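/- Let $\mathbb I=\mathbb Q\cap[0,1)$. An *atomic clock constraint* over a set of clocks has one of the forms $\lfloor x\rfloor\le k$, $\lfloor x\rfloor\equiv_m k$, $\{x\}=0$, $\lfloor x\rfloor-\lfloor y\rfloor\le k$, $\lfloor x\rfloor-\lfloor y\rfloor\equiv_m k$, $\{x\}\le\{y\}$, where $k\in\mathbb Z$, $m\ge 1$ and $\{x\}=x-\lfloor x\rfloor$; those of the forms $\{x\}=0$ and $\{x\}\le\{y\}$ are *fractional*. Clock constraints are boolean combinations of atomic ones. A *timed pushdown automaton* (TPDA) $\mathcal P$ consists of finite sets $\Sigma$ (input letters), $\Gamma$ (stack symbols), $L$ (control locations), $X$ (global clocks), $Z$ (stack clocks), and a finite set of rules $\langle\ell,\mathsf{op},r\rangle$ with $\ell,r\in L$, where $\mathsf{op}$ is one of: time elapse; reading $a\in\Sigma\cup\{\varepsilon\}$; a test of a clock constraint over $X$; a reset of a set $Y\subseteq X$; $\mathsf{push}(\gamma:\psi)$ or $\mathsf{pop}(\gamma:\psi)$ with $\gamma\in\Gamma$ and $\psi$ a clock constraint over $X\cup Z$. A configuration is a triple $(\ell,\mu,u)$ with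 $\ell\in L$, $\mu\in\mathbb Q_{\ge0}^X$ and a stack $u\in(\Gamma\times\mathbb Q_{\ge0}^Z)^*$. A time elapse adds an arbitrary $\delta\in\mathbb Q_{\ge0}$ to all global clocks and to all clocks on the stack; $\mathsf{push}(\gamma:\psi)$ pushes $(\gamma,\zeta)$ for some $\zeta\in\mathbb Q_{\ge0}^Z$ with $(\mu,\zeta)\models\psi$; $\mathsf{pop}(\gamma:\psi)$ pops a topmost $(\gamma,\zeta)$ with $(\mu,\zeta)\models\psi$; the other operations are the obvious ones. $\mathcal P$ is *fractional* if all atomic constraints in it are fractional. For $\ell,r\in L$, $\mu,\nu\in\mathbb Q_{\ge0}^X$ and $\pi\in\mathbb N^\Sigma$ write $\mu\leadsto^{\pi}_{\ell r}\nu$ if there is a run from $(\ell,\mu,\text{empty stack})$ to $(r,\nu,\text{empty stack})$ that reads each letter $a$ exactly $\pi(a)$ times. The *fractional reachability relation* of $\mathcal P$ is the family, indexed by $\ell,r\in L$, of the sets $$R_{\ell r}=\{(\{\mu\},\pi,\{\nu\}) : \mu\leadsto^{\pi}_{\ell r}\nu\}\subseteq\mathbb I^X\times\mathbb N^\Sigma\times\mathbb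 I^X .$$ *Linear arithmetic* is the two-sorted first-order logic of $(\mathbb Z,\le,(\equiv_m)_{m\ge 1},+,(k)_{k\in\mathbb Z})\uplus(\mathbb Q,\le,+,(k)_{k\in\mathbb Q})$; a formula is *existential* if it is a block of existential quantifiers followed by a quantifier-free formula. **Theorem.** There are an algorithm and a constant $c$ such that, on input any fractional TPDA $\mathcal P$, the algorithm outputs a family $\{\psi_{\ell r}(\vec x,\vec f,\vec x')\}_{\ell,r\in L}$ of existential formulas of linear arithmetic, with rational variables $\vec x,\vec x'$ indexed by $X$ and integer variables $\vec f$ indexed by $\Sigma$ as their only free variables, that expresses the fractional reachability relation: for all $\ell,r\in L$, $\alpha,\beta\in\mathbb I^X$ and $\pi\in\mathbb N^\Sigma$, $$(\alpha,\pi,\beta)\in R_{\ell r}\iff(\alpha,\pi,\beta)\models\psi_{\ell r}.$$ Its running time is exponential in the number of clocks and polynomial in the other parameters: with $n=|X|+|Z|$ and $N$ the length of the representation of $\mathcal P$, it is at most $2^{(n+1)^c}N^c$; and if the rules of $\mathcal P$ are listed without repetition and all constraints are conjunctions of pairwise distinct atomic constraints or negations of such, it is also at most $2^{(n+1)^c}(|L|+|\Gamma|+|\Sigma|+2)^c$.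 -/

import Mathlib

namespace TimedPDA

/-! ### Machine model: programs over binary trees, with a running time -/

/-- Binary trees: the data on which programs operate. -/
inductive Data : Type where
  | nil : Data
  | node : Data → Data → Data

namespace Data

/-- The number of nodes and leaves of a tree. -/
def size : Data → ℕ
  | nil => 1
  | node a b => a.size + b.size + 1

def fst : Data → Data
  | nil => nil
  | node a _ => a

def snd : Data → Data
  | nil => nil
  | node _ b => b

/-- A finite sequence of trees, as a right comb. -/
def list : List Data → Data
  | [] => nil
  | a :: l => node a (list l)

def bool : Bool → Data
  | false => nil
  | true => node nil nil

/-- Unary representation, used for sizes and indices of finite sets. -/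
def unary : ℕ → Data
  | 0 => nil
  | n + 1 => node nil (unary n)

/-- Binary representation (least significant bit first), used for numeric constants. -/
def binary (n : ℕ) : Data := list (n.bits.map bool)

def int (k : ℤ) : Data := node (bool (decide (k < 0))) (binary k.natAbs)

def rat (q : ℚ) : Data := node (int q.num) (binary q.den)

/-- A tree with a numeric label in front of it. -/
def tag (k : ℕ) (d : Data) : Data := node (unary k) d

end Data

/-- Structured programs transforming one tree. A test fails on `nil` and succeeds on every other
tree; `loop c p` is "while `c`, do `p`". -/
inductive Prog : Type where
  | skip : Prog
  | nil : Prog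
  | fst : Prog
  | snd : Prog
  | pair : Prog → Prog → Prog
  | comp : Prog → Prog → Prog
  | cond : Prog → Prog → Prog → Prog
  | loop : Prog → Prog → Prog

/-- `Runs p x y t`: on input `x`, the program `p` halts with output `y` in time `t`.
Every execution of an instruction, every test and every iteration is charged the size of the whole
tree it is applied to, i.e. the cost of scanning and copying that tree. Hence no tree that is built
is larger than the elapsed time, and this running time is polynomially related to that of
(multitape) Turing machines. -/
inductive Runs : Prog → Data → Data → ℕ → Prop where
  | skip (x : Data) : Runs .skip x x x.size
  | nil (x : Data) : Runs .nil x .nil x.size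
  | fst (x : Data) : Runs .fst x x.fst x.size
  | snd (x : Data) : Runs .snd x x.snd x.size
  | pair {p q : Prog} {x a b : Data} {s t : ℕ} :
      Runs p x a s → Runs q x b t → Runs (.pair p q) x (.node a b) (s + t + x.size)
  | comp {p q : Prog} {x y z : Data} {s t : ℕ} :
      Runs p x y s → Runs q y z t → Runs (.comp q p) x z (s + t + x.size)
  | condTrue {c p q : Prog} {x a b y : Data} {s t : ℕ} :
      Runs c x (.node a b) s → Runs p x y t → Runs (.cond c p q) x y (s + t + x.size)
  | condFalse {c p q : Prog} {x y : Data} {s t : ℕ} :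
      Runs c x .nil s → Runs q x y t → Runs (.cond c p q) x y (s + t + x.size)
  | loopDone {c p : Prog} {x : Data} {s : ℕ} :
      Runs c x .nil s → Runs (.loop c p) x x (s + x.size)
  | loopStep {c p : Prog} {x a b y z : Data} {s t u : ℕ} :
      Runs c x (.node a b) s → Runs p x y t → Runs (.loop c p) y z u →
      Runs (.loop c p) x z (s + t + u + x.size)

/-- Programs are deterministic, in their output and in their running time. -/
theorem Runs.deterministic {p : Prog} {x y : Data} {t : ℕ} (h : Runs p x y t) :
    ∀ {z : Data} {u : ℕ}, Runs p x z u → y = z ∧ t = u := by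
  induction h with
  | skip | nil | fst | snd => intro z u h'; cases h'; exact ⟨rfl, rfl⟩
  | pair _ _ ih₁ ih₂ =>
    intro z u h'
    cases h' with
    | pair h₁ h₂ =>
      obtain ⟨rfl, rfl⟩ := ih₁ h₁
      obtain ⟨rfl, rfl⟩ := ih₂ h₂
      exact ⟨rfl, rfl⟩
  | comp _ _ ih₁ ih₂ =>
    intro z u h'
    cases h' with
    | comp h₁ h₂ =>
      obtain ⟨rfl, rfl⟩ := ih₁ h₁
      obtain ⟨rfl, rfl⟩ := ih₂ h₂
      exact ⟨rfl, rfl⟩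
  | condTrue _ _ ih₁ ih₂ =>
    intro z u h'
    cases h' with
    | condTrue h₁ h₂ =>
      obtain ⟨-, rfl⟩ := ih₁ h₁
      obtain ⟨rfl, rfl⟩ := ih₂ h₂
      exact ⟨rfl, rfl⟩
    | condFalse h₁ h₂ => exact absurd (ih₁ h₁).1 (by simp)
  | condFalse _ _ ih₁ ih₂ =>
    intro z u h'
    cases h' with
    | condTrue h₁ h₂ => exact absurd (ih₁ h₁).1 (by simp)
    | condFalse h₁ h₂ =>
      obtain ⟨-, rfl⟩ := ih₁ h₁
      obtain ⟨rfl, rfl⟩ := ih₂ h₂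
      exact ⟨rfl, rfl⟩
  | loopDone _ ih =>
    intro z u h'
    cases h' with
    | loopDone h₁ => obtain ⟨-, rfl⟩ := ih h₁; exact ⟨rfl, rfl⟩
    | loopStep h₁ _ _ => exact absurd (ih h₁).1 (by simp)
  | loopStep _ _ _ ih₁ ih₂ ih₃ =>
    intro z u h'
    cases h' with
    | loopDone h₁ => exact absurd (ih₁ h₁).1 (by simp)
    | loopStep h₁ h₂ h₃ =>
      obtain ⟨-, rfl⟩ := ih₁ h₁
      obtain ⟨rfl, rfl⟩ := ih₂ h₂
      obtain ⟨rfl, rfl⟩ := ih₃ h₃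
      exact ⟨rfl, rfl⟩

/-- The running time bounds the size of the input and of the output. -/
theorem Runs.size_le {p : Prog} {x y : Data} {t : ℕ} (h : Runs p x y t) :
    x.size ≤ t ∧ y.size ≤ t := by
  induction h with
  | skip x => exact ⟨le_rfl, le_rfl⟩
  | nil x => exact ⟨le_rfl, by cases x <;> simp [Data.size]⟩
  | fst x =>
    refine ⟨le_rfl, ?_⟩
    cases x <;> simp [Data.fst, Data.size]
    omega
  | snd x =>
    refine ⟨le_rfl, ?_⟩
    cases x <;> simp [Data.snd, Data.size]
    omega
  | @pair _ _ x =>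
    have : 1 ≤ x.size := by cases x <;> simp [Data.size]
    simp only [Data.size]; omega
  | _ => omega

/-! ### Linear arithmetic over the integers and the rationals -/

/-- Terms of the integer sort. -/
inductive IntTerm : Type where
  | var : ℕ → IntTerm
  | const : ℤ → IntTerm
  | add : IntTerm → IntTerm → IntTerm

/-- Terms of the rational sort. -/
inductive RatTerm : Type where
  | var : ℕ → RatTerm
  | const : ℚ → RatTerm
  | add : RatTerm → RatTerm → RatTerm

namespace IntTerm

def eval (v : ℕ → ℤ) : IntTerm → ℤ
  | var i => v i
  | const k => k
  | add s t => s.eval v + t.eval v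

def vars : IntTerm → Set ℕ
  | var i => {i}
  | const _ => ∅
  | add s t => s.vars ∪ t.vars

def encode : IntTerm → Data
  | var i => .tag 0 (.unary i)
  | const k => .tag 1 (.int k)
  | add s t => .tag 2 (.node s.encode t.encode)

end IntTerm

namespace RatTerm

def eval (w : ℕ → ℚ) : RatTerm → ℚ
  | var i => w i
  | const k => k
  | add s t => s.eval w + t.eval w

def vars : RatTerm → Set ℕ
  | var i => {i}
  | const _ => ∅
  | add s t => s.vars ∪ t.vars

def encode : RatTerm → Data
  | var i => .tag 0 (.unary i)
  | const k => .tag 1 (.rat k)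
  | add s t => .tag 2 (.node s.encode t.encode)

end RatTerm

/-- Two-sorted first-order formulas over `(ℤ, ≤, (≡ₘ)ₘ, +, (k)ₖ) ⊎ (ℚ, ≤, +, (k)ₖ)`.
Integer variables and rational variables are numbered separately. -/
inductive Formula : Type where
  | verum : Formula
  | intLe : IntTerm → IntTerm → Formula
  | intEq : IntTerm → IntTerm → Formula
  | intMod : ℕ+ → IntTerm → IntTerm → Formula
  | ratLe : RatTerm → RatTerm → Formula
  | ratEq : RatTerm → RatTerm → Formula
  | neg : Formula → Formula
  | and : Formula → Formula → Formula
  | or : Formula → Formula → Formula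
  | exInt : ℕ → Formula → Formula
  | exRat : ℕ → Formula → Formula

namespace Formula

def Sat : Formula → (ℕ → ℤ) → (ℕ → ℚ) → Prop
  | verum, _, _ => True
  | intLe s t, v, _ => s.eval v ≤ t.eval v
  | intEq s t, v, _ => s.eval v = t.eval v
  | intMod m s t, v, _ => s.eval v ≡ t.eval v [ZMOD (m : ℕ)]
  | ratLe s t, _, w => s.eval w ≤ t.eval w
  | ratEq s t, _, w => s.eval w = t.eval w
  | neg φ, v, w => ¬ φ.Sat v w
  | and φ χ, v, w => φ.Sat v w ∧ χ.Sat v w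
  | or φ χ, v, w => φ.Sat v w ∨ χ.Sat v w
  | exInt i φ, v, w => ∃ k : ℤ, φ.Sat (Function.update v i k) w
  | exRat i φ, v, w => ∃ q : ℚ, φ.Sat v (Function.update w i q)

/-- The free variables of the integer sort. -/
def freeInt : Formula → Set ℕ
  | verum => ∅
  | intLe s t => s.vars ∪ t.vars
  | intEq s t => s.vars ∪ t.vars
  | intMod _ s t => s.vars ∪ t.vars
  | ratLe _ _ => ∅
  | ratEq _ _ => ∅
  | neg φ => φ.freeInt
  | and φ χ => φ.freeInt ∪ χ.freeInt
  | or φ χ => φ.freeInt ∪ χ.freeInt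
  | exInt i φ => φ.freeInt \ {i}
  | exRat _ φ => φ.freeInt

/-- The free variables of the rational sort. -/
def freeRat : Formula → Set ℕ
  | verum => ∅
  | intLe _ _ => ∅
  | intEq _ _ => ∅
  | intMod _ _ _ => ∅
  | ratLe s t => s.vars ∪ t.vars
  | ratEq s t => s.vars ∪ t.vars
  | neg φ => φ.freeRat
  | and φ χ => φ.freeRat ∪ χ.freeRat
  | or φ χ => φ.freeRat ∪ χ.freeRat
  | exInt _ φ => φ.freeRat
  | exRat i φ => φ.freeRat \ {i}

def QuantifierFree : Formula → Prop
  | neg φ => φ.QuantifierFree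
  | and φ χ => φ.QuantifierFree ∧ χ.QuantifierFree
  | or φ χ => φ.QuantifierFree ∧ χ.QuantifierFree
  | exInt _ _ => False
  | exRat _ _ => False
  | _ => True

/-- A block of existential quantifiers followed by a quantifier-free formula. -/
inductive Existential : Formula → Prop where
  | qf {φ : Formula} : φ.QuantifierFree → Existential φ
  | exInt (i : ℕ) {φ : Formula} : Existential φ → Existential (.exInt i φ)
  | exRat (i : ℕ) {φ : Formula} : Existential φ → Existential (.exRat i φ)

def encode : Formula → Data
  | verum => .tag 0 .nil
  | intLe s t => .tag 1 (.node s.encode t.encode)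
  | intEq s t => .tag 2 (.node s.encode t.encode)
  | intMod m s t => .tag 3 (.node (.binary m) (.node s.encode t.encode))
  | ratLe s t => .tag 4 (.node s.encode t.encode)
  | ratEq s t => .tag 5 (.node s.encode t.encode)
  | neg φ => .tag 6 φ.encode
  | and φ χ => .tag 7 (.node φ.encode χ.encode)
  | or φ χ => .tag 8 (.node φ.encode χ.encode)
  | exInt i φ => .tag 9 (.node (.unary i) φ.encode)
  | exRat i φ => .tag 10 (.node (.unary i) φ.encode)

end Formula

/-! ### Clock constraints -/

/-- Atomic clock constraints over a set `V` of clocks. -/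
inductive Atom (V : Type) : Type where
  /-- `⌊x⌋ ≤ k` -/
  | floorLe : V → ℤ → Atom V
  /-- `⌊x⌋ ≡ k (mod m)` -/
  | floorMod : ℕ+ → V → ℤ → Atom V
  /-- `{x} = 0` -/
  | fractZero : V → Atom V
  /-- `⌊x⌋ - ⌊y⌋ ≤ k` -/
  | floorDiffLe : V → V → ℤ → Atom V
  /-- `⌊x⌋ - ⌊y⌋ ≡ k (mod m)` -/
  | floorDiffMod : ℕ+ → V → V → ℤ → Atom V
  /-- `{x} ≤ {y}` -/
  | fractLe : V → V → Atom V

namespace Atom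

variable {V : Type}

def Sat (μ : V → ℚ≥0) : Atom V → Prop
  | floorLe x k => ⌊(μ x : ℚ)⌋ ≤ k
  | floorMod m x k => ⌊(μ x : ℚ)⌋ ≡ k [ZMOD (m : ℕ)]
  | fractZero x => Int.fract (μ x : ℚ) = 0
  | floorDiffLe x y k => ⌊(μ x : ℚ)⌋ - ⌊(μ y : ℚ)⌋ ≤ k
  | floorDiffMod m x y k => ⌊(μ x : ℚ)⌋ - ⌊(μ y : ℚ)⌋ ≡ k [ZMOD (m : ℕ)]
  | fractLe x y => Int.fract (μ x : ℚ) ≤ Int.fract (μ y : ℚ)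

def Fractional : Atom V → Prop
  | fractZero _ => True
  | fractLe _ _ => True
  | _ => False

def encode (e : V → Data) : Atom V → Data
  | floorLe x k => .tag 0 (.node (e x) (.int k))
  | floorMod m x k => .tag 1 (.node (.binary m) (.node (e x) (.int k)))
  | fractZero x => .tag 2 (e x)
  | floorDiffLe x y k => .tag 3 (.node (e x) (.node (e y) (.int k)))
  | floorDiffMod m x y k => .tag 4 (.node (.binary m) (.node (e x) (.node (e y) (.int k))))
  | fractLe x y => .tag 5 (.node (e x) (e y))

end Atom

/-- Boolean combinations of atomic clock constraints. -/
inductive Constraint (V : Type) : Type where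
  | verum : Constraint V
  | atom : Atom V → Constraint V
  | neg : Constraint V → Constraint V
  | and : Constraint V → Constraint V → Constraint V
  | or : Constraint V → Constraint V → Constraint V

namespace Constraint

variable {V : Type}

def Sat (μ : V → ℚ≥0) : Constraint V → Prop
  | verum => True
  | atom a => a.Sat μ
  | neg φ => ¬ φ.Sat μ
  | and φ χ => φ.Sat μ ∧ χ.Sat μ
  | or φ χ => φ.Sat μ ∨ χ.Sat μ

def Fractional : Constraint V → Prop
  | verum => True
  | atom a => a.Fractional
  | neg φ => φ.Fractional
  | and φ χ => φ.Fractional ∧ χ.Fractional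
  | or φ χ => φ.Fractional ∧ χ.Fractional

/-- An atomic constraint or its negation, e.g. `{x} < {y}` as the negation of `{y} ≤ {x}`. -/
def literal (b : Bool) (a : Atom V) : Constraint V :=
  if b then atom a else neg (atom a)

/-- The conjunction of a list of literals. -/
def conj : List (Bool × Atom V) → Constraint V
  | [] => verum
  | (b, a) :: l => and (literal b a) (conj l)

/-- Conjunctions of pairwise distinct literals. -/
def Conjunctive (φ : Constraint V) : Prop :=
  ∃ l : List (Bool × Atom V), l.Nodup ∧ φ = conj l

def encode (e : V → Data) : Constraint V → Data
  | verum => .tag 0 .nil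
  | atom a => .tag 1 (a.encode e)
  | neg φ => .tag 2 (φ.encode e)
  | and φ χ => .tag 3 (.node (φ.encode e) (χ.encode e))
  | or φ χ => .tag 4 (.node (φ.encode e) (χ.encode e))

end Constraint

/-! ### Timed pushdown automata -/

/-- Operations, for `s` input letters, `g` stack symbols, `m` global clocks and `n` stack clocks.
Stack constraints speak about the global clocks (`Sum.inl`) and the stack clocks (`Sum.inr`). -/
inductive Op (s g m n : ℕ) : Type where
  | elapse : Op s g m n
  /-- read an input letter, or `ε` (`none`) -/
  | input : Option (Fin s) → Op s g m n
  | test : Constraint (Fin m) → Op s g m n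
  | reset : Finset (Fin m) → Op s g m n
  | push : Fin g → Constraint (Fin m ⊕ Fin n) → Op s g m n
  | pop : Fin g → Constraint (Fin m ⊕ Fin n) → Op s g m n

namespace Op

variable {s g m n : ℕ}

def Fractional : Op s g m n → Prop
  | test φ => φ.Fractional
  | push _ φ => φ.Fractional
  | pop _ φ => φ.Fractional
  | _ => True

def Conjunctive : Op s g m n → Prop
  | test φ => φ.Conjunctive
  | push _ φ => φ.Conjunctive
  | pop _ φ => φ.Conjunctive
  | _ => True

def encodeGlobal (x : Fin m) : Data := .unary x

def encodeClock : Fin m ⊕ Fin n → Data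
  | .inl x => .tag 0 (.unary x)
  | .inr z => .tag 1 (.unary z)

def encode : Op s g m n → Data
  | elapse => .tag 0 .nil
  | input none => .tag 1 .nil
  | input (some a) => .tag 2 (.unary a)
  | test φ => .tag 3 (φ.encode encodeGlobal)
  | reset Y => .tag 4 (.list (List.ofFn fun x : Fin m => .bool (decide (x ∈ Y))))
  | push γ φ => .tag 5 (.node (.unary γ) (φ.encode encodeClock))
  | pop γ φ => .tag 6 (.node (.unary γ) (φ.encode encodeClock))

end Op

end TimedPDA

/-- A timed pushdown automaton. Its input alphabet, stack alphabet, set of control locations, set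
of global clocks and set of stack clocks are initial segments of the natural numbers; its set of
transition rules is presented as a list of triples (source, operation, target). -/
structure TPDA : Type where
  letters : ℕ
  stackSymbols : ℕ
  locations : ℕ
  globalClocks : ℕ
  stackClocks : ℕ
  rules : List (Fin locations × TimedPDA.Op letters stackSymbols globalClocks stackClocks ×
    Fin locations)

namespace TPDA

open TimedPDA

variable (P : TPDA)

abbrev Letter : Type := Fin P.letters
abbrev StackSymbol : Type := Fin P.stackSymbols
abbrev Loc : Type := Fin P.locations
abbrev Clock : Type := Fin P.globalClocks
abbrev StackClock : Type := Fin P.stackClocks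

/-- Only fractional constraints occur. -/
def Fractional : Prop := ∀ ρ ∈ P.rules, ρ.2.1.Fractional

/-- The rules are listed without repetition, and all constraints are conjunctions of pairwise
distinct atomic constraints or negations of such. -/
def Conjunctive : Prop := P.rules.Nodup ∧ ∀ ρ ∈ P.rules, ρ.2.1.Conjunctive

/-- The total number of clocks. -/
def clocks : ℕ := P.globalClocks + P.stackClocks

def encodeRule (ρ : P.Loc × Op P.letters P.stackSymbols P.globalClocks P.stackClocks × P.Loc) :
    Data :=
  .node (.unary ρ.1) (.node ρ.2.1.encode (.unary ρ.2.2))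

/-- The representation of a timed pushdown automaton as an input of a program. -/
def encode : Data :=
  .node (.unary P.letters) (.node (.unary P.stackSymbols) (.node (.unary P.locations)
    (.node (.unary P.globalClocks) (.node (.unary P.stackClocks)
      (.list (P.rules.map P.encodeRule))))))

/-- Configurations. The top of the timed stack is the head of the list. -/
structure Config : Type where
  loc : P.Loc
  val : P.Clock → ℚ≥0
  stack : List (P.StackSymbol × (P.StackClock → ℚ≥0))

/-- Transition labels: an input letter or `ε`, or a time increment. -/
abbrev Label : Type := Option P.Letter ⊕ ℚ≥0

/-- One-step transitions between configurations. -/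
inductive Step : P.Config → P.Label → P.Config → Prop where
  | elapse {ℓ r : P.Loc} (μ : P.Clock → ℚ≥0)
      (u : List (P.StackSymbol × (P.StackClock → ℚ≥0))) (δ : ℚ≥0)
      (h : (ℓ, Op.elapse, r) ∈ P.rules) :
      Step ⟨ℓ, μ, u⟩ (.inr δ) ⟨r, fun x => μ x + δ, u.map fun e => (e.1, fun z => e.2 z + δ)⟩
  | input {ℓ r : P.Loc} (μ : P.Clock → ℚ≥0)
      (u : List (P.StackSymbol × (P.StackClock → ℚ≥0))) (a : Option P.Letter)
      (h : (ℓ, Op.input a, r) ∈ P.rules) :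
      Step ⟨ℓ, μ, u⟩ (.inl a) ⟨r, μ, u⟩
  | test {ℓ r : P.Loc} (μ : P.Clock → ℚ≥0)
      (u : List (P.StackSymbol × (P.StackClock → ℚ≥0))) (φ : Constraint P.Clock)
      (h : (ℓ, Op.test φ, r) ∈ P.rules) (hφ : φ.Sat μ) :
      Step ⟨ℓ, μ, u⟩ (.inl none) ⟨r, μ, u⟩
  | reset {ℓ r : P.Loc} (μ : P.Clock → ℚ≥0)
      (u : List (P.StackSymbol × (P.StackClock → ℚ≥0))) (Y : Finset P.Clock)
      (h : (ℓ, Op.reset Y, r) ∈ P.rules) :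
      Step ⟨ℓ, μ, u⟩ (.inl none) ⟨r, fun x => if x ∈ Y then 0 else μ x, u⟩
  | push {ℓ r : P.Loc} (μ : P.Clock → ℚ≥0)
      (u : List (P.StackSymbol × (P.StackClock → ℚ≥0))) (γ : P.StackSymbol)
      (ψ : Constraint (P.Clock ⊕ P.StackClock)) (ζ : P.StackClock → ℚ≥0)
      (h : (ℓ, Op.push γ ψ, r) ∈ P.rules) (hψ : ψ.Sat (Sum.elim μ ζ)) :
      Step ⟨ℓ, μ, u⟩ (.inl none) ⟨r, μ, (γ, ζ) :: u⟩
  | pop {ℓ r : P.Loc} (μ : P.Clock → ℚ≥0)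
      (u : List (P.StackSymbol × (P.StackClock → ℚ≥0))) (γ : P.StackSymbol)
      (ψ : Constraint (P.Clock ⊕ P.StackClock)) (ζ : P.StackClock → ℚ≥0)
      (h : (ℓ, Op.pop γ ψ, r) ∈ P.rules) (hψ : ψ.Sat (Sum.elim μ ζ)) :
      Step ⟨ℓ, μ, (γ, ζ) :: u⟩ (.inl none) ⟨r, μ, u⟩

/-- Runs over finite sequences of labels. -/
inductive Run : P.Config → List P.Label → P.Config → Prop where
  | refl (c : P.Config) : Run c [] c
  | step {c d e : P.Config} {a : P.Label} {w : List P.Label} :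
      P.Step c a d → Run d w e → Run c (a :: w) e

/-- The input word read along a sequence of labels, without `ε`'s and time increments. -/
def untime (w : List P.Label) : List P.Letter := w.filterMap (Sum.elim id fun _ => none)

/-- The Parikh image: the number of occurrences of each input letter. -/
def parikh (w : List P.Label) (a : P.Letter) : ℕ := (P.untime w).count a

/-- The ternary reachability relation, with empty initial and final stacks. -/
def Reach (ℓ r : P.Loc) (μ : P.Clock → ℚ≥0) (π : P.Letter → ℕ) (ν : P.Clock → ℚ≥0) : Prop :=
  ∃ w : List P.Label, P.Run ⟨ℓ, μ, []⟩ w ⟨r, ν, []⟩ ∧ P.parikh w = π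

/-- The fractional reachability relation: the relation induced by the ternary reachability relation
on the fractional parts of the initial and final values of the global clocks. -/
def FractReach (ℓ r : P.Loc) (a : P.Clock → Set.Ico (0 : ℚ) 1) (π : P.Letter → ℕ)
    (b : P.Clock → Set.Ico (0 : ℚ) 1) : Prop :=
  ∃ μ ν : P.Clock → ℚ≥0, P.Reach ℓ r μ π ν ∧
    (∀ x, Int.fract (μ x : ℚ) = a x) ∧ ∀ x, Int.fract (ν x : ℚ) = b x

/-- The fractional reachability relation is expressed by the family `ψ`: in each formula the
integer variable `i` stands for the number of occurrences of letter `i`, the rational variable `x`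
for the fractional part of the initial value of clock `x`, the rational variable `globalClocks + x`
for the fractional part of its final value, and there are no other free variables. -/
def FractExpressedBy (ψ : P.Loc → P.Loc → Formula) : Prop :=
  ∀ ℓ r : P.Loc,
    (∀ i ∈ (ψ ℓ r).freeInt, i < P.letters) ∧
    (∀ i ∈ (ψ ℓ r).freeRat, i < P.globalClocks + P.globalClocks) ∧
    ∀ (a : P.Clock → Set.Ico (0 : ℚ) 1) (π : P.Letter → ℕ) (b : P.Clock → Set.Ico (0 : ℚ) 1)
      (v : ℕ → ℤ) (w : ℕ → ℚ),
      (∀ i : P.Letter, v i = π i) → (∀ x : P.Clock, w x = a x) →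
      (∀ x : P.Clock, w (P.globalClocks + x) = b x) →
      (P.FractReach ℓ r a π b ↔ (ψ ℓ r).Sat v w)

/-- The representation of a family of formulas as an output of a program: the matrix of the
formulas, row by row. -/
def encodeFamily (ψ : P.Loc → P.Loc → Formula) : Data :=
  .list (List.ofFn fun ℓ => .list (List.ofFn fun r => (ψ ℓ r).encode))

end TPDA

/-! Time stamps. Instead of its value, remember for each clock the moment modulo 1 at which it was
last zero: the current time minus the value. Stamps do not age. A time elapse moves only the current
time, and modulo 1 it can move it anywhere; a reset copies the current time into a clock; the stamps
of a stack frame are the same when it is popped as when it was pushed. The fractional part of a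
clock is the distance from its stamp to the current time around the circle, so a fractional
constraint depends only on the order of the stamps and the current time in the unit interval
(`Constraint.sat_iff_ordSat`). Hence runs with empty stack at both ends are described by an
inductive relation `TPDA.Sem` over an arbitrary linear order, with rules for the empty run,
concatenation, a single operation, and a matching push and pop around a run (`TPDA.Sem.exists_run`,
`TPDA.Run.semStack`).

Grammar. Over a dense order without endpoints every finite order-preserving partial map extends to
further finitely many points (`exists_extension`). So whether two stamp assignments are related by
`Sem` depends only on their joint order type, and the existentially chosen intermediate or stack
stamps can be supplied for any representative of the type. This gives a context-free grammar whose
nonterminals are triples of two locations and an order type and whose productions mirror the rules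
of `Sem`. Completeness (`TPDA.Sem.mem_lang`) holds over any linear order, soundness
(`TPDA.sem_of_mem_lang`) over dense ones without endpoints. For the latter, stamps are shifted from
`[0,1)` into `(0,1)` (`TPDA.exists_shift`).

Formula. A vector of production counts belongs to a derivation exactly when each nonterminal is
produced as often as it is rewritten and every rewritten nonterminal is reachable from the start
(`Grammar.gen_of_balanced`). Reachability is certified by integer ranks, which makes the Parikh
image existentially definable. The formula guesses initial and final stamps in `(0,1)` that fit the
given fractional parts, and is a disjunction over order types of "the stamps have this type" and
"the letter counts are in the Parikh image of this nonterminal".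

Time. The calculus `PF` of polynomial-time functions is closed under the usual list operations, and
`fun_prop` assembles the programs. Everything is polynomial in the automaton together with the list
of tuples representing order types. Only that list is large, with `K ^ K` tuples for `K` linear in
the number of clocks; this yields the first bound. For the second, automata with conjunctive
constraints have few possible rules, each of small size, so that the input itself is short
(`TPDA.size_le`). -/

namespace TimedPDA

/-! ### Polynomial-time computable functions between encoded types -/

/-- Types whose elements are represented by trees. -/
class Enc (α : Type) where
  enc : α → Data

open Enc (enc)

/-- The size of the representation. -/
def sz {α : Type} [Enc α] (a : α) : ℕ := (enc a).size

theorem Data.one_le_size (d : Data) : 1 ≤ d.size := by cases d <;> simp [Data.size]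

theorem one_le_sz {α : Type} [Enc α] (a : α) : 1 ≤ sz a := Data.one_le_size _

instance : Enc Data := ⟨id⟩
instance : Enc Unit := ⟨fun _ => .nil⟩
instance : Enc ℕ := ⟨Data.unary⟩
instance : Enc Bool := ⟨Data.bool⟩
instance {α β : Type} [Enc α] [Enc β] : Enc (α × β) := ⟨fun p => .node (enc p.1) (enc p.2)⟩
instance {α : Type} [Enc α] : Enc (List α) := ⟨fun l => .list (l.map enc)⟩
instance : Enc IntTerm := ⟨IntTerm.encode⟩
instance : Enc RatTerm := ⟨RatTerm.encode⟩
instance : Enc Formula := ⟨Formula.encode⟩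

variable {α β γ σ : Type} [Enc α] [Enc β] [Enc γ] [Enc σ]

/-- Polynomially bounded in the size of the argument. -/
def PB (g : α → ℕ) : Prop := ∃ c, ∀ a, g a ≤ (sz a + 1) ^ c

namespace PB

theorem mono {g h : α → ℕ} (hh : PB h) (H : ∀ a, g a ≤ h a) : PB g :=
  let ⟨c, hc⟩ := hh
  ⟨c, fun a => (H a).trans (hc a)⟩

theorem size : PB (fun a : α => sz a) := ⟨1, fun a => by simp⟩

theorem const (k : ℕ) : PB (fun _ : α => k) := ⟨k, fun a => by
  have : k ≤ 2 ^ k := Nat.lt_two_pow_self.le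
  exact this.trans (Nat.pow_le_pow_left (by have := one_le_sz a; omega) _)⟩

theorem mul {g h : α → ℕ} (hg : PB g) (hh : PB h) : PB (fun a => g a * h a) := by
  obtain ⟨c, hc⟩ := hg
  obtain ⟨d, hd⟩ := hh
  exact ⟨c + d, fun a => by rw [pow_add]; exact Nat.mul_le_mul (hc a) (hd a)⟩

theorem add {g h : α → ℕ} (hg : PB g) (hh : PB h) : PB (fun a => g a + h a) := by
  obtain ⟨c, hc⟩ := hg
  obtain ⟨d, hd⟩ := hh
  refine ⟨max c d + 1, fun a => ?_⟩
  have h1 : 1 ≤ sz a := one_le_sz a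
  have e1 : (sz a + 1) ^ c ≤ (sz a + 1) ^ max c d :=
    Nat.pow_le_pow_right (by omega) (le_max_left _ _)
  have e2 : (sz a + 1) ^ d ≤ (sz a + 1) ^ max c d :=
    Nat.pow_le_pow_right (by omega) (le_max_right _ _)
  have := hc a
  have := hd a
  rw [pow_succ]
  nlinarith

theorem pow {g : α → ℕ} (hg : PB g) (k : ℕ) : PB (fun a => g a ^ k) := by
  obtain ⟨c, hc⟩ := hg
  exact ⟨c * k, fun a => by rw [pow_mul]; exact Nat.pow_le_pow_left (hc a) _⟩

theorem comp {f : α → β} {g : β → ℕ} (hg : PB g) (hf : PB fun a => sz (f a)) :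
    PB (fun a => g (f a)) := by
  obtain ⟨c, hc⟩ := hg
  exact ((hf.add (const 1)).pow c).mono fun a => hc (f a)

end PB

/-- Functions computed by a program in time polynomial in the size of the argument. -/
@[fun_prop]
def PF (f : α → β) : Prop :=
  ∃ (p : Prog) (c : ℕ), ∀ a, ∃ t, Runs p (enc a) (enc (f a)) t ∧ t ≤ (sz a + 1) ^ c

namespace PF

theorem of_time {f : α → β} (p : Prog) {T : α → ℕ} (hT : PB T)
    (h : ∀ a, ∃ t, Runs p (enc a) (enc (f a)) t ∧ t ≤ T a) : PF f := by
  obtain ⟨c, hc⟩ := hT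
  exact ⟨p, c, fun a => let ⟨t, h1, h2⟩ := h a; ⟨t, h1, h2.trans (hc a)⟩⟩

theorem time {f : α → β} (hf : PF f) :
    ∃ (p : Prog) (T : α → ℕ), PB T ∧ ∀ a, ∃ t, Runs p (enc a) (enc (f a)) t ∧ t ≤ T a := by
  obtain ⟨p, c, h⟩ := hf
  exact ⟨p, _, ⟨c, fun a => le_rfl⟩, h⟩

theorem size {f : α → β} (hf : PF f) : PB fun a => sz (f a) := by
  obtain ⟨p, c, h⟩ := hf
  exact ⟨c, fun a => let ⟨t, h1, h2⟩ := h a; h1.size_le.2.trans h2⟩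

/-- Replacing the result by something with the same representation. -/
theorem recode {f : α → β} (hf : PF f) {g : α → γ} (h : ∀ a, enc (g a) = enc (f a)) : PF g := by
  obtain ⟨p, c, hp⟩ := hf
  exact ⟨p, c, fun a => by rw [h]; exact hp a⟩

/-- Replacing the argument by something with the same representation. -/
theorem recodeArg {f : α → β} (hf : PF f) {g : γ → β} (e : γ → α) (he : ∀ c, enc (e c) = enc c)
    (h : ∀ c, enc (g c) = enc (f (e c))) : PF g := by
  obtain ⟨p, c, hp⟩ := hf
  refine ⟨p, c, fun a => ?_⟩
  obtain ⟨t, h1, h2⟩ := hp (e a)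
  exact ⟨t, by rw [h, ← he a]; exact h1, by simpa only [sz, he a] using h2⟩

@[fun_prop]
theorem id' : PF (fun a : α => a) :=
  of_time .skip PB.size fun _ => ⟨_, .skip _, le_rfl⟩

@[fun_prop]
theorem comp {f : α → β} {g : β → γ} (hg : PF g) (hf : PF f) : PF (fun a => g (f a)) := by
  obtain ⟨p, T, hT, hp⟩ := hf.time
  obtain ⟨q, U, hU, hq⟩ := hg.time
  refine of_time (.comp q p) ((hT.add (hU.comp hf.size)).add PB.size) fun a => ?_
  obtain ⟨s, h1, h2⟩ := hp a
  obtain ⟨t, h3, h4⟩ := hq (f a)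
  exact ⟨_, .comp h1 h3, Nat.add_le_add_right (Nat.add_le_add h2 h4) _⟩

@[fun_prop]
theorem prodMk {f : α → β} {g : α → γ} (hf : PF f) (hg : PF g) : PF (fun a => (f a, g a)) := by
  obtain ⟨p, T, hT, hp⟩ := hf.time
  obtain ⟨q, U, hU, hq⟩ := hg.time
  refine of_time (.pair p q) ((hT.add hU).add PB.size) fun a => ?_
  obtain ⟨s, h1, h2⟩ := hp a
  obtain ⟨t, h3, h4⟩ := hq a
  exact ⟨_, .pair h1 h3, Nat.add_le_add_right (Nat.add_le_add h2 h4) _⟩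

theorem dataNode {f g : α → Data} (hf : PF f) (hg : PF g) :
    PF (fun a => Data.node (f a) (g a)) := (hf.prodMk hg).recode fun _ => rfl

@[fun_prop]
theorem const (b : β) : PF (fun _ : α => b) := by
  suffices ∀ d : Data, PF (fun _ : α => d) from (this (enc b)).recode fun _ => rfl
  intro d
  induction d with
  | nil => exact of_time .nil PB.size fun a => ⟨_, .nil _, le_rfl⟩
  | node a b ha hb => exact dataNode ha hb

@[fun_prop]
theorem fst : PF (fun p : α × β => p.1) :=
  of_time .fst PB.size fun p => ⟨_, .fst (enc p), le_rfl⟩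

@[fun_prop]
theorem snd : PF (fun p : α × β => p.2) :=
  of_time .snd PB.size fun p => ⟨_, .snd (enc p), le_rfl⟩

@[fun_prop]
theorem dataFst : PF Data.fst := of_time .fst PB.size fun p => ⟨_, .fst (enc p), le_rfl⟩

@[fun_prop]
theorem dataSnd : PF Data.snd := of_time .snd PB.size fun p => ⟨_, .snd (enc p), le_rfl⟩

theorem ite {c : α → Bool} {f g : α → β} (hc : PF c) (hf : PF f) (hg : PF g) :
    PF (fun a => if c a = true then f a else g a) := by
  obtain ⟨r, V, hV, hr⟩ := hc.time
  obtain ⟨p, T, hT, hp⟩ := hf.time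
  obtain ⟨q, U, hU, hq⟩ := hg.time
  refine of_time (.cond r p q) (((hV.add hT).add hU).add PB.size) fun a => ?_
  obtain ⟨v, h5, h6⟩ := hr a
  cases h : c a
  · obtain ⟨t, h3, h4⟩ := hq a
    rw [h] at h5
    exact ⟨_, .condFalse h5 (by simpa using h3), by simp only [sz] at *; omega⟩
  · obtain ⟨t, h3, h4⟩ := hp a
    rw [h] at h5
    exact ⟨_, .condTrue h5 (by simpa using h3), by simp only [sz] at *; omega⟩

@[fun_prop]
theorem cond {c : α → Bool} {f g : α → β} (hc : PF c) (hf : PF f) (hg : PF g) :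
    PF (fun a => bif c a then f a else g a) := by
  simpa only [cond_eq_ite] using hc.ite hf hg

@[fun_prop]
theorem not {c : α → Bool} (hc : PF c) : PF (fun a => !c a) := by
  have := hc.cond (const (α := α) false) (const true)
  exact this.recode fun a => by cases c a <;> rfl

@[fun_prop]
theorem and {c d : α → Bool} (hc : PF c) (hd : PF d) : PF (fun a => c a && d a) := by
  have := hc.cond hd (const false)
  exact this.recode fun a => by cases c a <;> rfl

@[fun_prop]
theorem or {c d : α → Bool} (hc : PF c) (hd : PF d) : PF (fun a => c a || d a) := by
  have := hc.cond (const true) hd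
  exact this.recode fun a => by cases c a <;> rfl

@[fun_prop]
theorem beqBool {c d : α → Bool} (hc : PF c) (hd : PF d) : PF (fun a => c a == d a) := by
  have := hc.cond hd hd.not
  exact this.recode fun a => by cases c a <;> cases d a <;> rfl

@[fun_prop]
theorem cons {f : α → β} {g : α → List β} (hf : PF f) (hg : PF g) : PF (fun a => f a :: g a) :=
  (hf.prodMk hg).recode fun _ => rfl

/-- Case distinction on a list. -/
theorem listCases {l : α → List β} {f : α → γ} {g : α → β → List β → γ} (hl : PF l) (hf : PF f)
    (hg : PF fun p : α × β × List β => g p.1 p.2.1 p.2.2) :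
    PF (fun a => match l a with
      | [] => f a
      | b :: t => g a b t) := by
  obtain ⟨r, V, hV, hr⟩ := hl.time
  obtain ⟨p, T, hT, hp⟩ := hf.time
  obtain ⟨q, U, hU, hq⟩ := hg.time
  obtain ⟨e, hU⟩ := hU
  -- A nonempty list is encoded as the pair of its head and tail, so the output of `r` already is
  -- the argument `(b, t)` of the second branch, and pairing it with the input suffices.
  refine of_time (.cond r (.comp q (.pair .skip r)) p)
    (T := fun a => V a + (T a + (V a + sz a + sz a + (sz a + V a + 2) ^ e + sz a)) + sz a)
    ((hV.add (hT.add ((((hV.add PB.size).add PB.size).add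
      (((PB.size.add hV).add (PB.const 2)).pow e)).add PB.size))).add PB.size) fun a => ?_
  obtain ⟨v, h5, h6⟩ := hr a
  cases h : l a with
  | nil =>
    obtain ⟨t, h3, h4⟩ := hp a
    rw [h] at h5
    exact ⟨_, .condFalse h5 h3, by simp only [sz] at *; omega⟩
  | cons b t =>
    obtain ⟨u, h3, h4⟩ := hq (a, b, t)
    rw [h] at h5
    refine ⟨_, .condTrue h5 (.comp (.pair (.skip _) h5) h3), ?_⟩
    have h7 : sz (a, b, t) + 1 ≤ sz a + V a + 2 := by
      have : (Data.node (enc b) (enc t)).size ≤ v := h5.size_le.2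
      change ((enc a).size + (Data.node (enc b) (enc t)).size + 1) + 1 ≤ (enc a).size + V a + 2
      omega
    have h8 := (h4.trans (hU _)).trans (Nat.pow_le_pow_left h7 e)
    simp only [sz] at *
    omega

/-- Running a loop, with a bound on the number of iterations and on the sizes of the states. -/
theorem loop_runs {f : σ → σ} {c : σ → Bool} (hf : PF f) (hc : PF c) :
    ∃ (p : Prog) (e : ℕ), ∀ (k : ℕ) (s : σ) (B : ℕ), (∀ i < k, c (f^[i] s) = true) →
      c (f^[k] s) = false → (∀ i ≤ k, sz (f^[i] s) ≤ B) →
      ∃ t, Runs p (enc s) (enc (f^[k] s)) t ∧ t ≤ (k + 1) * (B + 2) ^ e := by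
  obtain ⟨r, c1, hr⟩ := hc
  obtain ⟨p, c2, hp⟩ := hf
  refine ⟨.loop r p, c1 + c2 + 3, fun k => ?_⟩
  have key : ∀ (s : σ) (B : ℕ), sz s ≤ B → (sz s + 1) ^ c1 + (sz s + 1) ^ c2 + sz s ≤
      (B + 2) ^ (c1 + c2 + 3) := by
    intro s B h
    have e1 : (sz s + 1) ^ c1 ≤ (B + 2) ^ (c1 + c2 + 1) :=
      (Nat.pow_le_pow_left (by omega) _).trans (Nat.pow_le_pow_right (by omega) (by omega))
    have e2 : (sz s + 1) ^ c2 ≤ (B + 2) ^ (c1 + c2 + 1) :=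
      (Nat.pow_le_pow_left (by omega) _).trans (Nat.pow_le_pow_right (by omega) (by omega))
    have e3 : sz s ≤ (B + 2) ^ (c1 + c2 + 1) :=
      (show sz s ≤ (B + 2) ^ 1 by rw [pow_one]; omega).trans (Nat.pow_le_pow_right (by omega) (by omega))
    have e4 : (B + 2) ^ (c1 + c2 + 3) = (B + 2) ^ (c1 + c2 + 1) * (B + 2) ^ 2 := by
      rw [← pow_add]
    have e5 : 4 ≤ (B + 2) ^ 2 := by nlinarith
    rw [e4]
    nlinarith
  induction k with
  | zero =>
    intro s B _ h0 hB
    obtain ⟨t, h1, h2⟩ := hr s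
    have h0' : c s = false := h0
    rw [h0'] at h1
    refine ⟨_, .loopDone h1, ?_⟩
    have := key s B (hB 0 le_rfl)
    simp only [sz] at *
    omega
  | succ k ih =>
    intro s B hk h0 hB
    obtain ⟨t, h1, h2⟩ := hr s
    have h0' : c s = true := hk 0 (by omega)
    rw [h0'] at h1
    obtain ⟨u, h3, h4⟩ := hp s
    obtain ⟨w, h5, h6⟩ := ih (f s) B (fun i hi => hk (i + 1) (by omega)) h0
      (fun i hi => hB (i + 1) (by omega))
    refine ⟨_, .loopStep h1 h3 h5, ?_⟩
    have := key s B (hB 0 (by omega))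
    have e : (k + 1 + 1) * (B + 2) ^ (c1 + c2 + 3) =
      (k + 1) * (B + 2) ^ (c1 + c2 + 3) + (B + 2) ^ (c1 + c2 + 3) := by ring
    rw [e]
    simp only [sz] at *
    omega

/-- A polynomial bound on the number of iterations does not suffice, since a polynomial-time body
may square the size of the state each time. Therefore the sizes of all intermediate states are
bounded separately. -/
theorem loop {f : σ → σ} {c : σ → Bool} {init : α → σ} {g : α → σ} {K B : α → ℕ}
    (hf : PF f) (hc : PF c) (hinit : PF init) (hK : PB K) (hB : PB B)
    (h : ∀ a, ∃ k ≤ K a, (∀ i < k, c (f^[i] (init a)) = true) ∧ c (f^[k] (init a)) = false ∧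
      (∀ i ≤ k, sz (f^[i] (init a)) ≤ B a) ∧ g a = f^[k] (init a)) : PF g := by
  obtain ⟨p, e, hp⟩ := loop_runs hf hc
  obtain ⟨q, T, hT, hq⟩ := hinit.time
  refine of_time (.comp p q) ((hT.add ((hK.add (PB.const 1)).mul
    ((hB.add (PB.const 2)).pow e))).add PB.size) fun a => ?_
  obtain ⟨k, hk, h1, h2, h3, h4⟩ := h a
  obtain ⟨t, h5, h6⟩ := hp k (init a) (B a) h1 h2 h3
  obtain ⟨u, h7, h8⟩ := hq a
  rw [h4]
  refine ⟨_, .comp h7 h5, Nat.add_le_add_right (Nat.add_le_add h8 (h6.trans ?_)) _⟩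
  exact Nat.mul_le_mul_right _ (by omega)

/-- One step of a left fold. -/
def foldStep {α β σ : Type} (f : α → σ → β → σ) (s : (α × σ) × List β) : (α × σ) × List β :=
  match s.2 with
  | [] => s
  | b :: t => ((s.1.1, f s.1.1 s.1.2 b), t)

theorem foldStep_iterate {α β σ : Type} (f : α → σ → β → σ) (a : α) (l : List β) (s : σ) {k : ℕ}
    (hk : k ≤ l.length) :
    (foldStep f)^[k] ((a, s), l) = ((a, (l.take k).foldl (f a) s), l.drop k) := by
  induction k generalizing s l with
  | zero => rfl
  | succ k ih =>
    cases l with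
    | nil => simp at hk
    | cons b t =>
      rw [Function.iterate_succ_apply]
      exact ih t (f a s b) (by simpa using hk)

/-- Running a left fold, with a bound on the sizes of the intermediate results. -/
theorem foldl_runs {f : α → σ → β → σ} (hf : PF fun p : (α × σ) × β => f p.1.1 p.1.2 p.2) :
    ∃ (p : Prog) (e : ℕ), ∀ (a : α) (s : σ) (l : List β) (B : ℕ),
      (∀ l', l' <+: l → sz (l'.foldl (f a) s) ≤ B) →
      ∃ t, Runs p (enc ((a, s), l)) (enc (l.foldl (f a) s)) t ∧
        t ≤ (sz a + sz l + B + 4) ^ e := by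
  have hstep : PF (foldStep f) :=
    listCases (l := fun s : (α × σ) × List β => s.2) (f := fun s => s)
      (g := fun s b t => ((s.1.1, f s.1.1 s.1.2 b), t)) (by fun_prop) (by fun_prop)
      ((fst.comp (fst.comp fst)).prodMk (hf.comp (g := fun p : (α × σ) × β => f p.1.1 p.1.2 p.2)
        ((fst.comp fst).prodMk (fst.comp snd))) |>.prodMk (snd.comp snd))
  have hc : PF (fun s : (α × σ) × List β => match s.2 with
      | [] => false
      | _ :: _ => true) :=
    listCases (f := fun _ => false) (g := fun _ _ _ => true) (by fun_prop) (by fun_prop)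
      (by fun_prop)
  obtain ⟨p, e, hp⟩ := loop_runs hstep hc
  -- The loop ends in the state `((a, result), [])`, from which the result is projected. The bound
  -- `B` stays a free parameter, so that folds with exponentially large results are covered too.
  refine ⟨.comp (.comp .snd .fst) p, e + 4, fun a s l B hB => ?_⟩
  have hlen : l.length + 1 ≤ sz l := by
    clear hB
    induction l with
    | nil => simp [sz, enc, Data.list, Data.size]
    | cons b t ih =>
      have : sz (b :: t) = sz b + sz t + 1 := rfl
      simp only [List.length_cons]
      omega
  have hdrop : ∀ k, sz (l.drop k) ≤ sz l := by
    clear hB hlen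
    induction l with
    | nil => simp
    | cons b t ih =>
      intro k
      have : sz (b :: t) = sz b + sz t + 1 := rfl
      cases k with
      | zero => simp
      | succ k => rw [List.drop_succ_cons]; have := ih k; omega
  have hsz : ∀ i ≤ l.length, sz ((foldStep f)^[i] ((a, s), l)) ≤ sz a + sz l + B + 2 := by
    intro i hi
    rw [foldStep_iterate f a l s hi]
    have h1 := hdrop i
    have h2 := hB _ (List.take_prefix i l)
    have h3 : sz ((a, (l.take i).foldl (f a) s), l.drop i) =
      (sz a + sz ((l.take i).foldl (f a) s) + 1) + sz (l.drop i) + 1 := rfl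
    omega
  have hc1 : ∀ i < l.length, (match ((foldStep f)^[i] ((a, s), l)).2 with
      | [] => false
      | _ :: _ => true) = true := by
    intro i hi
    rw [foldStep_iterate f a l s hi.le]
    cases h : l.drop i with
    | nil => rw [List.drop_eq_nil_iff] at h; omega
    | cons b t => rfl
  have hc2 : (match ((foldStep f)^[l.length] ((a, s), l)).2 with
      | [] => false
      | _ :: _ => true) = false := by
    rw [foldStep_iterate f a l s le_rfl, List.drop_length]
  obtain ⟨t, h1, h2⟩ := hp l.length ((a, s), l) (sz a + sz l + B + 2) hc1 hc2 hsz
  rw [foldStep_iterate f a l s le_rfl, List.take_length, List.drop_length] at h1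
  refine ⟨_, .comp h1 (.comp (.fst _) (.snd _)), ?_⟩
  have h3 := h1.size_le
  have h4 : t ≤ (sz a + sz l + B + 4) ^ (e + 1) := by
    refine h2.trans ?_
    rw [pow_succ, mul_comm]
    exact Nat.mul_le_mul_left _ (by omega)
  have h5 : ((enc ((a, l.foldl (f a) s), ([] : List β))).fst).size ≤
      (enc ((a, l.foldl (f a) s), ([] : List β))).size := by
    change (enc (a, l.foldl (f a) s)).size ≤
      (enc (a, l.foldl (f a) s)).size + (enc ([] : List β)).size + 1
    omega
  have h6 : (enc ((a, s), l)).size ≤ t := h3.1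
  have h7 : (sz a + sz l + B + 4) ^ (e + 4) =
      (sz a + sz l + B + 4) ^ (e + 1) * (sz a + sz l + B + 4) ^ 3 := by rw [← pow_add]
  have h8 : 4 ^ 3 ≤ (sz a + sz l + B + 4) ^ 3 := Nat.pow_le_pow_left (by omega) 3
  have h9 := Nat.mul_le_mul h4 h8
  rw [h7]
  omega

theorem foldl {f : α → σ → β → σ} {s : α → σ} {l : α → List β} {B : α → ℕ}
    (hf : PF fun p : (α × σ) × β => f p.1.1 p.1.2 p.2) (hs : PF s) (hl : PF l) (hB : PB B)
    (h : ∀ a l', l' <+: l a → sz (l'.foldl (f a) (s a)) ≤ B a) :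
    PF (fun a => (l a).foldl (f a) (s a)) := by
  obtain ⟨p, e, hp⟩ := foldl_runs hf
  obtain ⟨q, T, hT, hq⟩ := ((id'.prodMk hs).prodMk hl).time
  refine of_time (.comp p q) ((hT.add ((((PB.size.add hl.size).add hB).add (PB.const 4)).pow
    e)).add PB.size) fun a => ?_
  obtain ⟨t, h5, h6⟩ := hp a (s a) (l a) (B a) (h a)
  obtain ⟨u, h7, h8⟩ := hq a
  exact ⟨_, .comp h7 h5, Nat.add_le_add_right (Nat.add_le_add h8 h6) _⟩

end PF

end TimedPDA

namespace TimedPDA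

open Enc (enc)

variable {α β γ σ : Type} [Enc α] [Enc β] [Enc γ] [Enc σ]

/-! ### Sizes of representations -/

theorem sz_prod (a : α) (b : β) : sz (a, b) = sz a + sz b + 1 := rfl

theorem sz_nil : sz ([] : List α) = 1 := rfl

theorem sz_cons (a : α) (l : List α) : sz (a :: l) = sz a + sz l + 1 := rfl

theorem sz_nat (n : ℕ) : sz n = 2 * n + 1 := by
  induction n with
  | zero => rfl
  | succ n ih =>
    have : sz (n + 1) = 1 + sz n + 1 := rfl
    omega

theorem sz_bool_le (b : Bool) : sz b ≤ 3 := by cases b <;> decide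

theorem sz_append (l m : List α) : sz (l ++ m) + 1 = sz l + sz m := by
  induction l with
  | nil => rw [List.nil_append, sz_nil]; omega
  | cons a l ih => rw [List.cons_append, sz_cons, sz_cons]; omega

theorem sz_reverse (l : List α) : sz l.reverse = sz l := by
  induction l with
  | nil => rfl
  | cons a l ih =>
    have := sz_append l.reverse [a]
    rw [List.reverse_cons, sz_cons]
    rw [sz_cons, sz_nil] at this
    omega

theorem length_lt_sz (l : List α) : l.length < sz l := by
  induction l with
  | nil => exact Nat.zero_lt_one
  | cons a l ih => rw [sz_cons, List.length_cons]; omega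

theorem sz_le_of_mem {a : α} {l : List α} (h : a ∈ l) : sz a < sz l := by
  induction l with
  | nil => simp at h
  | cons b l ih =>
    rw [sz_cons]
    rcases List.mem_cons.1 h with rfl | h
    · omega
    · have := ih h
      omega

theorem sz_list_le {l : List α} {B : ℕ} (h : ∀ a ∈ l, sz a ≤ B) :
    sz l ≤ 1 + l.length * (B + 1) := by
  induction l with
  | nil => simp [sz_nil]
  | cons b l ih =>
    have h1 := ih fun a ha => h a (List.mem_cons_of_mem _ ha)
    have h2 := h b List.mem_cons_self
    rw [sz_cons, List.length_cons, add_mul]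
    omega

theorem sz_prefix {l m : List α} (h : l <+: m) : sz l ≤ sz m := by
  obtain ⟨k, rfl⟩ := h
  have := sz_append l k
  have := one_le_sz k
  omega

/-- Unary numbers and lists of units have the same trees, so arithmetic and recursion on numbers
reduce to list operations. -/
theorem enc_nat (n : ℕ) : enc (List.replicate n ()) = enc n := by
  induction n with
  | zero => rfl
  | succ n ih =>
    have h1 : enc (n + 1) = Data.node .nil (enc n) := rfl
    have h2 : enc (List.replicate (n + 1) ()) = Data.node .nil (enc (List.replicate n ())) := rfl
    rw [h1, h2, ih]

namespace PF

/-! ### Lists -/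

theorem foldl_cons_eq {β : Type} (l m : List β) :
    l.foldl (fun acc b => b :: acc) m = l.reverse ++ m := by
  induction l generalizing m with
  | nil => rfl
  | cons a l ih => simp [ih]

theorem reverseAppend {f g : α → List β} (hf : PF f) (hg : PF g) :
    PF (fun a => (f a).reverse ++ g a) := by
  have := foldl (f := fun (_ : α) acc (b : β) => b :: acc) (by fun_prop) hg hf
    (hf.size.add hg.size) fun a l' hl' => by
      rw [foldl_cons_eq]
      have h1 := sz_append l'.reverse (g a)
      have h2 := sz_prefix hl'
      rw [sz_reverse] at h1
      omega
  exact this.recode fun a => by rw [foldl_cons_eq]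

@[fun_prop]
theorem reverse {f : α → List β} (hf : PF f) : PF (fun a => (f a).reverse) := by
  simpa using hf.reverseAppend (const (α := α) ([] : List β))

@[fun_prop]
theorem append {f g : α → List β} (hf : PF f) (hg : PF g) : PF (fun a => f a ++ g a) := by
  simpa using hf.reverse.reverseAppend hg

-- Folding with `cons` produces the image in reverse. Each partial result has at most as many items
-- as the list has, each polynomially bounded in size, which gives the bound the fold requires.
@[fun_prop]
theorem map {l : α → List β} {f : α → β → γ} (hl : PF l) (hf : PF fun p : α × β => f p.1 p.2) :
    PF (fun a => (l a).map (f a)) := by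
  have heq : ∀ (a : α) (l : List β) (m : List γ),
      l.foldl (fun acc b => f a b :: acc) m = (l.map (f a)).reverse ++ m := by
    intro a l
    induction l with
    | nil => simp
    | cons b l ih => intro m; simp [ih]
  obtain ⟨c, hc⟩ := hf.size
  have hB : PB fun a : α => 1 + sz (l a) * ((sz a + sz (l a) + 2) ^ c + 1) :=
    (PB.const 1).add (hl.size.mul ((((PB.size.add hl.size).add (PB.const 2)).pow c).add
      (PB.const 1)))
  have := foldl (s := fun _ => []) (l := l) (f := fun (a : α) (acc : List γ) (b : β) => f a b :: acc)
    (cons (hf.comp (g := fun p : α × β => f p.1 p.2)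
      (f := fun p : (α × List γ) × β => (p.1.1, p.2)) (by fun_prop)) (by fun_prop))
    (by fun_prop) hl hB fun a l' hl' => by
      rw [heq, List.append_nil, sz_reverse]
      have h1 : ∀ y ∈ l'.map (f a), sz y ≤ (sz a + sz (l a) + 2) ^ c := by
        intro y hy
        obtain ⟨b, hb, rfl⟩ := List.mem_map.1 hy
        refine (hc (a, b)).trans (Nat.pow_le_pow_left ?_ _)
        rw [sz_prod]
        have := sz_le_of_mem (hl'.subset hb)
        omega
      refine (sz_list_le h1).trans (Nat.add_le_add_left (Nat.mul_le_mul_right _ ?_) _)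
      rw [List.length_map]
      have := length_lt_sz l'
      have := sz_prefix hl'
      omega
  simpa [heq] using this.reverse

@[fun_prop]
theorem flatten {l : α → List (List β)} (hl : PF l) : PF (fun a => (l a).flatten) := by
  have heq : ∀ (l : List (List β)) (m : List β),
      l.foldl (fun acc b => acc ++ b) m = m ++ l.flatten := by
    intro l
    induction l with
    | nil => simp
    | cons b l ih => intro m; simp [ih]
  have hsz : ∀ l : List (List β), sz l.flatten ≤ sz l := by
    intro l
    induction l with
    | nil => exact le_rfl
    | cons b l ih =>
      rw [List.flatten_cons, sz_cons]
      have := sz_append b l.flatten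
      omega
  have := foldl (s := fun _ => []) (l := l) (f := fun (_ : α) (acc : List β) (b : List β) => acc ++ b)
    (by fun_prop) (by fun_prop) hl hl.size fun a l' hl' => by
      rw [heq, List.nil_append]
      exact (hsz l').trans (sz_prefix hl')
  simpa [heq] using this

@[fun_prop]
theorem flatMap {l : α → List β} {f : α → β → List γ} (hl : PF l)
    (hf : PF fun p : α × β => f p.1 p.2) : PF (fun a => (l a).flatMap (f a)) := by
  simpa only [List.flatMap_def] using (hl.map hf).flatten

@[fun_prop]
theorem all {l : α → List β} {f : α → β → Bool} (hl : PF l)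
    (hf : PF fun p : α × β => f p.1 p.2) : PF (fun a => (l a).all (f a)) := by
  have heq : ∀ (a : α) (l : List β) (m : Bool),
      l.foldl (fun acc b => acc && f a b) m = (m && l.all (f a)) := by
    intro a l
    induction l with
    | nil => simp
    | cons b l ih => intro m; simp [ih, Bool.and_assoc]
  have := foldl (s := fun _ => true) (l := l) (f := fun (a : α) (acc : Bool) (b : β) => acc && f a b)
    (and (by fun_prop) (hf.comp (g := fun p : α × β => f p.1 p.2)
      (f := fun p : (α × Bool) × β => (p.1.1, p.2)) (by fun_prop)))
    (by fun_prop) hl (PB.const 3) fun a l' hl' => sz_bool_le _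
  simpa [heq] using this

/-- Right folds that add a bounded number of nodes in each step. -/
theorem foldr {l : α → List β} {s : α → γ} {op : β → γ → γ} {k : ℕ} (hl : PF l) (hs : PF s)
    (hop : PF fun p : β × γ => op p.1 p.2) (hk : ∀ b c, sz (op b c) ≤ sz b + sz c + k) :
    PF (fun a => (l a).foldr op (s a)) := by
  have hsz : ∀ (l : List β) (c : γ),
      sz (l.foldl (fun c b => op b c) c) ≤ sz c + (k + 1) * sz l := by
    intro l
    induction l with
    | nil => intro c; simp
    | cons b l ih =>
      intro c
      refine (ih _).trans ?_
      have := hk b c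
      have := one_le_sz b
      rw [sz_cons]
      nlinarith
  have := foldl (s := s) (l := fun a => (l a).reverse) (f := fun (_ : α) (c : γ) (b : β) => op b c)
    (hop.comp (g := fun p : β × γ => op p.1 p.2)
      (f := fun p : (α × γ) × β => (p.2, p.1.2)) (by fun_prop)) hs hl.reverse
    (hs.size.add ((PB.const (k + 1)).mul hl.size)) fun a l' hl' => by
      refine (hsz _ _).trans ?_
      have := sz_prefix hl'
      rw [sz_reverse] at this
      nlinarith
  simpa [List.foldl_reverse] using this

@[fun_prop]
theorem tail {l : α → List β} (hl : PF l) : PF (fun a => (l a).tail) := by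
  have := listCases (g := fun _ _ t => t) hl (const (α := α) ([] : List β)) (by fun_prop)
  exact this.recode fun a => by cases l a <;> rfl

@[fun_prop]
theorem headD {l : α → List β} (hl : PF l) (b : β) : PF (fun a => (l a).headD b) := by
  have := listCases (g := fun _ b _ => b) hl (const (α := α) b) (by fun_prop)
  exact this.recode fun a => by cases l a <;> rfl

/-! ### Natural numbers -/

theorem replicate {n : α → ℕ} (hn : PF n) : PF (fun a => List.replicate (n a) ()) :=
  hn.recode fun _ => enc_nat _

@[fun_prop]
theorem length {l : α → List β} (hl : PF l) : PF (fun a => (l a).length) :=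
  (hl.map (f := fun _ _ => ()) (const _)).recode fun a => by
    rw [List.map_const', enc_nat]

@[fun_prop]
theorem natAdd {m n : α → ℕ} (hm : PF m) (hn : PF n) : PF (fun a => m a + n a) :=
  (hm.replicate.append hn.replicate).recode fun a => by
    rw [List.replicate_append_replicate, enc_nat]

@[fun_prop]
theorem natMul {m n : α → ℕ} (hm : PF m) (hn : PF n) : PF (fun a => m a * n a) := by
  have := (hm.replicate.flatMap (f := fun a _ => List.replicate (n a) ())
    (hn.replicate.comp (g := fun a => List.replicate (n a) ()) fst)).length
  exact this.recode fun a => by simp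

@[fun_prop]
theorem drop {n : α → ℕ} {l : α → List β} (hn : PF n) (hl : PF l) :
    PF (fun a => (l a).drop (n a)) := by
  have heq : ∀ (k : ℕ) (m : List β),
      (List.replicate k ()).foldl (fun acc _ => acc.tail) m = m.drop k := by
    intro k
    induction k with
    | zero => simp
    | succ k ih => intro m; simp [List.replicate_succ, ih]
  have hsz : ∀ (k : ℕ) (m : List β), sz (m.drop k) ≤ sz m := fun k m => by
    have := sz_append (m.take k) (m.drop k)
    have := one_le_sz (m.take k)
    rw [List.take_append_drop] at *
    omega
  have := foldl (s := l) (l := fun a => List.replicate (n a) ())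
    (f := fun (_ : α) (acc : List β) (_ : Unit) => acc.tail) (by fun_prop) hl hn.replicate
    hl.size fun a l' hl' => by
      rw [List.eq_replicate_of_mem (l := l') (a := ()) fun _ _ => rfl, heq]
      exact hsz _ _
  simpa only [heq] using this

@[fun_prop]
theorem getD {n : α → ℕ} {l : α → List β} (hn : PF n) (hl : PF l) (b : β) :
    PF (fun a => (l a).getD (n a) b) :=
  ((hn.drop hl).headD b).recode fun a => by
    rw [List.headD_eq_head?_getD, List.head?_drop, List.getD_eq_getElem?_getD]

@[fun_prop]
theorem natSub {m n : α → ℕ} (hm : PF m) (hn : PF n) : PF (fun a => m a - n a) :=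
  (hn.drop hm.replicate).recode fun a => by rw [List.drop_replicate, enc_nat]

theorem natIsZero {n : α → ℕ} (hn : PF n) : PF (fun a => decide (n a = 0)) := by
  have := listCases (g := fun _ _ _ => false) hn.replicate (const (α := α) true) (by fun_prop)
  exact this.recode fun a => by cases h : n a <;> simp [List.replicate_succ]

@[fun_prop]
theorem natLe {m n : α → ℕ} (hm : PF m) (hn : PF n) : PF (fun a => decide (m a ≤ n a)) := by
  simpa only [Nat.sub_eq_zero_iff_le] using (hm.natSub hn).natIsZero

@[fun_prop]
theorem natLt {m n : α → ℕ} (hm : PF m) (hn : PF n) : PF (fun a => decide (m a < n a)) := by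
  simpa only [Nat.succ_le_iff] using (hm.natAdd (const 1)).natLe hn

@[fun_prop]
theorem natEq {m n : α → ℕ} (hm : PF m) (hn : PF n) : PF (fun a => decide (m a = n a)) := by
  have := (hm.natLe hn).and (hn.natLe hm)
  exact this.recode fun a => by
    rw [← Bool.decide_and]; exact congrArg enc (decide_eq_decide.2 le_antisymm_iff)

-- A fold in which the length of the accumulator supplies the next number.
@[fun_prop]
theorem range {n : α → ℕ} (hn : PF n) : PF (fun a => List.range (n a)) := by
  have heq : ∀ (k : ℕ), (List.replicate k ()).foldl
      (fun (acc : List ℕ) _ => acc ++ [acc.length]) [] = List.range k := by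
    intro k
    induction k with
    | zero => rfl
    | succ k ih =>
      rw [List.replicate_succ', List.foldl_append, ih, List.range_succ]
      simp
  have hB : PB fun a : α => 1 + sz (n a) * (2 * sz (n a) + 1 + 1) :=
    (PB.const 1).add (hn.size.mul ((((PB.const 2).mul hn.size).add (PB.const 1)).add
      (PB.const 1)))
  have := foldl (s := fun _ => []) (l := fun a => List.replicate (n a) ())
    (f := fun (_ : α) (acc : List ℕ) (_ : Unit) => acc ++ [acc.length]) (by fun_prop)
    (by fun_prop) hn.replicate hB fun a l' hl' => by
      have hlen : l'.length ≤ n a := by simpa using hl'.length_le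
      have h2 := sz_nat (n a)
      rw [List.eq_replicate_of_mem (l := l') (a := ()) fun _ _ => rfl, heq]
      refine (sz_list_le (B := 2 * sz (n a) + 1) fun i hi => ?_).trans
        (Nat.add_le_add_left (Nat.mul_le_mul_right _ ?_) _)
      · have := List.mem_range.1 hi
        rw [sz_nat]
        omega
      · rw [List.length_range]
        omega
  simpa only [heq] using this

end PF

end TimedPDA

namespace TimedPDA

/-! ### Commutative grammars: Parikh images via balanced and connected counts -/

namespace Grammar

open Relation

variable {ι N : Type} (lhs : ι → N) (rhs : ι → Multiset N)

/-- The occurrence relation between nonterminals given by the productions that are used. -/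
def Edge (y : ι → ℕ) (A B : N) : Prop := ∃ i, 0 < y i ∧ lhs i = A ∧ B ∈ rhs i

/-- Every nonterminal that is rewritten is reachable from `M`. -/
def Connected (M : Multiset N) (y : ι → ℕ) : Prop :=
  ∀ i, 0 < y i → ∃ B ∈ M, ReflTransGen (Edge lhs rhs y) B (lhs i)

variable {lhs rhs}

/-- A path to `B` can be cut at the first visit of `B`. -/
theorem path_avoiding {y : ι → ℕ} {B C : N} (h : ReflTransGen (Edge lhs rhs y) C B) :
    ReflTransGen (fun A A' => A ≠ B ∧ Edge lhs rhs y A A') C B := by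
  induction h using ReflTransGen.head_induction_on with
  | refl => exact .refl
  | @head C D hCD _ ih =>
    by_cases hC : C = B
    · rw [hC]
    · exact .head ⟨hC, hCD⟩ ih

/-- Among the used productions with unreachable left hand side take one of least rank. Its left hand
side has a parent production of smaller rank, which by minimality starts from a reachable
nonterminal; but then the child is reachable as well. Ranks are integers because they become integer
variables. -/
theorem connected_of_rank [Fintype ι] {M : Multiset N} {y : ι → ℕ} {z : N → ℤ}
    (hz : ∀ A, A ∈ M ∨ (∀ i, lhs i = A → y i = 0) ∨
      ∃ i, 0 < y i ∧ A ∈ rhs i ∧ z (lhs i) + 1 ≤ z A) : Connected lhs rhs M y := by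
  classical
  by_contra hc
  simp only [Connected, not_forall] at hc
  obtain ⟨i₀, hi₀, hn₀⟩ := hc
  obtain ⟨i, hi, hmin⟩ := Finset.exists_min_image
    (Finset.univ.filter fun i => 0 < y i ∧ ¬ ∃ B ∈ M, ReflTransGen (Edge lhs rhs y) B (lhs i))
    (fun i => z (lhs i)) ⟨i₀, by simpa using ⟨hi₀, by simpa using hn₀⟩⟩
  simp only [Finset.mem_filter, Finset.mem_univ, true_and] at hi hmin
  rcases hz (lhs i) with h | h | ⟨j, h1, h2, h3⟩
  · exact hi.2 ⟨_, h, .refl⟩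
  · exact hi.1.ne' (h i rfl)
  · by_cases hj : ∃ B ∈ M, ReflTransGen (Edge lhs rhs y) B (lhs j)
    · obtain ⟨B, hB, hr⟩ := hj
      exact hi.2 ⟨B, hB, hr.tail ⟨j, h1, rfl, h2⟩⟩
    · have := hmin j ⟨h1, hj⟩
      omega

variable (lhs rhs) [DecidableEq ι]

/-- `Gen M y`: from the multiset `M` of nonterminals, the empty multiset is derived with `y i` uses of
each production `i`. -/
inductive Gen : Multiset N → (ι → ℕ) → Prop where
  | zero : Gen 0 0
  | fire (i : ι) {M : Multiset N} {y : ι → ℕ} :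
      Gen (M + rhs i) y → Gen (lhs i ::ₘ M) (y + Pi.single i 1)

variable {lhs rhs}

theorem Gen.add {M M' : Multiset N} {y y' : ι → ℕ} (h : Gen lhs rhs M y)
    (h' : Gen lhs rhs M' y') : Gen lhs rhs (M + M') (y + y') := by
  induction h with
  | zero => simpa using h'
  | @fire i M y _ ih =>
    have : Gen lhs rhs (M + M' + rhs i) (y + y') := by
      rwa [add_right_comm]
    have := Gen.fire i this
    rwa [Multiset.cons_add, add_right_comm]

theorem Gen.of_production {i : ι} {y : ι → ℕ} (h : Gen lhs rhs (rhs i) y) :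
    Gen lhs rhs {lhs i} (y + Pi.single i 1) :=
  Gen.fire i (M := 0) (by simpa using h)

-- The induction principle for soundness: if the sets `I A` are closed under all productions, with
-- Minkowski sums on right hand sides, then the total weight of a derivation lies in the sum of the
-- sets of its start symbols.
open scoped Pointwise in
theorem Gen.sum_mem [Fintype ι] {W : Type} [AddCommMonoid W] {wt : ι → W} {I : N → Set W}
    (hI : ∀ i, ∀ w ∈ ((rhs i).map I).sum, wt i + w ∈ I (lhs i)) {M : Multiset N} {y : ι → ℕ}
    (h : Gen lhs rhs M y) : ∑ i, y i • wt i ∈ (M.map I).sum := by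
  induction h with
  | zero => simp
  | @fire i M y _ ih =>
    rw [Multiset.map_add, Multiset.sum_add] at ih
    obtain ⟨u, hu, v, hv, huv⟩ := Set.mem_add.1 ih
    rw [Multiset.map_cons, Multiset.sum_cons]
    refine Set.mem_add.2 ⟨_, hI i v hv, u, hu, ?_⟩
    have : ∑ j, (y + Pi.single i 1 : ι → ℕ) j • wt j = (∑ j, y j • wt j) + wt i := by
      simp only [Pi.add_apply, add_smul, Finset.sum_add_distrib]
      congr 1
      rw [Finset.sum_eq_single i]
      · simp
      · intro j _ hj; simp [Pi.single_eq_of_ne hj]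
      · simp
    rw [this, ← huv]
    abel

variable [DecidableEq N]

variable (lhs rhs) in
/-- Every nonterminal is produced as often as it is rewritten. -/
def Balanced [Fintype ι] (M : Multiset N) (y : ι → ℕ) : Prop :=
  ∀ A, M.count A + ∑ i, y i * (rhs i).count A = ∑ i, if lhs i = A then y i else 0

/-- The fired occurrence of `lhs i` adds one to both sides of its equation, and `rhs i` only moves
from the sum of produced symbols into the multiset. -/
theorem balanced_fire_iff [Fintype ι] {i : ι} {M : Multiset N} {y : ι → ℕ} :
    Balanced lhs rhs (lhs i ::ₘ M) (y + Pi.single i 1) ↔ Balanced lhs rhs (M + rhs i) y := by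
  have h1 : ∀ A, ∑ j, (y + Pi.single i 1 : ι → ℕ) j * (rhs j).count A =
      ∑ j, y j * (rhs j).count A + (rhs i).count A := by
    intro A
    simp only [Pi.add_apply, add_mul, Finset.sum_add_distrib]
    congr 1
    rw [Finset.sum_eq_single i]
    · simp
    · intro j _ hj; simp [Pi.single_eq_of_ne hj]
    · simp
  have h2 : ∀ A, (∑ j, if lhs j = A then (y + Pi.single i 1 : ι → ℕ) j else 0) =
      (∑ j, if lhs j = A then y j else 0) + if lhs i = A then 1 else 0 := by
    intro A
    have : ∀ j, (if lhs j = A then (y + Pi.single i 1 : ι → ℕ) j else 0) =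
        (if lhs j = A then y j else 0) + if lhs j = A then Pi.single (M := fun _ => ℕ) i 1 j
          else 0 := by
      intro j; split_ifs <;> simp
    rw [Finset.sum_congr rfl fun j _ => this j, Finset.sum_add_distrib]
    congr 1
    rw [Finset.sum_eq_single i]
    · simp
    · intro j _ hj; simp [Pi.single_eq_of_ne hj]
    · simp
  refine forall_congr' fun A => ?_
  rw [h1, h2, Multiset.count_cons, Multiset.count_add]
  by_cases h : A = lhs i
  · subst h; simp; omega
  · simp [h, Ne.symm h]; omega

theorem Gen.balanced [Fintype ι] {M : Multiset N} {y : ι → ℕ} (h : Gen lhs rhs M y) :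
    Balanced lhs rhs M y := by
  induction h with
  | zero => intro A; simp
  | fire i _ ih => exact balanced_fire_iff.2 ih

/-- The converse certificate, by induction from the end of the derivation. Putting a step in front
raises all ranks by one and gives the rewritten symbol rank `0`, so that this step serves as parent
for the symbols of its right hand side. -/
theorem Gen.exists_rank {M : Multiset N} {y : ι → ℕ} (h : Gen lhs rhs M y) :
    ∃ z : N → ℕ, ∀ A, A ∈ M ∨ (∀ i, lhs i = A → y i = 0) ∨
      ∃ i, 0 < y i ∧ A ∈ rhs i ∧ z (lhs i) + 1 ≤ z A := by
  induction h with
  | zero => exact ⟨0, fun A => Or.inr (Or.inl fun _ _ => rfl)⟩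
  | @fire i M y _ ih =>
    obtain ⟨z, hz⟩ := ih
    refine ⟨fun A => if A = lhs i then 0 else z A + 1, fun A => ?_⟩
    by_cases hA : A = lhs i
    · exact Or.inl (by simp [hA])
    by_cases hM : A ∈ M
    · exact Or.inl (by simp [hM])
    right
    by_cases hi : A ∈ rhs i
    · exact Or.inr ⟨i, by simp, hi, by simp [hA]⟩
    rcases hz A with h | h | ⟨j, h1, h2, h3⟩
    · exact absurd (Multiset.mem_add.1 h) (by simp [hM, hi])
    · refine Or.inl fun j hj => ?_
      have : j ≠ i := by rintro rfl; exact hA hj.symm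
      simp [h j hj, Pi.single_eq_of_ne this]
    · refine Or.inr ⟨j, by simp only [Pi.add_apply]; omega, h2, ?_⟩
      simp only [hA, if_false]
      split_ifs <;> omega

/-- Counts that are balanced and connected are the counts of a derivation. -/
theorem gen_of_balanced [Fintype ι] (n : ℕ) {M : Multiset N} {y : ι → ℕ} (hn : ∑ i, y i = n)
    (hb : Balanced lhs rhs M y) (hc : Connected lhs rhs M y) : Gen lhs rhs M y := by
  induction n generalizing M y with
  | zero =>
    have hy : y = 0 := by
      funext i
      exact Finset.sum_eq_zero_iff.1 hn i (Finset.mem_univ i)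
    subst hy
    have : M = 0 := Multiset.eq_zero_of_forall_notMem fun A hA => by
      have h1 := hb A
      have h2 := Multiset.count_pos.2 hA
      simp at h1
      exact h1 hA
    subst this
    exact .zero
  | succ n ih =>
    set R := ReflTransGen (Edge lhs rhs y) with hR
    have hM : ∃ A, A ∈ M := by
      obtain ⟨i, _, hi⟩ := Finset.exists_ne_zero_of_sum_ne_zero (hn.trans_ne n.succ_ne_zero)
      obtain ⟨B, hB, -⟩ := hc i (Nat.pos_of_ne_zero hi)
      exact ⟨B, hB⟩
    -- Choose `B` in a source component among the symbols present: whatever in `M` leads to `B` can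
    -- be reached from `B` again. Rewriting such a `B` cannot cut it off from elsewhere.
    obtain ⟨B, hBM, hmin⟩ : ∃ B ∈ M, ∀ D ∈ M, R D B → R B D := by
      let r : {A // A ∈ M} → {A // A ∈ M} → Prop := fun D E => R D E ∧ ¬ R E D
      have : Finite {A // A ∈ M} := Set.Finite.to_subtype (s := {A | A ∈ M})
        ((Finset.finite_toSet M.toFinset).subset fun A hA => by simpa using hA)
      have : IsTrans _ r := ⟨fun D E F h1 h2 =>
        ⟨h1.1.trans h2.1, fun h => h1.2 (h2.1.trans h)⟩⟩
      have : Std.Irrefl r := ⟨fun D h => h.2 h.1⟩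
      obtain ⟨A, hA⟩ := hM
      obtain ⟨B, -, hB⟩ := (Finite.wellFounded_of_trans_of_irrefl r).has_min Set.univ
        ⟨⟨A, hA⟩, trivial⟩
      refine ⟨B, B.2, fun D hD hDB => ?_⟩
      by_contra hBD
      exact hB ⟨D, hD⟩ trivial ⟨hDB, hBD⟩
    obtain ⟨M', rfl⟩ := Multiset.exists_cons_of_mem hBM
    -- a production to begin with, after which nothing gets disconnected
    obtain ⟨p, hp, hpB, hgood⟩ : ∃ p, 0 < y p ∧ lhs p = B ∧
        ((∃ C ∈ rhs p, ReflTransGen (fun A A' => A ≠ B ∧ Edge lhs rhs y A A') C B) ∨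
          ∀ q, 0 < y q → B ∉ rhs q) := by
      -- If some used `q` produces `B`, then `q` is reached from some `D ∈ M`, and the choice of `B`
      -- closes a cycle through `B`. Its first production is `p`; after it the cycle returns to `B`
      -- without leaving from `B` in between.
      by_cases hq : ∃ q, 0 < y q ∧ B ∈ rhs q
      · obtain ⟨q, hq, hBq⟩ := hq
        obtain ⟨D, hD, hDq⟩ := hc q hq
        have hBD := hmin D hD (hDq.tail ⟨q, hq, rfl, hBq⟩)
        obtain ⟨C, ⟨p, hp, hpB, hC⟩, hCB⟩ := TransGen.head'_iff.1
          (TransGen.tail' (hBD.trans hDq) (show Edge lhs rhs y _ _ from ⟨q, hq, rfl, hBq⟩))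
        exact ⟨p, hp, hpB, Or.inl ⟨C, hC, path_avoiding hCB⟩⟩
      · push Not at hq
        have h1 := hb B
        have h2 := Multiset.count_pos.2 hBM
        obtain ⟨p, _, hp⟩ := Finset.exists_ne_zero_of_sum_ne_zero
          (show (∑ i, if lhs i = B then y i else 0) ≠ 0 by omega)
        by_cases hpB : lhs p = B
        · exact ⟨p, by simp [hpB] at hp; omega, hpB, Or.inr hq⟩
        · simp [hpB] at hp
    subst hpB
    obtain ⟨y', rfl⟩ : ∃ y' : ι → ℕ, y = y' + (Pi.single p 1 : ι → ℕ) := by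
      refine ⟨y - Pi.single p 1, ?_⟩
      funext i
      by_cases hi : i = p
      · subst hi; simp; omega
      · simp [Pi.single_eq_of_ne hi]
    have hne : ∀ i, i ≠ p → (y' + Pi.single p 1 : ι → ℕ) i = y' i := fun i hi => by
      simp [Pi.single_eq_of_ne hi]
    have hb' := balanced_fire_iff.1 hb
    refine .fire p (ih ?_ hb' ?_)
    · simp only [Pi.add_apply, Finset.sum_add_distrib, Finset.sum_pi_single'] at hn
      simpa using hn
    -- connectedness is preserved
    have hbase : (∃ D ∈ M' + rhs p, ReflTransGen (Edge lhs rhs y') D (lhs p)) ∨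
        ∀ i, lhs i = lhs p → y' i = 0 := by
      -- Edges that leave symbols other than `lhs p` do not come from `p`, hence survive the removal
      -- of one use of `p`.
      rcases hgood with ⟨C, hC, hpath⟩ | hno
      · refine Or.inl ⟨C, by simp [hC], ReflTransGen.mono ?_ _ _ hpath⟩
        rintro A A' ⟨hA, i, hi, rfl, hA'⟩
        have : i ≠ p := by rintro rfl; exact hA rfl
        exact ⟨i, by rwa [hne i this] at hi, rfl, hA'⟩
      -- Here no used production yields `lhs p`, so balance forces its remaining rewrites to be paid
      -- for by copies already present in the multiset.
      · by_cases hi : ∃ i, lhs i = lhs p ∧ y' i ≠ 0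
        · obtain ⟨i, hi, hyi⟩ := hi
          refine Or.inl ⟨lhs p, ?_, .refl⟩
          have h1 := hb' (lhs p)
          have h2 : ∑ j, y' j * (rhs j).count (lhs p) = 0 := by
            refine Finset.sum_eq_zero fun j _ => ?_
            by_cases hj : y' j = 0
            · simp [hj]
            · rw [Multiset.count_eq_zero.2 (hno j (by simp only [Pi.add_apply]; omega)), mul_zero]
          have h3 : y' i ≤ ∑ j, if lhs j = lhs p then y' j else 0 := by
            refine le_trans ?_ (Finset.single_le_sum (fun _ _ => Nat.zero_le _)
              (Finset.mem_univ i))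
            simp [hi]
          rw [← Multiset.count_pos]
          omega
        · push Not at hi
          exact Or.inr hi
    -- Only edges given by `p` can disappear, and their targets now belong to the start multiset; so
    -- old paths can be restarted after their last use of `p`.
    have hreach : ∀ D ∈ lhs p ::ₘ M', ∀ A, R D A →
        (∃ D ∈ M' + rhs p, ReflTransGen (Edge lhs rhs y') D A) ∨
          ∀ i, lhs i = A → y' i = 0 := by
      intro D hD A hDA
      induction hDA with
      | refl =>
        rcases Multiset.mem_cons.1 hD with rfl | hD
        · exact hbase
        · exact Or.inl ⟨D, by simp [hD], .refl⟩
      | @tail A' A _ hstep ih =>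
        obtain ⟨j, hj, rfl, hA⟩ := hstep
        by_cases hjp : j = p
        · exact Or.inl ⟨A, by simp [← hjp, hA], .refl⟩
        · rw [hne j hjp] at hj
          rcases ih with ⟨E, hE, hEA⟩ | h0
          · exact Or.inl ⟨E, hE, hEA.tail ⟨j, hj, rfl, hA⟩⟩
          · exact absurd (h0 j rfl) hj.ne'
    intro i hi
    obtain ⟨D, hD, hDi⟩ := hc i (by simp only [Pi.add_apply]; omega)
    rcases hreach D hD _ hDi with h | h
    · exact h
    · exact absurd (h i rfl) hi.ne'

end Grammar

end TimedPDA

namespace TimedPDA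

/-! ### Fractional constraints in terms of the order of time stamps

The value of a clock is determined, up to an integer, by the current time and by the time of its last
reset. Both are represented by points of a linear order. -/

section Order

variable {α : Type} [LinearOrder α]

/-- Going backwards in cyclic order from `o`, one meets `x` not later than `y`. -/
def CycLe (o x y : α) : Prop := (x ≤ o ∧ (o < y ∨ y ≤ x)) ∨ (o < x ∧ o < y ∧ y ≤ x)

instance (o x y : α) : Decidable (CycLe o x y) := inferInstanceAs (Decidable (_ ∨ _))

namespace Atom

variable {V : Type}

/-- The integral atoms receive the dummy value `False`; `Constraint.sat_iff_ordSat` excludes them by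
assuming the constraint fractional. -/
def OrdSat (o : α) (s : V → α) : Atom V → Prop
  | fractZero x => s x = o
  | fractLe x y => CycLe o (s x) (s y)
  | _ => False

end Atom

namespace Constraint

variable {V : Type}

def OrdSat (o : α) (s : V → α) : Constraint V → Prop
  | verum => True
  | atom a => a.OrdSat o s
  | neg φ => ¬ φ.OrdSat o s
  | and φ χ => φ.OrdSat o s ∧ χ.OrdSat o s
  | or φ χ => φ.OrdSat o s ∨ χ.OrdSat o s

end Constraint

theorem fract_sub_of_le {o x : ℚ} (ho : o < 1) (hx : 0 ≤ x) (h : x ≤ o) :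
    Int.fract (o - x) = o - x := Int.fract_eq_self.2 ⟨by linarith, by linarith⟩

theorem fract_sub_of_lt {o x : ℚ} (ho : 0 ≤ o) (hx : x < 1) (h : o < x) :
    Int.fract (o - x) = o - x + 1 := by
  rw [← Int.fract_add_one]
  exact Int.fract_eq_self.2 ⟨by linarith, by linarith⟩

theorem fract_sub_eq_zero_iff {o x : ℚ} (ho : 0 ≤ o) (ho' : o < 1) (hx : 0 ≤ x) (hx' : x < 1) :
    Int.fract (o - x) = 0 ↔ x = o := by
  rcases le_or_gt x o with h | h
  · rw [fract_sub_of_le ho' hx h]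
    constructor <;> intro h <;> linarith
  · rw [fract_sub_of_lt ho hx' h]
    constructor <;> intro h <;> linarith

/-- Stamps beyond `o` belong to the previous turn of the circle: their distance to `o` is increased
by `1`, so they are older than all stamps up to `o`. -/
theorem fract_sub_le_iff {o x y : ℚ} (ho : 0 ≤ o) (ho' : o < 1) (hx : 0 ≤ x) (hx' : x < 1)
    (hy : 0 ≤ y) (hy' : y < 1) :
    Int.fract (o - x) ≤ Int.fract (o - y) ↔ CycLe o x y := by
  unfold CycLe
  rcases le_or_gt x o with h | h <;> rcases le_or_gt y o with h' | h'
  · rw [fract_sub_of_le ho' hx h, fract_sub_of_le ho' hy h']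
    simp only [h, h.not_gt, h'.not_gt, true_and, false_and, false_or, or_false]
    constructor <;> intro h <;> linarith
  · rw [fract_sub_of_le ho' hx h, fract_sub_of_lt ho hy' h']
    simp only [h, h', true_and, true_or, iff_true]
    linarith
  · rw [fract_sub_of_lt ho hx' h, fract_sub_of_le ho' hy h']
    simp only [h.not_ge, h'.not_gt, false_and, and_false, or_false, iff_false]
    linarith
  · rw [fract_sub_of_lt ho hx' h, fract_sub_of_lt ho hy' h']
    simp only [h, h', h.not_ge, true_and, false_and, false_or]
    constructor <;> intro h <;> linarith

/-- The bridge from values to order: `e` places the abstract stamps in the unit interval, and the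
valuation need only agree with their distances to the current time modulo `1`. -/
theorem Constraint.sat_iff_ordSat {e : α → ℚ} (he : StrictMono e)
    (h01 : ∀ a, 0 ≤ e a ∧ e a < 1) {V : Type} {φ : Constraint V} (hφ : φ.Fractional)
    {μ : V → ℚ≥0} {o : α} {s : V → α}
    (h : ∀ v, Int.fract (μ v : ℚ) = Int.fract (e o - e (s v))) : φ.Sat μ ↔ φ.OrdSat o s := by
  induction φ with
  | verum => exact Iff.rfl
  | atom a =>
    cases a with
    | fractZero x =>
      change Int.fract (μ x : ℚ) = 0 ↔ s x = o
      rw [h, fract_sub_eq_zero_iff (h01 _).1 (h01 _).2 (h01 _).1 (h01 _).2, he.injective.eq_iff]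
    | fractLe x y =>
      change Int.fract (μ x : ℚ) ≤ Int.fract (μ y : ℚ) ↔ CycLe o (s x) (s y)
      rw [h, h, fract_sub_le_iff (h01 _).1 (h01 _).2 (h01 _).1 (h01 _).2 (h01 _).1 (h01 _).2]
      simp only [CycLe, he.le_iff_le, he.lt_iff_lt]
    | _ => exact hφ.elim
  | neg φ ih => exact not_congr (ih hφ)
  | and φ χ ih ih' => exact and_congr (ih hφ.1) (ih' hφ.2)
  | or φ χ ih ih' => exact or_congr (ih hφ.1) (ih' hφ.2)

end Order

end TimedPDA

/-! ### Runs in terms of time stamps -/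

namespace TPDA

open TimedPDA

variable (P : TPDA) (α : Type) [LinearOrder α]

/-- The current time (`none`) and the time stamps of the global clocks. -/
abbrev Stamps : Type := Option P.Clock → α

variable {P α}

/-- The satisfaction of a stack constraint. -/
def StackSat (ψ : Constraint (P.Clock ⊕ P.StackClock)) (s : P.Stamps α) (ζ : P.StackClock → α) :
    Prop := ψ.OrdSat (s none) (Sum.elim (fun x => s (some x)) ζ)

/-- The effect of operations that do not concern the stack. -/
def OpRel (s : P.Stamps α) (π : P.Letter → ℕ) (s' : P.Stamps α) :
    Op P.letters P.stackSymbols P.globalClocks P.stackClocks → Prop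
  -- The new current time is unrestricted, because modulo `1` every moment lies in the future.
  | .elapse => π = 0 ∧ ∀ x, s' (some x) = s (some x)
  | .input a => π = a.elim 0 (fun a => Pi.single a 1) ∧ s' = s
  | .test φ => π = 0 ∧ s' = s ∧ φ.OrdSat (s none) fun x => s (some x)
  | .reset Y => π = 0 ∧ s' none = s none ∧
      ∀ x, s' (some x) = if x ∈ Y then s none else s (some x)
  | .push _ _ => False
  | .pop _ _ => False

variable (P α) in
/-- Runs that begin and end with the same stack and do not inspect it, in terms of time stamps. -/
inductive Sem : P.Loc → P.Stamps α → (P.Letter → ℕ) → P.Loc → P.Stamps α → Prop where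
  | refl (ℓ : P.Loc) (s : P.Stamps α) : Sem ℓ s 0 ℓ s
  | comp {ℓ k r : P.Loc} {s s' s'' : P.Stamps α} {π π' : P.Letter → ℕ} :
      Sem ℓ s π k s' → Sem k s' π' r s'' → Sem ℓ s (π + π') r s''
  | op {ℓ r : P.Loc} {s s' : P.Stamps α} {π : P.Letter → ℕ}
      {op : Op P.letters P.stackSymbols P.globalClocks P.stackClocks}
      (h : (ℓ, op, r) ∈ P.rules) (hop : OpRel s π s' op) : Sem ℓ s π r s'
  | stack {ℓ k l r : P.Loc} {s s' : P.Stamps α} {π : P.Letter → ℕ} {γ : P.StackSymbol}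
      {ψ χ : Constraint (P.Clock ⊕ P.StackClock)} (ζ : P.StackClock → α)
      (hpush : (ℓ, Op.push γ ψ, k) ∈ P.rules) (hψ : StackSat ψ s ζ) (h : Sem k s π l s')
      (hpop : (l, Op.pop γ χ, r) ∈ P.rules) (hχ : StackSat χ s' ζ) : Sem ℓ s π r s'

/-! #### Parikh images -/

theorem parikh_append (w w' : List P.Label) : P.parikh (w ++ w') = P.parikh w + P.parikh w' := by
  funext a
  simp [parikh, untime, List.filterMap_append]

theorem parikh_inl (a : Option P.Letter) :
    P.parikh [.inl a] = a.elim 0 (fun a => Pi.single a 1) := by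
  funext b
  cases a with
  | none => rfl
  | some a =>
    by_cases h : a = b
    · subst h; simp [parikh, untime]
    · simp [parikh, untime, h]

theorem parikh_inr (δ : ℚ≥0) : P.parikh [.inr δ] = 0 := by
  rfl

theorem Run.append {c d f : P.Config} {w w' : List P.Label} (h : P.Run c w d) (h' : P.Run d w' f) :
    P.Run c (w ++ w') f := by
  induction h with
  | refl => exact h'
  | step h _ ih => exact .step h (ih h')

theorem Step.run {c d : P.Config} {a : P.Label} (h : P.Step c a d) : P.Run c [a] d :=
  .step h (.refl _)

/-! #### From time stamps to runs -/

/-- The induction carries an arbitrary stack `u` underneath and the total time `δ` by which it ages.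
Knowing `δ` modulo `1` is what allows the stack clocks to be compared at the matching pop. -/
theorem Sem.exists_run (hP : P.Fractional) {e : α → ℚ} (he : StrictMono e)
    (h01 : ∀ a, 0 ≤ e a ∧ e a < 1) {ℓ r : P.Loc} {s s' : P.Stamps α} {π : P.Letter → ℕ}
    (h : P.Sem α ℓ s π r s') (μ : P.Clock → ℚ≥0)
    (u : List (P.StackSymbol × (P.StackClock → ℚ≥0)))
    (hμ : ∀ x, Int.fract (μ x : ℚ) = Int.fract (e (s none) - e (s (some x)))) :
    ∃ (w : List P.Label) (ν : P.Clock → ℚ≥0) (δ : ℚ≥0),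
      P.Run ⟨ℓ, μ, u⟩ w ⟨r, ν, u.map fun f => (f.1, fun z => f.2 z + δ)⟩ ∧ P.parikh w = π ∧
      (∀ x, Int.fract (ν x : ℚ) = Int.fract (e (s' none) - e (s' (some x)))) ∧
      Int.fract (δ : ℚ) = Int.fract (e (s' none) - e (s none)) := by
  induction h generalizing μ u with
  | refl ℓ s => exact ⟨[], μ, 0, by simpa using Run.refl _, rfl, hμ, by simp⟩
  | comp _ _ ih ih' =>
    obtain ⟨w, ν, δ, h1, h2, h3, h4⟩ := ih μ u hμ
    obtain ⟨w', ν', δ', h1', h2', h3', h4'⟩ := ih' ν _ h3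
    refine ⟨w ++ w', ν', δ + δ', ?_, by rw [parikh_append, h2, h2'], h3', ?_⟩
    · simpa [List.map_map, Function.comp_def, add_assoc] using h1.append h1'
    · rw [Int.fract_eq_fract] at h4 h4' ⊢
      obtain ⟨z, hz⟩ := h4
      obtain ⟨z', hz'⟩ := h4'
      exact ⟨z + z', by push_cast; linarith⟩
  | @op ℓ r s s' π op h hop =>
    cases op with
    | elapse =>
      obtain ⟨rfl, hs⟩ := hop
      let δ : ℚ≥0 := ⟨Int.fract (e (s' none) - e (s none)), Int.fract_nonneg _⟩
      have hδ : (δ : ℚ) = Int.fract (e (s' none) - e (s none)) := rfl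
      refine ⟨_, _, δ, (Step.elapse μ u δ h).run, parikh_inr _, fun x => ?_, by
        rw [hδ, Int.fract_fract]⟩
      have h1 := hμ x
      rw [← hs x, Int.fract_eq_fract] at h1
      obtain ⟨z, hz⟩ := h1
      rw [Int.fract_eq_fract]
      refine ⟨z - ⌊e (s' none) - e (s none)⌋, ?_⟩
      have := Int.fract_add_floor (e (s' none) - e (s none))
      push_cast
      rw [hδ]
      linarith
    | input a =>
      obtain ⟨rfl, rfl⟩ := hop
      exact ⟨_, _, 0, by simpa using (Step.input μ u a h).run, parikh_inl _, hμ, by simp⟩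
    | test φ =>
      obtain ⟨rfl, rfl, hφ⟩ := hop
      exact ⟨_, _, 0, by
        simpa using (Step.test μ u φ h
          ((Constraint.sat_iff_ordSat he h01 (hP _ h) hμ).2 hφ)).run, parikh_inl _, hμ, by simp⟩
    | reset Y =>
      obtain ⟨rfl, h0, hs⟩ := hop
      refine ⟨_, _, 0, by simpa using (Step.reset μ u Y h).run, parikh_inl _, fun x => ?_,
        by simp [h0]⟩
      rw [h0, hs]
      by_cases hx : x ∈ Y <;> simp [hx, hμ]
    | push _ _ => exact hop.elim
    | pop _ _ => exact hop.elim
  | @stack ℓ k l r s s' π γ ψ χ ζ hpush hψ _ hpop hχ ih =>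
    -- The pushed values are the least ones with the prescribed stamps.
    let ξ : P.StackClock → ℚ≥0 := fun z =>
      ⟨Int.fract (e (s none) - e (ζ z)), Int.fract_nonneg _⟩
    have hξ : ∀ z, (ξ z : ℚ) = Int.fract (e (s none) - e (ζ z)) := fun _ => rfl
    obtain ⟨w, ν, δ, h1, h2, h3, h4⟩ := ih μ ((γ, ξ) :: u) hμ
    have hψ' : ψ.Sat (Sum.elim μ ξ) := (Constraint.sat_iff_ordSat he h01 (hP _ hpush) (by
      rintro (x | z)
      · exact hμ x
      · simp [hξ])).2 hψ
    have hχ' : χ.Sat (Sum.elim ν fun z => ξ z + δ) :=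
      (Constraint.sat_iff_ordSat he h01 (hP _ hpop) (by
        rintro (x | z)
        · exact h3 x
        · rw [Int.fract_eq_fract] at h4
          obtain ⟨n, hn⟩ := h4
          simp only [Sum.elim_inr]
          rw [Int.fract_eq_fract]
          refine ⟨n - ⌊e (s none) - e (ζ z)⌋, ?_⟩
          have := Int.fract_add_floor (e (s none) - e (ζ z))
          push_cast
          rw [hξ]
          linarith)).2 hχ
    refine ⟨_, ν, δ, ((Step.push μ u γ ψ ξ hpush hψ').run.append h1).append
      (Step.pop ν _ γ χ _ hpop hχ').run, ?_, h3, h4⟩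
    rw [parikh_append, parikh_append, parikh_inl, h2]
    simp

/-! #### From runs to time stamps -/

/-- Runs that consume the given stack. -/
def SemStack (r : P.Loc) (s' : P.Stamps α) : List (P.StackSymbol × (P.StackClock → α)) →
    P.Loc → P.Stamps α → (P.Letter → ℕ) → Prop
  | [], ℓ, s, π => P.Sem α ℓ s π r s'
  | (γ, ζ) :: u, ℓ, s, π => ∃ (l k : P.Loc) (t : P.Stamps α) (π₁ π₂ : P.Letter → ℕ)
      (χ : Constraint (P.Clock ⊕ P.StackClock)), P.Sem α ℓ s π₁ l t ∧
        (l, Op.pop γ χ, k) ∈ P.rules ∧ StackSat χ t ζ ∧ SemStack r s' u k t π₂ ∧ π = π₁ + π₂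

theorem SemStack.prepend {r : P.Loc} {s' : P.Stamps α}
    {u : List (P.StackSymbol × (P.StackClock → α))} {ℓ k : P.Loc} {s t : P.Stamps α}
    {π π' : P.Letter → ℕ} (h : P.Sem α ℓ s π k t) (h' : SemStack r s' u k t π') :
    SemStack r s' u ℓ s (π + π') := by
  cases u with
  | nil => exact .comp h h'
  | cons f u =>
    obtain ⟨γ, ζ⟩ := f
    obtain ⟨l, k', t', π₁, π₂, χ, h1, h2, h3, h4, rfl⟩ := h'
    exact ⟨l, k', t', π + π₁, π₂, χ, .comp h h1, h2, h3, h4, by rw [add_assoc]⟩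

/-- The fractional part, as a point of the unit interval. -/
def fractPoint (q : ℚ) : Set.Ico (0 : ℚ) 1 := ⟨Int.fract q, Int.fract_nonneg q, Int.fract_lt_one q⟩

theorem fractPoint_sub_fractPoint (a b : ℚ) :
    Int.fract ((fractPoint a : ℚ) - fractPoint b) = Int.fract (a - b) := by
  rw [Int.fract_eq_fract]
  refine ⟨⌊b⌋ - ⌊a⌋, ?_⟩
  have h1 := Int.fract_add_floor a
  have h2 := Int.fract_add_floor b
  simp only [fractPoint]
  push_cast
  linarith

/-- The time stamps of a valuation at time `T`. -/
def stamps (T : ℚ) (μ : P.Clock → ℚ≥0) : P.Stamps (Set.Ico (0 : ℚ) 1)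
  | none => fractPoint T
  | some x => fractPoint (T - μ x)

/-- The time stamps of a stack at time `T`. -/
def stackStamps (T : ℚ) (u : List (P.StackSymbol × (P.StackClock → ℚ≥0))) :
    List (P.StackSymbol × (P.StackClock → Set.Ico (0 : ℚ) 1)) :=
  u.map fun f => (f.1, fun z => fractPoint (T - f.2 z))

theorem fract_stamps (T : ℚ) (μ : P.Clock → ℚ≥0) (x : P.Clock) :
    Int.fract (μ x : ℚ) =
      Int.fract ((stamps T μ none : ℚ) - stamps T μ (some x)) := by
  simp only [stamps, fractPoint_sub_fractPoint]
  simp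

theorem stackSat_stamps {ψ : Constraint (P.Clock ⊕ P.StackClock)} (hψ : ψ.Fractional) (T : ℚ)
    (μ : P.Clock → ℚ≥0) (ζ : P.StackClock → ℚ≥0) :
    ψ.Sat (Sum.elim μ ζ) ↔ StackSat ψ (stamps T μ) fun z => fractPoint (T - ζ z) := by
  refine Constraint.sat_iff_ordSat (e := Subtype.val) (fun _ _ h => h) (fun a => a.2) hψ ?_
  rintro (x | z)
  · exact fract_stamps T μ x
  · simp only [stamps, Sum.elim_inr, fractPoint_sub_fractPoint]
    simp

/-- Since the run is read from its end, the stack at its beginning is arbitrary, and `SemStack`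
splits the run at the pops of the frames present. A push in front turns the first segment into a
`Sem.stack` step; a pop opens a new, empty first segment. The absolute time `T` of the first
configuration is arbitrary. -/
theorem Run.semStack (hP : P.Fractional) {c d : P.Config} {w : List P.Label} (h : P.Run c w d)
    (hd : d.stack = []) (T : ℚ) :
    ∃ T', SemStack d.loc (stamps T' d.val) (stackStamps T c.stack) c.loc (stamps T c.val)
      (P.parikh w) := by
  induction h generalizing T with
  | refl c =>
    rw [hd]
    exact ⟨T, .refl _ _⟩
  | @step c d f a w hs _ ih =>
    have hw : P.parikh (a :: w) = P.parikh [a] + P.parikh w := parikh_append [a] w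
    rw [hw]
    cases hs with
    | @elapse ℓ r μ u δ h =>
      obtain ⟨T', ih⟩ := ih hd (T + δ)
      refine ⟨T', SemStack.prepend (t := stamps (T + δ) fun x => μ x + δ)
        (.op h ⟨parikh_inr _, fun x => ?_⟩) ?_⟩
      · simp [stamps]
      -- Age and time grow by the same amount, so the stamps on the stack remain.
      · have : (stackStamps (T + δ) (u.map fun e => (e.1, fun z => e.2 z + δ))) =
            stackStamps T u := by
          simp [stackStamps]
        rw [← this]
        exact ih
    | @input ℓ r μ u a h =>
      obtain ⟨T', ih⟩ := ih hd T
      exact ⟨T', SemStack.prepend (.op h ⟨parikh_inl _, rfl⟩) ih⟩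
    | @test ℓ r μ u φ h hφ =>
      obtain ⟨T', ih⟩ := ih hd T
      refine ⟨T', SemStack.prepend (.op h ⟨parikh_inl _, rfl, ?_⟩) ih⟩
      exact (Constraint.sat_iff_ordSat (e := Subtype.val) (fun _ _ h => h) (fun a => a.2) (hP _ h)
        (fract_stamps T μ)).1 hφ
    | @reset ℓ r μ u Y h =>
      obtain ⟨T', ih⟩ := ih hd T
      refine ⟨T', SemStack.prepend
        (t := stamps T fun x => if x ∈ Y then 0 else μ x)
        (.op h ⟨parikh_inl _, rfl, fun x => ?_⟩) ih⟩
      by_cases hx : x ∈ Y <;> simp [stamps, hx]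
    | @push ℓ r μ u γ ψ ζ h hψ =>
      obtain ⟨T', l, k, t, π₁, π₂, χ, h1, h2, h3, h4, h5⟩ := ih hd T
      refine ⟨T', ?_⟩
      rw [parikh_inl, h5]
      simp only [Option.elim_none, zero_add]
      exact SemStack.prepend (.stack _ h ((stackSat_stamps (hP _ h) T μ ζ).1 hψ) h1 h2 h3) h4
    | @pop ℓ r μ u γ ψ ζ h hψ =>
      obtain ⟨T', ih⟩ := ih hd T
      exact ⟨T', ℓ, r, _, 0, P.parikh w, ψ, .refl _ _, h,
        (stackSat_stamps (hP _ h) T μ ζ).1 hψ, ih, by rw [parikh_inl]; rfl⟩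

end TPDA

namespace TimedPDA

/-! ### Order types of finite tuples -/

section OrdEq

variable {J I α β γ : Type} [LinearOrder α] [LinearOrder β] [LinearOrder γ]

/-- Two tuples are ordered in the same way. -/
def OrdEq (u : J → α) (v : J → β) : Prop := ∀ i j, u i ≤ u j ↔ v i ≤ v j

namespace OrdEq

variable {u : J → α} {v : J → β} {w : J → γ}

theorem symm (h : OrdEq u v) : OrdEq v u := fun i j => (h i j).symm

theorem trans (h : OrdEq u v) (h' : OrdEq v w) : OrdEq u w := fun i j => (h i j).trans (h' i j)

theorem comp (h : OrdEq u v) (f : I → J) : OrdEq (fun i => u (f i)) fun i => v (f i) :=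
  fun i j => h (f i) (f j)

theorem eq_iff (h : OrdEq u v) (i j : J) : u i = u j ↔ v i = v j := by
  rw [le_antisymm_iff, le_antisymm_iff, h i j, h j i]

theorem lt_iff (h : OrdEq u v) (i j : J) : u i < u j ↔ v i < v j := by
  rw [← not_le, ← not_le, h j i]

theorem cycLe_iff (h : OrdEq u v) (i j k : J) :
    CycLe (u i) (u j) (u k) ↔ CycLe (v i) (v j) (v k) := by
  simp only [CycLe, h.lt_iff, h _ _]

end OrdEq

theorem Constraint.ordSat_congr {V : Type} {o : α} {s : V → α} {o' : β} {s' : V → β}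
    (h : OrdEq (fun c : Option V => c.elim o s) fun c : Option V => c.elim o' s')
    (φ : Constraint V) : φ.OrdSat o s ↔ φ.OrdSat o' s' := by
  induction φ with
  | verum => exact Iff.rfl
  | atom a =>
    cases a with
    | fractZero x => exact h.eq_iff (some x) none
    | fractLe x y => exact h.cycLe_iff none (some x) (some y)
    | _ => exact Iff.rfl
  | neg φ ih => exact not_congr ih
  | and φ χ ih ih' => exact and_congr ih ih'
  | or φ χ ih ih' => exact or_congr ih ih'

/-- Every order type of tuples occurs on an initial segment of the natural numbers. -/
theorem exists_grid [Fintype J] (u : J → α) :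
    ∃ g : J → ℕ, (∀ j, g j < Fintype.card J) ∧ OrdEq g u := by
  classical
  -- Each entry is replaced by the number of distinct smaller values.
  refine ⟨fun j => ((Finset.univ.image u).filter (· < u j)).card, fun j => ?_, fun i j => ?_⟩
  · refine lt_of_lt_of_le (Finset.card_lt_card (t := Finset.univ.image u) ?_)
      (Finset.card_image_le)
    exact Finset.filter_ssubset.2 ⟨u j, by simp, by simp⟩
  · constructor
    · intro h
      by_contra hlt
      rw [not_le] at hlt
      refine absurd h (not_le.2 (Finset.card_lt_card ?_))
      refine Finset.ssubset_iff_of_subset (fun x hx => ?_) |>.2 ⟨u j, by simpa using hlt, by simp⟩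
      simp only [Finset.mem_filter] at hx ⊢
      exact ⟨hx.1, hx.2.trans hlt⟩
    · intro h
      refine Finset.card_le_card fun x hx => ?_
      simp only [Finset.mem_filter] at hx ⊢
      exact ⟨hx.1, hx.2.trans_le h⟩

/-- Homogeneity of dense linear orders without endpoints. -/
theorem exists_extension [Finite J] [Finite I] [DenselyOrdered α] [NoMinOrder α] [NoMaxOrder α]
    [Nonempty α] (g : J → β) (f : I → J) (s : I → α) (h : OrdEq s fun i => g (f i)) :
    ∃ u : J → α, OrdEq u g ∧ ∀ i, u (f i) = s i := by
  classical
  cases nonempty_fintype J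
  cases nonempty_fintype I
  -- The embedding starts on the values prescribed by `s` and is extended by one point of `β` at a
  -- time.
  have key : ∀ T : Finset β, ∃ F : ((Finset.univ.image fun i => g (f i)) ∪ T : Finset β) ↪o α,
      ∀ i, F ⟨g (f i), by simp⟩ = s i := by
    intro T
    induction T using Finset.induction_on with
    | empty =>
      have hch : ∀ b : ((Finset.univ.image fun i => g (f i)) ∪ ∅ : Finset β), ∃ i,
          g (f i) = b := fun b => by simpa using b.2
      choose k hk using hch
      refine ⟨OrderEmbedding.ofMapLEIff (fun b => s (k b)) fun b c => ?_, fun i => ?_⟩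
      · rw [h]
        change g (f (k b)) ≤ g (f (k c)) ↔ _
        rw [hk, hk]; rfl
      · exact (h.eq_iff _ _).2 (hk _)
    | insert b T _ ih =>
      obtain ⟨F, hF⟩ := ih
      obtain ⟨G, hG⟩ := Order.exists_orderEmbedding_insert _ F b
      have hsub : ∀ x, x ∈ ((Finset.univ.image fun i => g (f i)) ∪ insert b T : Finset β) →
          x ∈ insert b ((Finset.univ.image fun i => g (f i)) ∪ T) := fun x hx => by
        simpa [or_left_comm] using hx
      refine ⟨OrderEmbedding.ofMapLEIff (fun x => G ⟨x, hsub x x.2⟩) fun x y => ?_, fun i => ?_⟩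
      · rw [G.le_iff_le]; rfl
      · rw [← hF i]
        exact congrFun hG ⟨g (f i), by simp⟩
  obtain ⟨F, hF⟩ := key (Finset.univ.image g)
  exact ⟨fun j => F ⟨g j, by simp⟩, fun i j => by rw [F.le_iff_le]; rfl, hF⟩

end OrdEq

end TimedPDA

namespace TimedPDA

open Enc (enc)

variable {α β : Type} [Enc α] [Enc β]

/-! ### Reading trees -/

namespace Data

/-- The length of the right spine. -/
def toNat : Data → ℕ
  | nil => 0
  | node _ b => b.toNat + 1

def toList : Data → List Data
  | nil => []
  | node a b => a :: b.toList

theorem toNat_unary (n : ℕ) : (unary n).toNat = n := by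
  induction n with
  | zero => rfl
  | succ n ih => exact congrArg (· + 1) ih

theorem length_toList (d : Data) : d.toList.length = d.toNat := by
  induction d with
  | nil => rfl
  | node a b _ ih => exact congrArg (· + 1) ih

theorem toList_list (l : List Data) : (list l).toList = l := by
  induction l with
  | nil => rfl
  | cons a l ih => exact congrArg (a :: ·) ih

theorem enc_toList (d : Data) : enc d.toList = d := by
  induction d with
  | nil => rfl
  | node a b _ ih => exact congrArg (node a) ih

theorem size_fst_le (d : Data) : d.fst.size ≤ d.size := by
  cases d
  · exact le_rfl
  · simp only [fst, size]; omega

theorem size_snd_le (d : Data) : d.snd.size ≤ d.size := by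
  cases d
  · exact le_rfl
  · simp only [snd, size]; omega

theorem size_fst_add_size_snd_le (d : Data) : d.fst.size + d.snd.size ≤ d.size + 1 := by
  cases d
  · exact le_rfl
  · simp only [fst, snd, size]; omega

end Data

namespace PF

@[fun_prop]
theorem toList {f : α → Data} (hf : PF f) : PF fun a => (f a).toList :=
  hf.recode fun _ => Data.enc_toList _

@[fun_prop]
theorem toNat {f : α → Data} (hf : PF f) : PF fun a => (f a).toNat := by
  simpa only [Data.length_toList] using hf.toList.length

end PF

/-! ### Evaluation of boolean combinations -/

section Eval

/-- The truth value of the representation of a boolean combination. -/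
def evalData (at' : Data → Bool) : Data → Bool
  | .nil => true
  | .node t b =>
    if t.toNat = 0 then true
    else if t.toNat = 1 then at' b
    else if t.toNat = 2 then !evalData at' b
    else if t.toNat = 3 then evalData at' b.fst && evalData at' b.snd
    else evalData at' b.fst || evalData at' b.snd
termination_by d => d.size
decreasing_by
  all_goals
    have := b.size_fst_le
    have := b.size_snd_le
    have := t.one_le_size
    simp only [Data.size]
    omega

variable {V : Type}

theorem evalData_encode {at' : Data → Bool} {e : V → Data} (φ : Constraint V)
    (sat : Constraint V → Prop) (h0 : sat .verum) (h1 : ∀ a, sat (.atom a) ↔ at' (a.encode e) = true)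
    (h2 : ∀ φ, sat (.neg φ) ↔ ¬ sat φ) (h3 : ∀ φ χ, sat (.and φ χ) ↔ sat φ ∧ sat χ)
    (h4 : ∀ φ χ, sat (.or φ χ) ↔ sat φ ∨ sat χ) :
    evalData at' (φ.encode e) = true ↔ sat φ := by
  induction φ with
  | verum => simp [Constraint.encode, Data.tag, evalData, Data.toNat_unary, h0]
  | atom a => simp [Constraint.encode, Data.tag, evalData, Data.toNat_unary, h1]
  | neg φ ih => simp [Constraint.encode, Data.tag, evalData, Data.toNat_unary, h2, ← ih]
  | and φ χ ih ih' =>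
    simp [Constraint.encode, Data.tag, evalData, Data.toNat_unary, h3, ← ih, ← ih', Data.fst,
      Data.snd]
  | or φ χ ih ih' =>
    simp [Constraint.encode, Data.tag, evalData, Data.toNat_unary, h4, ← ih, ← ih', Data.fst,
      Data.snd]

/-- Processing an item `i` of the work list, where `w` is the rest of it and `v` the list of values.
The work list holds trees to be evaluated (label `0`) and negations, conjunctions and disjunctions to
be carried out (labels `1`, `2` and above). -/
def evalItem (at' : α → Data → Bool) (a : α) (v : List Bool) (i : ℕ × Data)
    (w : List (ℕ × Data)) : List (ℕ × Data) × List Bool :=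
  bif decide (i.1 = 0) then
    bif decide (i.2.fst.toNat ≤ 1) then
      (w, (bif decide (i.2.fst.toNat = 0) then true else at' a i.2.snd) :: v)
    else bif decide (i.2.fst.toNat = 2) then ((0, i.2.snd) :: (1, Data.nil) :: w, v)
    else ((0, i.2.snd.fst) :: (0, i.2.snd.snd) ::
      ((bif decide (i.2.fst.toNat = 3) then 2 else 3), Data.nil) :: w, v)
  else (w,
    bif decide (i.1 = 1) then (!v.headD false) :: v.tail
    else (bif decide (i.1 = 2) then v.headD false && v.tail.headD false
      else v.headD false || v.tail.headD false) :: v.tail.tail)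

/-- One step of a stack machine for `evalData`. -/
def evalStep (at' : α → Data → Bool) (s : α × List (ℕ × Data) × List Bool) :
    α × List (ℕ × Data) × List Bool :=
  match s.2.1 with
  | [] => s
  | i :: w => (s.1, evalItem at' s.1 s.2.2 i w)

theorem evalStep_pf {at' : α → Data → Bool} (hat : PF fun p : α × Data => at' p.1 p.2) :
    PF (evalStep at') := by
  have h : PF fun p : (α × List (ℕ × Data) × List Bool) × (ℕ × Data) × List (ℕ × Data) =>
      at' p.1.1 p.2.1.2.snd :=
    hat.comp (g := fun p : α × Data => at' p.1 p.2)
      (f := fun p : (α × List (ℕ × Data) × List Bool) × (ℕ × Data) × List (ℕ × Data) =>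
      (p.1.1, p.2.1.2.snd)) (by fun_prop)
  have h' : PF fun p : (α × List (ℕ × Data) × List Bool) × (ℕ × Data) × List (ℕ × Data) =>
      (p.1.1, evalItem at' p.1.1 p.1.2.2 p.2.1 p.2.2) := by
    unfold evalItem
    fun_prop
  have := PF.listCases (l := fun s : α × List (ℕ × Data) × List Bool => s.2.1)
    (f := fun s => s) (g := fun s i w => (s.1, evalItem at' s.1 s.2.2 i w)) (by fun_prop)
    (by fun_prop) h'
  exact this.recode fun s => by obtain ⟨a, w, v⟩ := s; cases w <;> rfl

/-- The tree on top of the work list turns into its value while the rest of both stacks is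
untouched, so the statement can be used for subtrees. The factor `4` leaves room for opening a node
and carrying out its connective. -/
theorem evalStep_iterate {α : Type} (at' : α → Data → Bool) (a : α) : ∀ d : Data, ∃ n ≤ 4 * d.size,
    ∀ (w : List (ℕ × Data)) (v : List Bool),
      (evalStep at')^[n] (a, (0, d) :: w, v) = (a, w, evalData (at' a) d :: v) := by
  suffices ∀ (k : ℕ) (d : Data), d.size = k → ∃ n ≤ 4 * d.size,
    ∀ (w : List (ℕ × Data)) (v : List Bool),
      (evalStep at')^[n] (a, (0, d) :: w, v) = (a, w, evalData (at' a) d :: v) from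
    fun d => this _ d rfl
  intro k
  induction k using Nat.strong_induction_on with
  | _ k ih =>
    rintro d rfl
    cases d with
    | nil => exact ⟨1, by simp [Data.size], fun w v => by simp [evalStep, evalItem, evalData, Data.fst,
        Data.toNat]⟩
    | node t b =>
      have hs : (Data.node t b).size = t.size + b.size + 1 := rfl
      have ht := t.one_le_size
      have hb1 := b.size_fst_le
      have hb2 := b.size_snd_le
      have hb3 := b.size_fst_add_size_snd_le
      rw [evalData]
      by_cases h0 : t.toNat = 0
      · exact ⟨1, by omega, fun w v => by simp [evalStep, evalItem, Data.fst, h0]⟩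
      by_cases h1 : t.toNat = 1
      · exact ⟨1, by omega, fun w v => by simp [evalStep, evalItem, Data.fst, Data.snd, h1]⟩
      by_cases h2 : t.toNat = 2
      · obtain ⟨n, hn, hb⟩ := ih b.size (by omega) b rfl
        refine ⟨1 + (n + 1), by omega, fun w v => ?_⟩
        rw [add_comm 1, Function.iterate_add_apply, Function.iterate_one, add_comm n,
          Function.iterate_add_apply, Function.iterate_one]
        have : evalStep at' (a, (0, Data.node t b) :: w, v) = (a, (0, b) :: (1, Data.nil) :: w, v) := by
          simp [evalStep, evalItem, Data.fst, Data.snd, h2]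
        rw [this, hb]
        simp [evalStep, evalItem, h2]
      · obtain ⟨n, hn, hb⟩ := ih b.fst.size (by omega) b.fst rfl
        obtain ⟨m, hm, hb'⟩ := ih b.snd.size (by omega) b.snd rfl
        refine ⟨1 + (m + (n + 1)), by omega, fun w v => ?_⟩
        rw [Function.iterate_add_apply, Function.iterate_one, Function.iterate_add_apply,
          Function.iterate_add_apply, Function.iterate_one]
        have : evalStep at' (a, (0, Data.node t b) :: w, v) = (a, (0, b.fst) :: (0, b.snd) ::
            ((bif decide (t.toNat = 3) then 2 else 3), Data.nil) :: w, v) := by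
          have : ¬ t.toNat ≤ 1 := by omega
          simp [evalStep, evalItem, Data.fst, Data.snd, h2, this]; rfl
        rw [this, hb, hb']
        -- The operands come off the value stack in reverse order; both connectives are commutative.
        by_cases h3 : t.toNat = 3
        · simp [evalStep, evalItem, h3, Bool.and_comm]
        · simp [evalStep, evalItem, h0, h1, h2, h3, Bool.or_comm]

/-- A tree is replaced by subtrees of itself and labels of bounded size. Linear growth together with
a linear number of steps keeps the states polynomial. -/
theorem evalStep_size (at' : α → Data → Bool) (s : α × List (ℕ × Data) × List Bool) :
    sz (evalStep at' s) ≤ sz s + 40 := by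
  obtain ⟨a, w, v⟩ := s
  cases w with
  | nil => simp [evalStep]
  | cons i w =>
    obtain ⟨k, d⟩ := i
    have hd1 : sz d.snd ≤ sz d := d.size_snd_le
    have hd2 : sz d.snd.fst + sz d.snd.snd ≤ sz d.snd + 1 := d.snd.size_fst_add_size_snd_le
    have hb : ∀ b : Bool, sz b ≤ 3 := sz_bool_le
    have hv : sz v.tail ≤ sz v := by
      cases v with
      | nil => exact le_rfl
      | cons b v => rw [List.tail_cons, sz_cons]; omega
    have hv' : sz v.tail.tail ≤ sz v := by
      cases v with
      | nil => exact le_rfl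
      | cons b v =>
        cases v with
        | nil => rw [List.tail_cons, sz_cons]; exact Nat.le_add_left _ _ |>.trans (Nat.le_add_right _ _)
        | cons b' v => rw [List.tail_cons, List.tail_cons, sz_cons, sz_cons]; omega
    have hn : sz Data.nil = 1 := rfl
    simp only [evalStep, evalItem]
    cases h1 : decide (k = 0)
    · simp only [cond_false, sz_prod, sz_cons]
      cases h2 : decide (k = 1)
      · simp only [cond_false, sz_cons]
        have := hb (bif decide (k = 2) then v.headD false && v.tail.headD false
          else v.headD false || v.tail.headD false)
        omega
      · simp only [cond_true, sz_cons]
        have := hb (!v.headD false)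
        omega
    · simp only [cond_true]
      cases h2 : decide (d.fst.toNat ≤ 1)
      · cases h3 : decide (d.fst.toNat = 2)
        · simp only [cond_false, sz_prod, sz_cons, sz_nat]
          have : (bif decide (d.fst.toNat = 3) then 2 else 3) ≤ 3 := by
            cases decide (d.fst.toNat = 3) <;> decide
          omega
        · simp only [cond_false, cond_true, sz_prod, sz_cons, sz_nat]
          omega
      · simp only [cond_true, sz_prod, sz_cons]
        have := hb (bif decide (d.fst.toNat = 0) then true else at' a d.snd)
        omega

/-- Programs have loops but no recursion, hence the detour through the stack machine. -/
theorem PF.evalData {at' : α → Data → Bool} {f : α → Data}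
    (hat : PF fun p : α × Data => at' p.1 p.2) (hf : PF f) :
    PF fun a => evalData (at' a) (f a) := by
  have hc : PF (fun s : α × List (ℕ × Data) × List Bool => !decide (s.2.1.length = 0)) := by
    fun_prop
  have hK : PB fun a : α => 4 * (f a).size := (PB.const 4).mul hf.size
  have hinit : PF fun a => (a, [((0 : ℕ), f a)], ([] : List Bool)) := by fun_prop
  have := loop (g := fun a => (a, ([] : List (ℕ × Data)), [TimedPDA.evalData (at' a) (f a)]))
    (evalStep_pf hat) hc hinit hK (hinit.size.add ((PB.const 40).mul hK)) ?_
  · have := ((snd.comp snd).comp this).headD false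
    simpa using this
  intro a
  obtain ⟨n, hn, hev⟩ := evalStep_iterate at' a (f a)
  have hev := hev [] []
  -- The loop stops at the first empty work list, possibly before step `n`; since the machine idles
  -- from then on, its state is already the final one.
  have hfix : ∀ m (v : List Bool), (evalStep at')^[m] (a, [], v) = (a, [], v) := by
    intro m v
    induction m with
    | zero => rfl
    | succ m ih => exact ih
  have hex : ∃ k, ((evalStep at')^[k] (a, [((0 : ℕ), f a)], ([] : List Bool))).2.1 = [] :=
    ⟨n, by rw [hev]⟩
  classical
  have hkn : Nat.find hex ≤ n := Nat.find_min' hex (by rw [hev])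
  refine ⟨Nat.find hex, hkn.trans hn, fun i hi => ?_, ?_, fun i hi => ?_, ?_⟩
  · have := Nat.find_min hex hi
    cases h : ((evalStep at')^[i] (a, [((0 : ℕ), f a)], ([] : List Bool))).2.1 with
    | nil => exact absurd h this
    | cons b t => simp
  · simp [Nat.find_spec hex]
  · have : ∀ j, sz ((evalStep at')^[j] (a, [((0 : ℕ), f a)], ([] : List Bool))) ≤
        sz (a, [((0 : ℕ), f a)], ([] : List Bool)) + 40 * j := by
      intro j
      induction j with
      | zero => exact le_rfl
      | succ j ih =>
        rw [Function.iterate_succ_apply']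
        have := evalStep_size at' ((evalStep at')^[j] (a, [((0 : ℕ), f a)], ([] : List Bool)))
        omega
    have := this i
    simp only [sz_prod, sz_cons] at *
    omega
  · obtain ⟨m, hm⟩ := Nat.exists_eq_add_of_le hkn
    have hsp := Nat.find_spec hex
    rw [← hev, hm, add_comm, Function.iterate_add_apply]
    set st := (evalStep at')^[Nat.find hex] (a, [((0 : ℕ), f a)], ([] : List Bool)) with hst
    have ha : ∀ j (s : α × List (ℕ × Data) × List Bool), ((evalStep at')^[j] s).1 = s.1 := by
      intro j
      induction j with
      | zero => exact fun _ => rfl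
      | succ j ih =>
        intro s
        rw [Function.iterate_succ_apply, ih]
        unfold evalStep
        cases s.2.1 <;> rfl
    have : st = (a, [], st.2.2) := by
      refine Prod.ext (ha _ _) (Prod.ext hsp rfl)
    rw [this, hfix]

end Eval

end TimedPDA

namespace TimedPDA

open Enc (enc)

variable {α β : Type} [Enc α] [Enc β]

/-! ### The productions of the grammar -/

/-- The entry number `j` in the group that begins at `o`. -/
def coord (h : List ℕ) (o j : ℕ) : ℕ := h.getD (o + j) 0

/-- A tuple consists of three groups of `X + 1` entries, at offsets `0`, `X + 1` and `2 * (X + 1)`,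
for the initial, final and intermediate stamps, and of the stack stamps from `3 * (X + 1)` on. In a
group the clocks come first and the current time is the entry number `X`. -/
def sameOn (X o o' : ℕ) (h : List ℕ) : Bool :=
  (List.range (X + 1)).all fun j => decide (coord h o j = coord h o' j)

/-- The entries of two groups of `f`, with the corresponding entries of the first two groups of `g`. -/
def coordPairs (X o o' : ℕ) (f g : List ℕ) : List (ℕ × ℕ) :=
  ((List.range (X + 1)).map fun j => (coord f o j, coord g 0 j)) ++
    (List.range (X + 1)).map fun j => (coord f o' j, coord g (X + 1) j)

/-- The groups of `f` at `o` and `o'` are ordered like the first two groups of `g`. -/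
def sameOrder (X o o' : ℕ) (f g : List ℕ) : Bool :=
  (coordPairs X o o' f g).all fun p => (coordPairs X o o' f g).all fun q =>
    decide (p.1 ≤ q.1) == decide (p.2 ≤ q.2)

def cycLeBool (o x y : ℕ) : Bool :=
  (decide (x ≤ o) && (decide (o < y) || decide (y ≤ x))) ||
    (decide (o < x) && (decide (o < y) && decide (y ≤ x)))

/-- The entry for the clock represented by `d`, which is a global clock if `b` holds. -/
def clockCoord (b : Bool) (X o : ℕ) (h : List ℕ) (d : Data) : ℕ :=
  bif b then coord h o d.toNat
  else bif decide (d.fst.toNat = 0) then coord h o d.snd.toNat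
  else coord h (3 * (X + 1)) d.snd.toNat

def atomHolds (b : Bool) (X o : ℕ) (h : List ℕ) (d : Data) : Bool :=
  bif decide (d.fst.toNat = 2) then decide (clockCoord b X o h d.snd = coord h o X)
  else bif decide (d.fst.toNat = 5) then
    cycLeBool (coord h o X) (clockCoord b X o h d.snd.fst) (clockCoord b X o h d.snd.snd)
  else false

def constraintHolds (b : Bool) (X o : ℕ) (h : List ℕ) (d : Data) : Bool :=
  evalData (atomHolds b X o h) d

/-- The operation represented by `d` relates the first group to the second one. -/
def opHolds (X : ℕ) (d : Data) (h : List ℕ) : Bool :=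
  bif decide (d.fst.toNat = 0) then
    -- The range stops before `X`: the current time may change.
    (List.range X).all fun j => decide (coord h (X + 1) j = coord h 0 j)
  else bif decide (d.fst.toNat ≤ 2) then sameOn X (X + 1) 0 h
  else bif decide (d.fst.toNat = 3) then
    sameOn X (X + 1) 0 h && constraintHolds true X 0 h d.snd
  else bif decide (d.fst.toNat = 4) then
    decide (coord h (X + 1) X = coord h 0 X) && (List.range X).all fun j =>
      decide (coord h (X + 1) j = bif decide ((d.snd.toList.getD j .nil).toNat = 0) then coord h 0 j
        else coord h 0 X)
  else false

def opLetters (d : Data) : List ℕ :=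
  bif decide (d.fst.toNat = 2) then [d.snd.toNat] else []

/-- The operations represented by `d` and `d'` push and pop the same symbol, in the situations
described by the first and the second group, with the stack clocks in the last group. -/
def stackHolds (X : ℕ) (d d' : Data) (h : List ℕ) : Bool :=
  (decide (d.fst.toNat = 5) && (decide (d'.fst.toNat = 6) &&
    decide (d.snd.fst.toNat = d'.snd.fst.toNat))) &&
  (constraintHolds false X 0 h d.snd.snd && constraintHolds false X (X + 1) h d'.snd.snd)

/-- The number of a nonterminal, for two locations and an order type. -/
def code (L n ℓ r i : ℕ) : ℕ := (ℓ * L + r) * n + i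

/-- Productions: left hand side, nonterminals and letters of the right hand side. -/
abbrev Production : Type := ℕ × List ℕ × List ℕ

def idProductions (L X : ℕ) (H : List (List ℕ)) : List Production :=
  (List.range L).flatMap fun ℓ => (List.range H.length).flatMap fun i =>
    bif sameOn X 0 (X + 1) (H.getD i []) then [(code L H.length ℓ ℓ i, [], [])] else []

/-- Only the first two groups of a tuple matter for the meaning of a nonterminal; the others are
witnesses. Renaming exchanges the witnesses, so that each remaining production may read the ones it
needs off its own left hand side. -/
def renameProductions (L X : ℕ) (H : List (List ℕ)) : List Production :=
  (List.range L).flatMap fun ℓ => (List.range L).flatMap fun r =>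
    (List.range H.length).flatMap fun i => (List.range H.length).flatMap fun j =>
      bif sameOrder X 0 (X + 1) (H.getD i []) (H.getD j []) then
        [(code L H.length ℓ r i, [code L H.length ℓ r j], [])]
      else []

/-- The intermediate stamps are the third group of the tuple on the left, so the two factors share
one linear order with the endpoints. -/
def compProductions (L X : ℕ) (H : List (List ℕ)) : List Production :=
  (List.range L).flatMap fun ℓ => (List.range L).flatMap fun k => (List.range L).flatMap fun r =>
    (List.range H.length).flatMap fun i => (List.range H.length).flatMap fun j =>
      (List.range H.length).flatMap fun j' =>
        bif sameOrder X 0 (2 * (X + 1)) (H.getD i []) (H.getD j []) &&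
          sameOrder X (2 * (X + 1)) (X + 1) (H.getD i []) (H.getD j' []) then
          [(code L H.length ℓ r i, [code L H.length ℓ k j, code L H.length k r j'], [])]
        else []

def opProductions (L X : ℕ) (H : List (List ℕ)) (R : List Data) : List Production :=
  R.flatMap fun ρ => (List.range H.length).flatMap fun i =>
    bif opHolds X ρ.snd.fst (H.getD i []) then
      [(code L H.length ρ.fst.toNat ρ.snd.snd.toNat i, [], opLetters ρ.snd.fst)]
    else []

/-- The type `i` is the same on both sides because push and pop change neither the clocks nor the
time. -/
def stackProductions (L X : ℕ) (H : List (List ℕ)) (R : List Data) : List Production :=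
  R.flatMap fun ρ => R.flatMap fun ρ' => (List.range H.length).flatMap fun i =>
    bif stackHolds X ρ.snd.fst ρ'.snd.fst (H.getD i []) then
      [(code L H.length ρ.fst.toNat ρ'.snd.snd.toNat i,
        [code L H.length ρ.snd.snd.toNat ρ'.fst.toNat i], [])]
    else []

def productions (L X : ℕ) (H : List (List ℕ)) (R : List Data) : List Production :=
  idProductions L X H ++ (renameProductions L X H ++ (compProductions L X H ++
    (opProductions L X H R ++ stackProductions L X H R)))

namespace PF

variable {X o o' j L n ℓ r i : α → ℕ} {f g h : α → List ℕ} {d d' : α → Data} {b : α → Bool}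
  {H : α → List (List ℕ)} {R : α → List Data}

@[fun_prop]
theorem coord (hh : PF h) (ho : PF o) (hj : PF j) : PF fun a => coord (h a) (o a) (j a) := by
  unfold TimedPDA.coord
  fun_prop

@[fun_prop]
theorem sameOn (hX : PF X) (ho : PF o) (ho' : PF o') (hh : PF h) :
    PF fun a => sameOn (X a) (o a) (o' a) (h a) := by
  unfold TimedPDA.sameOn
  fun_prop

@[fun_prop]
theorem coordPairs (hX : PF X) (ho : PF o) (ho' : PF o') (hf : PF f) (hg : PF g) :
    PF fun a => coordPairs (X a) (o a) (o' a) (f a) (g a) := by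
  unfold TimedPDA.coordPairs
  fun_prop

@[fun_prop]
theorem sameOrder (hX : PF X) (ho : PF o) (ho' : PF o') (hf : PF f) (hg : PF g) :
    PF fun a => sameOrder (X a) (o a) (o' a) (f a) (g a) := by
  unfold TimedPDA.sameOrder
  fun_prop

@[fun_prop]
theorem cycLeBool {x y : α → ℕ} (ho : PF o) (hx : PF x) (hy : PF y) :
    PF fun a => cycLeBool (o a) (x a) (y a) := by
  unfold TimedPDA.cycLeBool
  fun_prop

@[fun_prop]
theorem clockCoord (hb : PF b) (hX : PF X) (ho : PF o) (hh : PF h) (hd : PF d) :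
    PF fun a => clockCoord (b a) (X a) (o a) (h a) (d a) := by
  unfold TimedPDA.clockCoord
  fun_prop

@[fun_prop]
theorem atomHolds (hb : PF b) (hX : PF X) (ho : PF o) (hh : PF h) (hd : PF d) :
    PF fun a => atomHolds (b a) (X a) (o a) (h a) (d a) := by
  unfold TimedPDA.atomHolds
  fun_prop

@[fun_prop]
theorem constraintHolds (hb : PF b) (hX : PF X) (ho : PF o) (hh : PF h) (hd : PF d) :
    PF fun a => constraintHolds (b a) (X a) (o a) (h a) (d a) :=
  PF.evalData (at' := fun a => TimedPDA.atomHolds (b a) (X a) (o a) (h a)) (by fun_prop) hd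

@[fun_prop]
theorem opHolds (hX : PF X) (hd : PF d) (hh : PF h) :
    PF fun a => opHolds (X a) (d a) (h a) := by
  unfold TimedPDA.opHolds
  fun_prop

@[fun_prop]
theorem opLetters (hd : PF d) : PF fun a => opLetters (d a) := by
  unfold TimedPDA.opLetters
  fun_prop

@[fun_prop]
theorem stackHolds (hX : PF X) (hd : PF d) (hd' : PF d') (hh : PF h) :
    PF fun a => stackHolds (X a) (d a) (d' a) (h a) := by
  unfold TimedPDA.stackHolds
  fun_prop

@[fun_prop]
theorem code (hL : PF L) (hn : PF n) (hℓ : PF ℓ) (hr : PF r) (hi : PF i) :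
    PF fun a => code (L a) (n a) (ℓ a) (r a) (i a) := by
  unfold TimedPDA.code
  fun_prop

@[fun_prop]
theorem productions (hL : PF L) (hX : PF X) (hH : PF H) (hR : PF R) :
    PF fun a => productions (L a) (X a) (H a) (R a) := by
  have h1 : PF fun a => idProductions (L a) (X a) (H a) := by
    unfold idProductions
    fun_prop
  have h2 : PF fun a => renameProductions (L a) (X a) (H a) := by
    unfold renameProductions
    fun_prop
  have h3 : PF fun a => compProductions (L a) (X a) (H a) := by
    unfold compProductions
    fun_prop
  have h4 : PF fun a => opProductions (L a) (X a) (H a) (R a) := by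
    unfold opProductions
    fun_prop
  have h5 : PF fun a => stackProductions (L a) (X a) (H a) (R a) := by
    unfold stackProductions
    fun_prop
  unfold TimedPDA.productions
  fun_prop

end PF

end TimedPDA

namespace TimedPDA

open Enc (enc)

variable {α β : Type} [Enc α] [Enc β]

/-! ### The formulas -/

namespace IntTerm

def sum (l : List IntTerm) : IntTerm := l.foldr .add (.const 0)

end IntTerm

namespace Formula

def conjs (l : List Formula) : Formula := l.foldr .and .verum

def disjs (l : List Formula) : Formula := l.foldr .or (.neg .verum)

def exInts (l : List ℕ) (φ : Formula) : Formula := l.foldr .exInt φ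

def exRats (l : List ℕ) (φ : Formula) : Formula := l.foldr .exRat φ

end Formula

namespace PF

@[fun_prop]
theorem intVar {i : α → ℕ} (hi : PF i) : PF fun a => IntTerm.var (i a) :=
  ((const 0).prodMk hi).recode fun _ => rfl

@[fun_prop]
theorem intAdd {s t : α → IntTerm} (hs : PF s) (ht : PF t) : PF fun a => (s a).add (t a) :=
  ((const 2).prodMk (hs.prodMk ht)).recode fun _ => rfl

@[fun_prop]
theorem intSum {l : α → List IntTerm} (hl : PF l) : PF fun a => IntTerm.sum (l a) :=
  hl.foldr (k := 7) (const _) (by fun_prop) fun s t => by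
    have : sz (s.add t) = sz (2 : ℕ) + (sz s + sz t + 1) + 1 := rfl
    rw [this, sz_nat]
    omega

@[fun_prop]
theorem ratVar {i : α → ℕ} (hi : PF i) : PF fun a => RatTerm.var (i a) :=
  ((const 0).prodMk hi).recode fun _ => rfl

@[fun_prop]
theorem ratAdd {s t : α → RatTerm} (hs : PF s) (ht : PF t) : PF fun a => (s a).add (t a) :=
  ((const 2).prodMk (hs.prodMk ht)).recode fun _ => rfl

@[fun_prop]
theorem intLe {s t : α → IntTerm} (hs : PF s) (ht : PF t) : PF fun a => Formula.intLe (s a) (t a) :=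
  ((const 1).prodMk (hs.prodMk ht)).recode fun _ => rfl

@[fun_prop]
theorem intEq {s t : α → IntTerm} (hs : PF s) (ht : PF t) : PF fun a => Formula.intEq (s a) (t a) :=
  ((const 2).prodMk (hs.prodMk ht)).recode fun _ => rfl

@[fun_prop]
theorem ratLe {s t : α → RatTerm} (hs : PF s) (ht : PF t) : PF fun a => Formula.ratLe (s a) (t a) :=
  ((const 4).prodMk (hs.prodMk ht)).recode fun _ => rfl

@[fun_prop]
theorem ratEq {s t : α → RatTerm} (hs : PF s) (ht : PF t) : PF fun a => Formula.ratEq (s a) (t a) :=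
  ((const 5).prodMk (hs.prodMk ht)).recode fun _ => rfl

variable {φ χ : α → Formula}

@[fun_prop]
theorem formulaNeg (hφ : PF φ) : PF fun a => (φ a).neg :=
  ((const 6).prodMk hφ).recode fun _ => rfl

@[fun_prop]
theorem formulaAnd (hφ : PF φ) (hχ : PF χ) : PF fun a => (φ a).and (χ a) :=
  ((const 7).prodMk (hφ.prodMk hχ)).recode fun _ => rfl

@[fun_prop]
theorem formulaOr (hφ : PF φ) (hχ : PF χ) : PF fun a => (φ a).or (χ a) :=
  ((const 8).prodMk (hφ.prodMk hχ)).recode fun _ => rfl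

@[fun_prop]
theorem exInt {i : α → ℕ} (hi : PF i) (hφ : PF φ) : PF fun a => Formula.exInt (i a) (φ a) :=
  ((const 9).prodMk (hi.prodMk hφ)).recode fun _ => rfl

@[fun_prop]
theorem exRat {i : α → ℕ} (hi : PF i) (hφ : PF φ) : PF fun a => Formula.exRat (i a) (φ a) :=
  ((const 10).prodMk (hi.prodMk hφ)).recode fun _ => rfl

@[fun_prop]
theorem conjs {l : α → List Formula} (hl : PF l) : PF fun a => Formula.conjs (l a) :=
  hl.foldr (k := 17) (const _) (by fun_prop) fun s t => by
    have : sz (s.and t) = sz (7 : ℕ) + (sz s + sz t + 1) + 1 := rfl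
    rw [this, sz_nat]
    omega

@[fun_prop]
theorem disjs {l : α → List Formula} (hl : PF l) : PF fun a => Formula.disjs (l a) :=
  hl.foldr (k := 19) (const _) (by fun_prop) fun s t => by
    have : sz (s.or t) = sz (8 : ℕ) + (sz s + sz t + 1) + 1 := rfl
    rw [this, sz_nat]
    omega

@[fun_prop]
theorem exInts {l : α → List ℕ} (hl : PF l) (hφ : PF φ) : PF fun a => Formula.exInts (l a) (φ a) :=
  hl.foldr (k := 21) hφ (by fun_prop) fun i t => by
    have : sz (Formula.exInt i t) = sz (9 : ℕ) + (sz i + sz t + 1) + 1 := rfl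
    rw [this, sz_nat]
    omega

@[fun_prop]
theorem exRats {l : α → List ℕ} (hl : PF l) (hφ : PF φ) : PF fun a => Formula.exRats (l a) (φ a) :=
  hl.foldr (k := 23) hφ (by fun_prop) fun i t => by
    have : sz (Formula.exRat i t) = sz (10 : ℕ) + (sz i + sz t + 1) + 1 := rfl
    rw [this, sz_nat]
    omega

end PF

/-! #### Parikh images of grammars

The integer variables are the numbers of occurrences of the `m` letters, the numbers of uses of the
productions in the list `G`, and the ranks of the nonterminals `0, …, N - 1`. -/

section Parikh

/-- The production number `j`. -/
def prod (G : List Production) (j : ℕ) : Production := G.getD j (0, [], [])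

def lhsTerms (m : ℕ) (G : List Production) (A : ℕ) : List IntTerm :=
  (List.range G.length).flatMap fun j =>
    bif decide ((prod G j).1 = A) then [IntTerm.var (m + j)] else []

def rhsTerms (m : ℕ) (G : List Production) (A : ℕ) : List IntTerm :=
  (List.range G.length).flatMap fun j => (prod G j).2.1.flatMap fun B =>
    bif decide (B = A) then [IntTerm.var (m + j)] else []

def letterTerms (m : ℕ) (G : List Production) (a : ℕ) : List IntTerm :=
  (List.range G.length).flatMap fun j => (prod G j).2.2.flatMap fun b =>
    bif decide (b = a) then [IntTerm.var (m + j)] else []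

def nonnegFormula (m j : ℕ) : Formula := .intLe (.const 0) (.var (m + j))

def letterFormula (m : ℕ) (G : List Production) (a : ℕ) : Formula :=
  .intEq (.var a) (.sum (letterTerms m G a))

def flowFormula (m : ℕ) (G : List Production) (S A : ℕ) : Formula :=
  .intEq (.add (bif decide (A = S) then .const 1 else .const 0) (.sum (rhsTerms m G A)))
    (.sum (lhsTerms m G A))

/-- The candidates for a parent of `A` in the sense of `Grammar.connected_of_rank`. -/
def parentFormulas (m : ℕ) (G : List Production) (A : ℕ) : List Formula :=
  (List.range G.length).flatMap fun j => (prod G j).2.1.flatMap fun B =>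
    bif decide (B = A) then
      [.and (.intLe (.const 1) (.var (m + j)))
        (.intLe (.add (.var (m + G.length + (prod G j).1)) (.const 1)) (.var (m + G.length + A)))]
    else []

def rankFormula (m : ℕ) (G : List Production) (S A : ℕ) : Formula :=
  bif decide (A = S) then .verum
  else .or (.intEq (.sum (lhsTerms m G A)) (.const 0)) (.disjs (parentFormulas m G A))

def parikhFormula (m : ℕ) (G : List Production) (N S : ℕ) : Formula :=
  .and (.conjs ((List.range G.length).map fun j => nonnegFormula m j))
    (.and (.conjs ((List.range m).map fun a => letterFormula m G a))
      (.and (.conjs ((List.range N).map fun A => flowFormula m G S A))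
        (.conjs ((List.range N).map fun A => rankFormula m G S A))))

namespace PF

variable {m S N A : α → ℕ} {G : α → List Production}

@[fun_prop]
theorem prod (hG : PF G) {j : α → ℕ} (hj : PF j) : PF fun a => prod (G a) (j a) := by
  unfold TimedPDA.prod
  fun_prop

@[fun_prop]
theorem parikhFormula (hm : PF m) (hG : PF G) (hN : PF N) (hS : PF S) :
    PF fun a => parikhFormula (m a) (G a) (N a) (S a) := by
  unfold TimedPDA.parikhFormula nonnegFormula letterFormula flowFormula rankFormula
    parentFormulas lhsTerms rhsTerms letterTerms
  fun_prop

end PF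

end Parikh

/-! #### Reachability

The rational variables are the fractional parts of the initial and final values of the `X` clocks,
followed by the entries of the first two groups of an order type. -/

section Reach

def typeVar (X i : ℕ) : RatTerm := .var (X + X + i)

/-- The fractional part `v` belongs to the time stamp `i` at time `o`. -/
def stampFormula (X v i o : ℕ) : Formula :=
  .or (.ratEq (.add (.var v) (typeVar X i)) (typeVar X o))
    (.ratEq (.add (.var v) (typeVar X i)) (.add (typeVar X o) (.const 1)))

def stampsFormula (X : ℕ) : Formula :=
  .conjs ((List.range X).map fun x => .and (stampFormula X x x X)
    (stampFormula X (X + x) (X + 1 + x) (X + 1 + X)))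

/-- Both bounds are strict: an order with a least element would lack the extension property on which
soundness rests. -/
def rangeFormula (X : ℕ) : Formula :=
  .conjs ((List.range (X + 1 + (X + 1))).map fun i =>
    .and (.neg (.ratLe (typeVar X i) (.const 0))) (.neg (.ratLe (.const 1) (typeVar X i))))

def typeFormula (X : ℕ) (f : List ℕ) : Formula :=
  .conjs ((List.range (X + 1 + (X + 1))).flatMap fun i =>
    (List.range (X + 1 + (X + 1))).map fun j =>
      bif decide (f.getD i 0 ≤ f.getD j 0) then .ratLe (typeVar X i) (typeVar X j)
      else .neg (.ratLe (typeVar X i) (typeVar X j)))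

/-- The disjunction over order types stands below the quantifiers, and all its members share the
same count and rank variables. -/
def reachMatrix (m L X : ℕ) (H : List (List ℕ)) (G : List Production) (ℓ r : ℕ) : Formula :=
  .and (.and (stampsFormula X) (rangeFormula X))
    (.disjs ((List.range H.length).map fun i => .and (typeFormula X (H.getD i []))
      (parikhFormula m G (L * L * H.length) (code L H.length ℓ r i))))

def reachFormula (m L X : ℕ) (H : List (List ℕ)) (G : List Production) (ℓ r : ℕ) : Formula :=
  .exRats ((List.range (X + 1 + (X + 1))).map fun i => X + X + i)
    (.exInts ((List.range (G.length + L * L * H.length)).map fun i => m + i)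
      (reachMatrix m L X H G ℓ r))

def reachFamily (m L X : ℕ) (H : List (List ℕ)) (G : List Production) : List (List Formula) :=
  (List.range L).map fun ℓ => (List.range L).map fun r => reachFormula m L X H G ℓ r

namespace PF

variable {m L X : α → ℕ} {H : α → List (List ℕ)} {G : α → List Production}

@[fun_prop]
theorem typeVar {i : α → ℕ} (hX : PF X) (hi : PF i) : PF fun a => typeVar (X a) (i a) := by
  unfold TimedPDA.typeVar
  fun_prop

@[fun_prop]
theorem stampFormula {v i o : α → ℕ} (hX : PF X) (hv : PF v) (hi : PF i) (ho : PF o) :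
    PF fun a => stampFormula (X a) (v a) (i a) (o a) := by
  unfold TimedPDA.stampFormula
  fun_prop

@[fun_prop]
theorem reachFormula {ℓ r : α → ℕ} (hm : PF m) (hL : PF L) (hX : PF X) (hH : PF H) (hG : PF G)
    (hℓ : PF ℓ) (hr : PF r) :
    PF fun a => reachFormula (m a) (L a) (X a) (H a) (G a) (ℓ a) (r a) := by
  unfold TimedPDA.reachFormula reachMatrix stampsFormula rangeFormula typeFormula
  fun_prop

theorem reachFamily (hm : PF m) (hL : PF L) (hX : PF X) (hH : PF H) (hG : PF G) :
    PF fun a => reachFamily (m a) (L a) (X a) (H a) (G a) := by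
  unfold TimedPDA.reachFamily
  fun_prop

end PF

end Reach

end TimedPDA

namespace TimedPDA

/-! ### The meaning of the formulas -/

namespace IntTerm

theorem eval_sum (v : ℕ → ℤ) (l : List IntTerm) : (sum l).eval v = (l.map (eval v)).sum := by
  induction l with
  | nil => rfl
  | cons t l ih => rw [List.map_cons, List.sum_cons, ← ih]; rfl

theorem vars_sum {l : List IntTerm} {i : ℕ} (h : i ∈ (sum l).vars) : ∃ t ∈ l, i ∈ t.vars := by
  induction l with
  | nil => exact h.elim
  | cons t l ih =>
    rcases h with h | h
    · exact ⟨t, by simp, h⟩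
    · obtain ⟨s, hs, h⟩ := ih h
      exact ⟨s, by simp [hs], h⟩

end IntTerm

namespace Formula

variable {v : ℕ → ℤ} {w : ℕ → ℚ} {l : List Formula}

theorem sat_conjs : (conjs l).Sat v w ↔ ∀ φ ∈ l, φ.Sat v w := by
  induction l with
  | nil => simp [conjs, Sat]
  | cons φ l ih =>
    rw [List.forall_mem_cons, ← ih]
    rfl

theorem sat_disjs : (disjs l).Sat v w ↔ ∃ φ ∈ l, φ.Sat v w := by
  induction l with
  | nil => simp [disjs, Sat]
  | cons φ l ih =>
    rw [List.exists_mem_cons_iff, ← ih]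
    rfl

theorem freeInt_conjs {i : ℕ} (h : i ∈ (conjs l).freeInt) : ∃ φ ∈ l, i ∈ φ.freeInt := by
  induction l with
  | nil => exact h.elim
  | cons φ l ih =>
    rcases h with h | h
    · exact ⟨φ, by simp, h⟩
    · obtain ⟨χ, hχ, h⟩ := ih h
      exact ⟨χ, by simp [hχ], h⟩

theorem freeInt_disjs {i : ℕ} (h : i ∈ (disjs l).freeInt) : ∃ φ ∈ l, i ∈ φ.freeInt := by
  induction l with
  | nil => exact h.elim
  | cons φ l ih =>
    rcases h with h | h
    · exact ⟨φ, by simp, h⟩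
    · obtain ⟨χ, hχ, h⟩ := ih h
      exact ⟨χ, by simp [hχ], h⟩

theorem freeRat_conjs {i : ℕ} (h : i ∈ (conjs l).freeRat) : ∃ φ ∈ l, i ∈ φ.freeRat := by
  induction l with
  | nil => exact h.elim
  | cons φ l ih =>
    rcases h with h | h
    · exact ⟨φ, by simp, h⟩
    · obtain ⟨χ, hχ, h⟩ := ih h
      exact ⟨χ, by simp [hχ], h⟩

theorem freeRat_disjs {i : ℕ} (h : i ∈ (disjs l).freeRat) : ∃ φ ∈ l, i ∈ φ.freeRat := by
  induction l with
  | nil => exact h.elim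
  | cons φ l ih =>
    rcases h with h | h
    · exact ⟨φ, by simp, h⟩
    · obtain ⟨χ, hχ, h⟩ := ih h
      exact ⟨χ, by simp [hχ], h⟩

theorem quantifierFree_conjs (h : ∀ φ ∈ l, φ.QuantifierFree) : (conjs l).QuantifierFree := by
  induction l with
  | nil => trivial
  | cons φ l ih => exact ⟨h φ (by simp), ih fun χ hχ => h χ (by simp [hχ])⟩

theorem quantifierFree_disjs (h : ∀ φ ∈ l, φ.QuantifierFree) : (disjs l).QuantifierFree := by
  induction l with
  | nil => trivial
  | cons φ l ih => exact ⟨h φ (by simp), ih fun χ hχ => h χ (by simp [hχ])⟩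

variable {φ : Formula}

theorem existential_exInts (h : φ.Existential) (l : List ℕ) : (exInts l φ).Existential := by
  induction l with
  | nil => exact h
  | cons i l ih => exact .exInt i ih

theorem existential_exRats (h : φ.Existential) (l : List ℕ) : (exRats l φ).Existential := by
  induction l with
  | nil => exact h
  | cons i l ih => exact .exRat i ih

theorem sat_exInts {l : List ℕ} :
    (exInts l φ).Sat v w ↔ ∃ v', (∀ i ∉ l, v' i = v i) ∧ φ.Sat v' w := by
  induction l generalizing v with
  | nil =>
    constructor
    · exact fun h => ⟨v, fun _ _ => rfl, h⟩
    · rintro ⟨v', h, h'⟩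
      obtain rfl : v' = v := funext fun i => h i (by simp)
      exact h'
  | cons i l ih =>
    constructor
    · rintro ⟨k, hk⟩
      obtain ⟨v', h, h'⟩ := ih.1 hk
      refine ⟨v', fun j hj => ?_, h'⟩
      rw [List.mem_cons, not_or] at hj
      rw [h j hj.2, Function.update_of_ne hj.1]
    · rintro ⟨v', h, h'⟩
      refine ⟨v' i, ih.2 ⟨v', fun j hj => ?_, h'⟩⟩
      by_cases hji : j = i
      · rw [hji, Function.update_self]
      · rw [Function.update_of_ne hji]
        exact h j (by simp [hji, hj])

theorem sat_exRats {l : List ℕ} :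
    (exRats l φ).Sat v w ↔ ∃ w', (∀ i ∉ l, w' i = w i) ∧ φ.Sat v w' := by
  induction l generalizing w with
  | nil =>
    constructor
    · exact fun h => ⟨w, fun _ _ => rfl, h⟩
    · rintro ⟨w', h, h'⟩
      obtain rfl : w' = w := funext fun i => h i (by simp)
      exact h'
  | cons i l ih =>
    constructor
    · rintro ⟨k, hk⟩
      obtain ⟨w', h, h'⟩ := ih.1 hk
      refine ⟨w', fun j hj => ?_, h'⟩
      rw [List.mem_cons, not_or] at hj
      rw [h j hj.2, Function.update_of_ne hj.1]
    · rintro ⟨w', h, h'⟩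
      refine ⟨w' i, ih.2 ⟨w', fun j hj => ?_, h'⟩⟩
      by_cases hji : j = i
      · rw [hji, Function.update_self]
      · rw [Function.update_of_ne hji]
        exact h j (by simp [hji, hj])

theorem freeInt_exInts (l : List ℕ) : (exInts l φ).freeInt = φ.freeInt \ {i | i ∈ l} := by
  induction l with
  | nil => simp [exInts]
  | cons i l ih =>
    change (exInts l φ).freeInt \ {i} = _
    rw [ih]
    ext j
    simp only [Set.mem_sdiff, Set.mem_ofPred_eq, Set.mem_singleton_iff, List.mem_cons]
    tauto

theorem freeRat_exRats (l : List ℕ) : (exRats l φ).freeRat = φ.freeRat \ {i | i ∈ l} := by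
  induction l with
  | nil => simp [exRats]
  | cons i l ih =>
    change (exRats l φ).freeRat \ {i} = _
    rw [ih]
    ext j
    simp only [Set.mem_sdiff, Set.mem_ofPred_eq, Set.mem_singleton_iff, List.mem_cons]
    tauto

theorem freeRat_exInts (l : List ℕ) : (exInts l φ).freeRat = φ.freeRat := by
  induction l with
  | nil => rfl
  | cons i l ih => exact ih

theorem freeInt_exRats (l : List ℕ) : (exRats l φ).freeInt = φ.freeInt := by
  induction l with
  | nil => rfl
  | cons i l ih => exact ih

end Formula

/-! #### Parikh images -/

theorem sum_map_flatMap_range {β : Type} (n : ℕ) (F : ℕ → List β) (g : β → ℤ) :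
    (((List.range n).flatMap F).map g).sum = ∑ j : Fin n, ((F j).map g).sum := by
  induction n with
  | zero => rfl
  | succ n ih =>
    rw [List.range_succ, List.flatMap_append, List.map_append, List.sum_append, ih,
      Fin.sum_univ_castSucc]
    simp

theorem sum_map_flatMap_count (v : ℕ → ℤ) (i A : ℕ) (l : List ℕ) :
    ((l.flatMap fun B => bif decide (B = A) then [IntTerm.var i] else []).map
      (IntTerm.eval v)).sum = l.count A * v i := by
  induction l with
  | nil => simp
  | cons B l ih =>
    rw [List.flatMap_cons, List.map_append, List.sum_append, ih, List.count_cons]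
    by_cases h : B = A
    · simp [h, IntTerm.eval]; ring
    · simp [h]

section Parikh

variable {m : ℕ} {G : List Production} {N S : ℕ} {v : ℕ → ℤ} {w : ℕ → ℚ}

/-- The left hand side of a production. -/
def lhsOf (G : List Production) (j : Fin G.length) : ℕ := (prod G j).1

/-- The nonterminals on the right hand side of a production. -/
def rhsOf (G : List Production) (j : Fin G.length) : Multiset ℕ := (prod G j).2.1

/-- The number of occurrences of a letter in a production. -/
def letterCount (G : List Production) (j : Fin G.length) (a : ℕ) : ℕ := (prod G j).2.2.count a

theorem eval_lhsTerms (A : ℕ) : (IntTerm.sum (lhsTerms m G A)).eval v =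
    ∑ j : Fin G.length, if lhsOf G j = A then v (m + j) else 0 := by
  rw [IntTerm.eval_sum, lhsTerms, sum_map_flatMap_range]
  refine Finset.sum_congr rfl fun j _ => ?_
  by_cases h : (prod G j).1 = A <;> simp [lhsOf, h, IntTerm.eval]

theorem eval_rhsTerms (A : ℕ) : (IntTerm.sum (rhsTerms m G A)).eval v =
    ∑ j : Fin G.length, ((rhsOf G j).count A : ℤ) * v (m + j) := by
  rw [IntTerm.eval_sum, rhsTerms, sum_map_flatMap_range]
  refine Finset.sum_congr rfl fun j _ => ?_
  rw [rhsOf, Multiset.coe_count]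
  exact sum_map_flatMap_count v _ A _

theorem eval_letterTerms (a : ℕ) : (IntTerm.sum (letterTerms m G a)).eval v =
    ∑ j : Fin G.length, (letterCount G j a : ℤ) * v (m + j) := by
  rw [IntTerm.eval_sum, letterTerms, sum_map_flatMap_range]
  exact Finset.sum_congr rfl fun j _ => sum_map_flatMap_count v _ a _

theorem sat_parentFormulas (A : ℕ) : (Formula.disjs (parentFormulas m G A)).Sat v w ↔
    ∃ j : Fin G.length, 1 ≤ v (m + j) ∧ A ∈ rhsOf G j ∧
      v (m + G.length + lhsOf G j) + 1 ≤ v (m + G.length + A) := by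
  rw [Formula.sat_disjs]
  constructor
  · rintro ⟨φ, hφ, hs⟩
    simp only [parentFormulas, List.mem_flatMap, List.mem_range] at hφ
    obtain ⟨j, hj, B, hB, hφ⟩ := hφ
    by_cases h : B = A
    · subst h
      simp only [decide_true, cond_true, List.mem_singleton] at hφ
      subst hφ
      exact ⟨⟨j, hj⟩, hs.1, hB, hs.2⟩
    · simp [h] at hφ
  · rintro ⟨j, h1, h2, h3⟩
    refine ⟨.and (.intLe (.const 1) (.var (m + j)))
      (.intLe (.add (.var (m + G.length + (prod G j).1)) (.const 1)) (.var (m + G.length + A))),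
      List.mem_flatMap.2 ⟨j, List.mem_range.2 j.2, List.mem_flatMap.2 ⟨A, h2, ?_⟩⟩, h1, h3⟩
    simp

/-- All nonterminals are smaller than `N`. -/
def BoundedBy (G : List Production) (N : ℕ) : Prop :=
  ∀ p ∈ G, p.1 < N ∧ ∀ B ∈ p.2.1, B < N

theorem prod_mem (j : Fin G.length) : prod G j ∈ G := by
  rw [prod, List.getD_eq_getElem _ _ j.2]
  exact List.getElem_mem _

theorem count_singleton_eq (A S : ℕ) : ((Multiset.count A {S} : ℕ) : ℤ) =
    IntTerm.eval v (bif decide (A = S) then .const 1 else .const 0) := by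
  by_cases h : A = S <;> simp [h, IntTerm.eval]

/-- Nonnegativity turns the variables into counts, the flow equations say that they are balanced,
and the ranks that they are connected. Numbers from `N` on occur in no production and are not the
start symbol, so they need no equations. -/
theorem exists_gen_of_sat (hN : BoundedBy G N) (hS : S < N)
    (h : (parikhFormula m G N S).Sat v w) : ∃ y, Grammar.Gen (lhsOf G) (rhsOf G) {S} y ∧
      ∀ a < m, v a = ∑ j, (letterCount G j a : ℤ) * y j := by
  obtain ⟨h1, h2, h3, h4⟩ := h
  rw [Formula.sat_conjs, List.forall_mem_map] at h1 h2 h3 h4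
  simp only [List.mem_range] at h1 h2 h3 h4
  have hy : ∀ j : Fin G.length, ((v (m + j)).toNat : ℤ) = v (m + j) := fun j =>
    Int.toNat_of_nonneg (h1 j j.2)
  refine ⟨fun j => (v (m + j)).toNat, ?_, fun a ha => ?_⟩
  · refine Grammar.gen_of_balanced _ rfl (fun A => ?_) (Grammar.connected_of_rank
      (z := fun A => v (m + G.length + A)) fun A => ?_)
    · by_cases hA : A < N
      · have : _ + (IntTerm.sum (rhsTerms m G A)).eval v = _ := h3 A hA
        rw [← count_singleton_eq, eval_rhsTerms, eval_lhsTerms] at this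
        apply Nat.cast_injective (R := ℤ)
        push_cast
        simp only [hy]
        rw [← this]
        exact congrArg _ (Finset.sum_congr rfl fun j _ => mul_comm _ _)
      · have e1 : ∀ j, lhsOf G j ≠ A := fun j hj => hA (hj ▸ (hN _ (prod_mem j)).1)
        have e2 : ∀ j, A ∉ rhsOf G j := fun j hj => hA ((hN _ (prod_mem j)).2 A hj)
        have e3 : A ≠ S := fun h => hA (h ▸ hS)
        simp [e1, Multiset.count_eq_zero.2 (e2 _), e3]
    · by_cases hA : A < N
      · by_cases hAS : A = S
        · exact Or.inl (by simp [hAS])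
        right
        have := h4 A hA
        simp only [rankFormula, hAS, decide_false, cond_false] at this
        rcases this with h | h
        · left
          have h : (IntTerm.sum (lhsTerms m G A)).eval v = 0 := h
          rw [eval_lhsTerms, Finset.sum_eq_zero_iff_of_nonneg fun j _ => by
            split_ifs
            · exact h1 j j.2
            · exact le_rfl] at h
          intro j hj
          have := h j (Finset.mem_univ j)
          rw [if_pos hj] at this
          simp [this]
        · obtain ⟨j, h5, h6, h7⟩ := (sat_parentFormulas A).1 h
          exact Or.inr ⟨j, by omega, h6, h7⟩
      · exact Or.inr (Or.inl fun j hj => absurd (hj ▸ (hN _ (prod_mem j)).1) hA)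
  · have : v a = (IntTerm.sum (letterTerms m G a)).eval v := h2 a ha
    rw [this, eval_letterTerms]
    simp only [hy]

/-- A derivation supplies the balanced counts and, by `Grammar.Gen.exists_rank`, the ranks; the
values outside the quantified block are kept. -/
theorem exists_sat_of_gen {y : Fin G.length → ℕ} (hN : BoundedBy G N)
    (h : Grammar.Gen (lhsOf G) (rhsOf G) {S} y)
    (hv : ∀ a < m, v a = ∑ j, (letterCount G j a : ℤ) * y j) :
    ∃ v' : ℕ → ℤ, (∀ i ∉ (List.range (G.length + N)).map fun i => m + i, v' i = v i) ∧
      (∀ i < m, v' i = v i) ∧ (parikhFormula m G N S).Sat v' w := by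
  obtain ⟨z, hz⟩ := h.exists_rank
  let v' : ℕ → ℤ := fun i => if i < m then v i else
    if hi : i - m < G.length then y ⟨i - m, hi⟩ else
      if i - m < G.length + N then z (i - m - G.length) else v i
  have hv0 : ∀ i < m, v' i = v i := fun i hi => by simp [v', hi]
  have hv1 : ∀ j : Fin G.length, v' (m + j) = y j := fun j => by simp [v']
  have hv2 : ∀ A < N, v' (m + G.length + A) = z A := fun A hA => by
    have e1 : m + G.length + A - m = G.length + A := by omega
    have e2 : ¬ m + G.length + A < m := by omega
    simp [v', e1, e2, hA]
  refine ⟨v', fun i hi => ?_, hv0, ?_, ?_, ?_, ?_⟩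
  · by_cases him : i < m
    · exact hv0 i him
    · have : ¬ i - m < G.length + N := fun h => hi (List.mem_map.2 ⟨i - m, by simpa using h, by omega⟩)
      have h' : ¬ i - m < G.length := by omega
      simp [v', him, this, h']
  all_goals
    rw [Formula.sat_conjs, List.forall_mem_map]
    simp only [List.mem_range]
  · intro j hj
    change 0 ≤ v' (m + j)
    rw [hv1 ⟨j, hj⟩]
    exact Int.natCast_nonneg _
  · intro a ha
    change v' a = (IntTerm.sum (letterTerms m G a)).eval v'
    rw [eval_letterTerms, hv0 a ha, hv a ha]
    simp only [hv1]
  · intro A hA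
    change _ + (IntTerm.sum (rhsTerms m G A)).eval v' = (IntTerm.sum (lhsTerms m G A)).eval v'
    have := congrArg (Nat.cast : ℕ → ℤ) (h.balanced A)
    push_cast at this
    rw [← count_singleton_eq, eval_rhsTerms, eval_lhsTerms]
    simp only [hv1]
    rw [← this]
    exact congrArg _ (Finset.sum_congr rfl fun j _ => mul_comm _ _)
  · intro A hA
    by_cases hAS : A = S
    · simp [rankFormula, hAS, Formula.Sat]
    simp only [rankFormula, hAS, decide_false, cond_false]
    rcases hz A with h | h | ⟨j, h1, h2, h3⟩
    · exact absurd (by simpa using h) hAS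
    · left
      change (IntTerm.sum (lhsTerms m G A)).eval v' = 0
      rw [eval_lhsTerms]
      refine Finset.sum_eq_zero fun j _ => ?_
      split_ifs with hj
      · rw [hv1, h j hj]; rfl
      · rfl
    · refine Or.inr ((sat_parentFormulas A).2 ⟨j, ?_, h2, ?_⟩)
      · rw [hv1]
        exact_mod_cast h1
      · rw [hv2 A hA, hv2 _ (show lhsOf G j < N from (hN _ (prod_mem j)).1)]
        exact_mod_cast h3

theorem parikhFormula_quantifierFree : (parikhFormula m G N S).QuantifierFree := by
  refine ⟨Formula.quantifierFree_conjs ?_, Formula.quantifierFree_conjs ?_,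
    Formula.quantifierFree_conjs ?_, Formula.quantifierFree_conjs ?_⟩ <;>
    rw [List.forall_mem_map] <;> intro A _
  · trivial
  · trivial
  · trivial
  · rw [rankFormula]
    cases decide (A = S)
    · refine ⟨trivial, Formula.quantifierFree_disjs fun φ hφ => ?_⟩
      simp only [parentFormulas, List.mem_flatMap] at hφ
      obtain ⟨j, -, B, -, hφ⟩ := hφ
      cases h : decide (B = A) <;> simp [h] at hφ
      subst hφ
      exact ⟨trivial, trivial⟩
    · trivial

theorem mem_vars_lhsTerms {A i : ℕ} (h : i ∈ (IntTerm.sum (lhsTerms m G A)).vars) :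
    i < m + G.length := by
  obtain ⟨t, ht, hi⟩ := IntTerm.vars_sum h
  simp only [lhsTerms, List.mem_flatMap, List.mem_range] at ht
  obtain ⟨j, hj, ht⟩ := ht
  cases h : decide ((prod G j).1 = A) <;> simp [h] at ht
  subst ht
  have hi : i = m + j := hi
  omega

theorem mem_vars_countTerms {F : ℕ → List ℕ} {A i : ℕ}
    (h : i ∈ (IntTerm.sum ((List.range G.length).flatMap fun j => (F j).flatMap fun B =>
      bif decide (B = A) then [IntTerm.var (m + j)] else [])).vars) :
    i < m + G.length := by
  obtain ⟨t, ht, hi⟩ := IntTerm.vars_sum h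
  simp only [List.mem_flatMap, List.mem_range] at ht
  obtain ⟨j, hj, B, -, ht⟩ := ht
  cases h : decide (B = A) <;> simp [h] at ht
  subst ht
  have hi : i = m + j := hi
  omega

theorem parikhFormula_freeInt (hN : BoundedBy G N) {i : ℕ}
    (hi : i ∈ (parikhFormula m G N S).freeInt) : i < m + (G.length + N) := by
  rcases hi with hi | hi | hi | hi <;> obtain ⟨φ, hφ, hi⟩ := Formula.freeInt_conjs hi <;>
    obtain ⟨j, hj, rfl⟩ := List.mem_map.1 hφ <;> rw [List.mem_range] at hj
  · rcases hi with hi | hi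
    · exact hi.elim
    · have hi : i = m + j := hi
      omega
  · rcases hi with hi | hi
    · have hi : i = j := hi
      omega
    · have := mem_vars_countTerms (F := fun j => (prod G j).2.2) hi
      omega
  · rcases hi with (hi | hi) | hi
    · cases h : decide (j = S) <;> simp [h, IntTerm.vars] at hi
    · have := mem_vars_countTerms (F := fun j => (prod G j).2.1) hi
      omega
    · have := mem_vars_lhsTerms hi
      omega
  · rw [rankFormula] at hi
    cases h : decide (j = S) <;> rw [h] at hi
    · rcases hi with (hi | hi) | hi
      · have := mem_vars_lhsTerms hi
        omega
      · exact hi.elim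
      · obtain ⟨χ, hχ, hi⟩ := Formula.freeInt_disjs hi
        simp only [parentFormulas, List.mem_flatMap, List.mem_range] at hχ
        obtain ⟨k, hk, B, -, hχ⟩ := hχ
        have hlhs : (prod G k).1 < N := (hN _ (prod_mem ⟨k, hk⟩)).1
        cases h : decide (B = j) <;> simp [h] at hχ
        subst hχ
        rcases hi with (hi | hi) | ((hi | hi) | hi)
        · exact hi.elim
        · have hi : i = m + k := hi
          omega
        · have hi : i = m + G.length + (prod G k).1 := hi
          omega
        · exact hi.elim
        · have hi : i = m + G.length + j := hi
          omega
    · exact hi.elim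

theorem parikhFormula_freeRat {i : ℕ} (hi : i ∈ (parikhFormula m G N S).freeRat) : False := by
  rcases hi with hi | hi | hi | hi <;> obtain ⟨φ, hφ, hi⟩ := Formula.freeRat_conjs hi <;>
    obtain ⟨j, hj, rfl⟩ := List.mem_map.1 hφ
  · exact hi
  · exact hi
  · exact hi
  · rw [rankFormula] at hi
    cases h : decide (j = S) <;> rw [h] at hi
    · rcases hi with hi | hi
      · exact hi
      · obtain ⟨χ, hχ, hi⟩ := Formula.freeRat_disjs hi
        simp only [parentFormulas, List.mem_flatMap] at hχ
        obtain ⟨k, -, B, -, hχ⟩ := hχ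
        cases h : decide (B = j) <;> simp [h] at hχ
        subst hχ
        rcases hi with hi | hi <;> exact hi
    · exact hi

end Parikh

end TimedPDA

namespace TimedPDA

/-! ### Positions of clocks and times in tuples -/

section Index

variable (X : ℕ)

/-- The position of the current time (`none`) or of a clock in a group. -/
def clockIdx (c : Option (Fin X)) : ℕ := c.elim X fun x => x

/-- The position in the first two groups. -/
def pairIdx (c : Option (Fin X) ⊕ Option (Fin X)) : ℕ :=
  c.elim (clockIdx X) fun c => X + 1 + clockIdx X c

variable {X}

theorem clockIdx_lt (c : Option (Fin X)) : clockIdx X c < X + 1 := by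
  cases c with
  | none => exact X.lt_succ_self
  | some x => exact x.2.trans X.lt_succ_self

theorem exists_clockIdx {i : ℕ} (h : i < X + 1) : ∃ c, clockIdx X c = i := by
  by_cases hi : i < X
  · exact ⟨some ⟨i, hi⟩, rfl⟩
  · exact ⟨none, by simp only [clockIdx, Option.elim_none]; omega⟩

theorem clockIdx_injective : Function.Injective (clockIdx X) := by
  rintro (_ | x) (_ | y) h
  · rfl
  · exact absurd h y.2.ne'
  · exact absurd h x.2.ne
  · exact congrArg some (Fin.ext h)

theorem pairIdx_lt (c : Option (Fin X) ⊕ Option (Fin X)) : pairIdx X c < X + 1 + (X + 1) := by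
  rcases c with c | c
  · have := clockIdx_lt c
    simp only [pairIdx, Sum.elim_inl]; omega
  · have := clockIdx_lt c
    simp only [pairIdx, Sum.elim_inr]; omega

theorem exists_pairIdx {i : ℕ} (h : i < X + 1 + (X + 1)) : ∃ c, pairIdx X c = i := by
  by_cases hi : i < X + 1
  · obtain ⟨c, hc⟩ := exists_clockIdx hi
    exact ⟨.inl c, hc⟩
  · obtain ⟨c, hc⟩ := exists_clockIdx (X := X) (i := i - (X + 1)) (by omega)
    exact ⟨.inr c, by simp only [pairIdx, Sum.elim_inr]; omega⟩

theorem pairIdx_injective : Function.Injective (pairIdx X) := by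
  rintro (c | c) (d | d) h
  · exact congrArg _ (clockIdx_injective h)
  · have := clockIdx_lt c
    simp only [pairIdx, Sum.elim_inl, Sum.elim_inr] at h; omega
  · have := clockIdx_lt d
    simp only [pairIdx, Sum.elim_inl, Sum.elim_inr] at h; omega
  · refine congrArg _ (clockIdx_injective ?_)
    simp only [pairIdx, Sum.elim_inr] at h; omega

end Index

/-! ### Meaning and free variables of the reachability formula -/

section Reach

variable {m L X : ℕ} {H : List (List ℕ)} {G : List Production} {ℓ r : ℕ} {v : ℕ → ℤ} {w : ℕ → ℚ}

/-- A group of entries. -/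
def group (X : ℕ) (h : List ℕ) (o : ℕ) (c : Option (Fin X)) : ℕ := coord h o (clockIdx X c)

theorem sat_typeFormula (f : List ℕ) : (typeFormula X f).Sat v w ↔
    OrdEq (fun c => w (X + X + pairIdx X c))
      (Sum.elim (group X f 0) (group X f (X + 1))) := by
  have hf : ∀ c, Sum.elim (group X f 0) (group X f (X + 1)) c = f.getD (pairIdx X c) 0 := by
    rintro (c | c)
    · simp [group, coord, pairIdx]
    · rfl
  rw [typeFormula, Formula.sat_conjs]
  constructor
  · intro h c d
    have := h _ (List.mem_flatMap.2 ⟨_, List.mem_range.2 (pairIdx_lt c),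
      List.mem_map.2 ⟨_, List.mem_range.2 (pairIdx_lt d), rfl⟩⟩)
    rw [hf, hf]
    by_cases hcd : f.getD (pairIdx X c) 0 ≤ f.getD (pairIdx X d) 0
    · simp only [hcd, decide_true, cond_true] at this
      exact iff_of_true this hcd
    · simp only [hcd, decide_false, cond_false] at this
      exact iff_of_false this hcd
  · intro h φ hφ
    simp only [List.mem_flatMap, List.mem_map, List.mem_range] at hφ
    obtain ⟨i, hi, j, hj, rfl⟩ := hφ
    obtain ⟨c, rfl⟩ := exists_pairIdx hi
    obtain ⟨d, rfl⟩ := exists_pairIdx hj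
    have := h c d
    rw [hf, hf] at this
    by_cases hcd : f.getD (pairIdx X c) 0 ≤ f.getD (pairIdx X d) 0
    · simp only [hcd, decide_true, cond_true]
      exact this.2 hcd
    · simp only [hcd, decide_false, cond_false]
      exact fun h => hcd (this.1 h)

theorem sat_rangeFormula : (rangeFormula X).Sat v w ↔
    ∀ c, w (X + X + pairIdx X c) ∈ Set.Ioo (0 : ℚ) 1 := by
  rw [rangeFormula, Formula.sat_conjs]
  constructor
  · intro h c
    have := h _ (List.mem_map.2 ⟨_, List.mem_range.2 (pairIdx_lt c), rfl⟩)
    exact ⟨not_le.1 this.1, not_le.1 this.2⟩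
  · intro h φ hφ
    simp only [List.mem_map, List.mem_range] at hφ
    obtain ⟨i, hi, rfl⟩ := hφ
    obtain ⟨c, rfl⟩ := exists_pairIdx hi
    exact ⟨not_le.2 (h c).1, not_le.2 (h c).2⟩

/-- `q` is the value of a clock with time stamp `t` at time `o`, modulo `1`. -/
def StampOf (q t o : ℚ) : Prop := q + t = o ∨ q + t = o + 1

/-- With all three numbers in the unit interval, `q + t` and `o` can be congruent modulo `1` only
with difference `0` or `1`; thus no floor function is needed in the formula. -/
theorem stampOf_iff {q t o : ℚ} (hq : 0 ≤ q) (hq' : q < 1) (ht : 0 < t) (ht' : t < 1)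
    (ho : 0 < o) (ho' : o < 1) : StampOf q t o ↔ q = Int.fract (o - t) := by
  unfold StampOf
  rcases le_or_gt t o with h | h
  · rw [fract_sub_of_le ho' ht.le h]
    constructor
    · rintro (h | h) <;> linarith
    · intro h; left; linarith
  · rw [fract_sub_of_lt ho.le ht' h]
    constructor
    · rintro (h | h) <;> linarith
    · intro h; right; linarith

theorem sat_stampsFormula : (stampsFormula X).Sat v w ↔ ∀ x : Fin X,
    StampOf (w x) (w (X + X + pairIdx X (.inl (some x)))) (w (X + X + pairIdx X (.inl none))) ∧
    StampOf (w (X + x)) (w (X + X + pairIdx X (.inr (some x))))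
      (w (X + X + pairIdx X (.inr none))) := by
  rw [stampsFormula, Formula.sat_conjs]
  constructor
  · intro h x
    exact h _ (List.mem_map.2 ⟨x, List.mem_range.2 x.2, rfl⟩)
  · intro h φ hφ
    simp only [List.mem_map, List.mem_range] at hφ
    obtain ⟨x, hx, rfl⟩ := hφ
    exact h ⟨x, hx⟩

theorem code_lt {n i : ℕ} (hℓ : ℓ < L) (hr : r < L) (hi : i < n) : code L n ℓ r i < L * L * n := by
  have h1 : ℓ * L + r + 1 ≤ L * L := by nlinarith
  unfold code
  nlinarith

theorem sat_reachFormula (hG : BoundedBy G (L * L * H.length)) (hℓ : ℓ < L) (hr : r < L) :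
    (reachFormula m L X H G ℓ r).Sat v w ↔
      ∃ (s s' : Option (Fin X) → Set.Ioo (0 : ℚ) 1) (i : ℕ),
        (∀ x : Fin X, StampOf (w x) (s (some x)) (s none) ∧
          StampOf (w (X + x)) (s' (some x)) (s' none)) ∧ i < H.length ∧
        OrdEq (Sum.elim s s')
          (Sum.elim (group X (H.getD i []) 0) (group X (H.getD i []) (X + 1))) ∧
        ∃ y, Grammar.Gen (lhsOf G) (rhsOf G) {code L H.length ℓ r i} y ∧
          ∀ a < m, v a = ∑ j, (letterCount G j a : ℤ) * y j := by
  have hmem : ∀ i, i < X + X → i ∉ (List.range (X + 1 + (X + 1))).map fun i => X + X + i := by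
    intro i hi h
    obtain ⟨j, -, rfl⟩ := List.mem_map.1 h
    omega
  have hmem' : ∀ i, i < m → i ∉ (List.range (G.length + L * L * H.length)).map fun i => m + i := by
    intro i hi h
    obtain ⟨j, -, rfl⟩ := List.mem_map.1 h
    omega
  rw [reachFormula, Formula.sat_exRats]
  constructor
  · rintro ⟨w', hw', hs⟩
    rw [Formula.sat_exInts] at hs
    obtain ⟨v', hv', ⟨h1, h2⟩, h3⟩ := hs
    rw [sat_stampsFormula] at h1
    rw [sat_rangeFormula] at h2
    obtain ⟨φ, hφ, h3⟩ := Formula.sat_disjs.1 h3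
    obtain ⟨i, hi, rfl⟩ := List.mem_map.1 hφ
    rw [List.mem_range] at hi
    have h4 := (sat_typeFormula _).1 h3.1
    obtain ⟨y, hy, hy'⟩ := exists_gen_of_sat hG (code_lt hℓ hr hi) h3.2
    refine ⟨fun c => ⟨_, h2 (.inl c)⟩, fun c => ⟨_, h2 (.inr c)⟩, i, fun x => ?_, hi, ?_, y, hy,
      fun a ha => ?_⟩
    · rw [← hw' x (hmem x (by omega)), ← hw' (X + x) (hmem _ (by omega))]
      exact h1 x
    · rintro (c | c) (d | d) <;> exact h4 _ _
    · rw [← hv' a (hmem' a ha)]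
      exact hy' a ha
  · rintro ⟨s, s', i, h1, hi, h2, y, hy, hy'⟩
    classical
    -- The guessed stamps overwrite exactly the quantified variables; well defined because `pairIdx`
    -- is injective.
    let w' : ℕ → ℚ := fun k => if h : ∃ c, X + X + pairIdx X c = k then
      (Sum.elim s s' h.choose : Set.Ioo (0 : ℚ) 1) else w k
    have hw' : ∀ c, w' (X + X + pairIdx X c) = (Sum.elim s s' c : Set.Ioo (0 : ℚ) 1) := by
      intro c
      have hex : ∃ d, X + X + pairIdx X d = X + X + pairIdx X c := ⟨c, rfl⟩
      have : hex.choose = c := pairIdx_injective (Nat.add_left_cancel hex.choose_spec)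
      simp only [w', dif_pos hex, this]
    have hw0 : ∀ k ∉ (List.range (X + 1 + (X + 1))).map fun i => X + X + i, w' k = w k := by
      intro k hk
      have : ¬ ∃ c, X + X + pairIdx X c = k := by
        rintro ⟨c, rfl⟩
        exact hk (List.mem_map.2 ⟨_, List.mem_range.2 (pairIdx_lt c), rfl⟩)
      simp only [w', dif_neg this]
    obtain ⟨v', hv', -, hs⟩ := exists_sat_of_gen (w := w') hG hy hy'
    refine ⟨w', hw0, Formula.sat_exInts.2 ⟨v', hv', ⟨sat_stampsFormula.2 fun x => ?_,
      sat_rangeFormula.2 fun c => ?_⟩, Formula.sat_disjs.2 ⟨_, List.mem_map.2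
        ⟨i, List.mem_range.2 hi, rfl⟩, (sat_typeFormula _).2 ?_, hs⟩⟩⟩
    · rw [hw0 x (hmem x (by omega)), hw0 (X + x) (hmem _ (by omega))]
      simp only [hw']
      exact h1 x
    · rw [hw']
      exact (Sum.elim s s' c).2
    · intro c d
      beta_reduce
      rw [hw', hw']
      exact h2 c d

theorem reachFormula_existential : (reachFormula m L X H G ℓ r).Existential := by
  have hq : (reachMatrix m L X H G ℓ r).QuantifierFree := ?_
  · exact Formula.existential_exRats (Formula.existential_exInts (.qf hq) _) _
  refine ⟨⟨?_, ?_⟩, ?_⟩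
  · refine Formula.quantifierFree_conjs ?_
    rw [List.forall_mem_map]
    exact fun i _ => ⟨⟨trivial, trivial⟩, trivial, trivial⟩
  · refine Formula.quantifierFree_conjs ?_
    rw [List.forall_mem_map]
    exact fun i _ => ⟨trivial, trivial⟩
  · refine Formula.quantifierFree_disjs ?_
    rw [List.forall_mem_map]
    refine fun i _ => ⟨Formula.quantifierFree_conjs ?_, parikhFormula_quantifierFree⟩
    intro φ hφ
    simp only [List.mem_flatMap, List.mem_map] at hφ
    obtain ⟨i, -, j, -, rfl⟩ := hφ
    rw [cond_eq_ite]
    split <;> trivial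

theorem reachFormula_freeInt (hG : BoundedBy G (L * L * H.length)) {i : ℕ}
    (hi : i ∈ (reachFormula m L X H G ℓ r).freeInt) : i < m := by
  rw [reachFormula, Formula.freeInt_exRats, Formula.freeInt_exInts] at hi
  obtain ⟨hi, hni⟩ := hi
  suffices i < m + (G.length + L * L * H.length) by
    by_contra him
    exact hni (List.mem_map.2 ⟨i - m, List.mem_range.2 (by omega), by omega⟩)
  rcases hi with (hi | hi) | hi
  · obtain ⟨φ, hφ, hi⟩ := Formula.freeInt_conjs hi
    obtain ⟨x, -, rfl⟩ := List.mem_map.1 hφ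
    rcases hi with (hi | hi) | hi | hi <;> exact hi.elim
  · obtain ⟨φ, hφ, hi⟩ := Formula.freeInt_conjs hi
    obtain ⟨x, -, rfl⟩ := List.mem_map.1 hφ
    rcases hi with hi | hi <;> exact hi.elim
  · obtain ⟨φ, hφ, hi⟩ := Formula.freeInt_disjs hi
    obtain ⟨x, -, rfl⟩ := List.mem_map.1 hφ
    rcases hi with hi | hi
    · obtain ⟨φ, hφ, hi⟩ := Formula.freeInt_conjs hi
      simp only [List.mem_flatMap, List.mem_map] at hφ
      obtain ⟨i, -, j, -, rfl⟩ := hφ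
      rw [cond_eq_ite] at hi
      split at hi <;> exact hi.elim
    · exact parikhFormula_freeInt hG hi

theorem reachFormula_freeRat {i : ℕ} (hi : i ∈ (reachFormula m L X H G ℓ r).freeRat) :
    i < X + X := by
  rw [reachFormula, Formula.freeRat_exRats, Formula.freeRat_exInts] at hi
  obtain ⟨hi, hni⟩ := hi
  suffices i < X + X + (X + 1 + (X + 1)) by
    by_contra him
    exact hni (List.mem_map.2 ⟨i - (X + X), List.mem_range.2 (by omega), by omega⟩)
  have hv : ∀ k < X + 1 + (X + 1), i ∈ (typeVar X k).vars → i < X + X + (X + 1 + (X + 1)) := by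
    intro k hk h
    have h : i = X + X + k := h
    omega
  rcases hi with (hi | hi) | hi
  · obtain ⟨φ, hφ, hi⟩ := Formula.freeRat_conjs hi
    obtain ⟨x, hx, rfl⟩ := List.mem_map.1 hφ
    rw [List.mem_range] at hx
    rcases hi with (((hi | hi) | hi) | ((hi | hi) | (hi | hi))) |
        (((hi | hi) | hi) | ((hi | hi) | (hi | hi)))
    · have hi : i = x := hi
      omega
    · exact hv _ (by omega) hi
    · exact hv _ (by omega) hi
    · have hi : i = x := hi
      omega
    · exact hv _ (by omega) hi
    · exact hv _ (by omega) hi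
    · exact hi.elim
    · have hi : i = X + x := hi
      omega
    · exact hv _ (by omega) hi
    · exact hv _ (by omega) hi
    · have hi : i = X + x := hi
      omega
    · exact hv _ (by omega) hi
    · exact hv _ (by omega) hi
    · exact hi.elim
  · obtain ⟨φ, hφ, hi⟩ := Formula.freeRat_conjs hi
    obtain ⟨x, hx, rfl⟩ := List.mem_map.1 hφ
    rw [List.mem_range] at hx
    rcases hi with (hi | hi) | (hi | hi)
    · exact hv _ hx hi
    · exact hi.elim
    · exact hi.elim
    · exact hv _ hx hi
  · obtain ⟨φ, hφ, hi⟩ := Formula.freeRat_disjs hi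
    obtain ⟨x, -, rfl⟩ := List.mem_map.1 hφ
    rcases hi with hi | hi
    · obtain ⟨φ, hφ, hi⟩ := Formula.freeRat_conjs hi
      simp only [List.mem_flatMap, List.mem_map, List.mem_range] at hφ
      obtain ⟨k, hk, j, hj, rfl⟩ := hφ
      rw [cond_eq_ite] at hi
      split at hi <;> rcases hi with hi | hi
      · exact hv _ hk hi
      · exact hv _ hj hi
      · exact hv _ hk hi
      · exact hv _ hj hi
    · exact (parikhFormula_freeRat hi).elim

end Reach

end TimedPDA

namespace TimedPDA

/-! ### Correctness of the tests on order types -/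

section Tests

variable {X : ℕ}

theorem forall_lt_succ_iff {p : ℕ → Prop} :
    (∀ i < X + 1, p i) ↔ ∀ c : Option (Fin X), p (clockIdx X c) := by
  constructor
  · exact fun h c => h _ (clockIdx_lt c)
  · intro h i hi
    obtain ⟨c, rfl⟩ := exists_clockIdx hi
    exact h c

theorem sameOn_iff {o o' : ℕ} {h : List ℕ} :
    sameOn X o o' h = true ↔ group X h o = group X h o' := by
  rw [sameOn, List.all_eq_true, funext_iff]
  simp only [List.mem_range, decide_eq_true_eq]
  exact forall_lt_succ_iff

theorem mem_coordPairs {o o' : ℕ} {f g : List ℕ} {p : ℕ × ℕ} : p ∈ coordPairs X o o' f g ↔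
    ∃ c, p = (Sum.elim (group X f o) (group X f o') c,
      Sum.elim (group X g 0) (group X g (X + 1)) c) := by
  simp only [coordPairs, List.mem_append, List.mem_map, List.mem_range]
  constructor
  · rintro (⟨i, hi, rfl⟩ | ⟨i, hi, rfl⟩) <;> obtain ⟨c, rfl⟩ := exists_clockIdx hi
    · exact ⟨.inl c, rfl⟩
    · exact ⟨.inr c, rfl⟩
  · rintro ⟨c | c, rfl⟩
    · exact Or.inl ⟨_, clockIdx_lt c, rfl⟩
    · exact Or.inr ⟨_, clockIdx_lt c, rfl⟩

theorem sameOrder_iff {o o' : ℕ} {f g : List ℕ} : sameOrder X o o' f g = true ↔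
    OrdEq (Sum.elim (group X f o) (group X f o'))
      (Sum.elim (group X g 0) (group X g (X + 1))) := by
  simp only [sameOrder, List.all_eq_true, mem_coordPairs, beq_iff_eq, decide_eq_decide]
  constructor
  · exact fun h c d => h _ ⟨c, rfl⟩ _ ⟨d, rfl⟩
  · rintro h _ ⟨c, rfl⟩ _ ⟨d, rfl⟩
    exact h c d

theorem cycLeBool_iff {o x y : ℕ} : cycLeBool o x y = true ↔ CycLe o x y := by
  simp [cycLeBool, CycLe]

theorem atomHolds_encode {V : Type} {b : Bool} {o : ℕ} {h : List ℕ} {e : V → Data} {s : V → ℕ}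
    (hs : ∀ v, clockCoord b X o h (e v) = s v) (a : Atom V) :
    atomHolds b X o h (a.encode e) = true ↔ a.OrdSat (coord h o X) s := by
  cases a <;>
    simp [atomHolds, Atom.encode, Data.tag, Data.toNat_unary, Atom.OrdSat, Data.fst, Data.snd, hs,
      cycLeBool_iff]

theorem constraintHolds_encode {V : Type} {b : Bool} {o : ℕ} {h : List ℕ} {e : V → Data}
    {s : V → ℕ} (hs : ∀ v, clockCoord b X o h (e v) = s v) (φ : Constraint V) :
    constraintHolds b X o h (φ.encode e) = true ↔ φ.OrdSat (coord h o X) s :=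
  evalData_encode φ (fun φ => φ.OrdSat (coord h o X) s) trivial
    (fun a => (atomHolds_encode hs a).symm) (fun _ => Iff.rfl) (fun _ _ => Iff.rfl)
    fun _ _ => Iff.rfl

end Tests

end TimedPDA

namespace TPDA

open TimedPDA

variable {P : TPDA}

/-- The entries of the last group. -/
def stackGroup (P : TPDA) (h : List ℕ) (z : P.StackClock) : ℕ := coord h (3 * (P.globalClocks + 1)) z

theorem constraintHolds_global (o : ℕ) (h : List ℕ) (φ : Constraint P.Clock) :
    constraintHolds true P.globalClocks o h (φ.encode Op.encodeGlobal) = true ↔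
      φ.OrdSat (group P.globalClocks h o none) fun x => group P.globalClocks h o (some x) :=
  constraintHolds_encode (fun x => by
    simp [clockCoord, Op.encodeGlobal, Data.toNat_unary, group, clockIdx]) φ

theorem constraintHolds_stack (o : ℕ) (h : List ℕ)
    (ψ : Constraint (P.Clock ⊕ P.StackClock)) :
    constraintHolds false P.globalClocks o h (ψ.encode Op.encodeClock) = true ↔
      StackSat ψ (group P.globalClocks h o) (P.stackGroup h) :=
  constraintHolds_encode (by
    rintro (x | z) <;>
      simp [clockCoord, Op.encodeClock, Data.tag, Data.toNat_unary, group, clockIdx, stackGroup,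
        Data.fst, Data.snd]) ψ

abbrev Operation (P : TPDA) : Type :=
  Op P.letters P.stackSymbols P.globalClocks P.stackClocks

/-- The entries of a tuple are themselves stamps, in the linear order `ℕ`, so the test on the tuple
is an instance of the semantics. -/
theorem opRel_iff_opHolds (h : List ℕ) (π : P.Letter → ℕ) (op : P.Operation) :
    OpRel (group P.globalClocks h 0) π (group P.globalClocks h (P.globalClocks + 1)) op ↔
      (π = fun a : P.Letter => (opLetters op.encode).count (a : ℕ)) ∧
        opHolds P.globalClocks op.encode h = true := by
  cases op with
  | elapse =>
    simp only [OpRel, Op.encode, opLetters, opHolds, Data.tag, Data.fst, Data.toNat_unary,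
      decide_true, cond_true, List.all_eq_true, List.mem_range, decide_eq_true_eq]
    exact and_congr Iff.rfl
      ⟨fun H j hj => H ⟨j, hj⟩, fun H x => H x x.2⟩
  | input a =>
    cases a with
    | none =>
      simp only [OpRel, Op.encode, opLetters, opHolds, Data.tag, Data.fst, Data.toNat_unary]
      exact and_congr Iff.rfl sameOn_iff.symm
    | some a =>
      simp only [OpRel, Op.encode, opLetters, opHolds, Data.tag, Data.fst, Data.toNat_unary]
      refine and_congr ?_ sameOn_iff.symm
      have : (fun b : P.Letter => List.count (b : ℕ) [(a : ℕ)]) = Pi.single a 1 := by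
        funext b
        by_cases hb : b = a
        · subst hb; simp
        · rw [Pi.single_eq_of_ne hb, List.count_eq_zero]
          simpa [Fin.ext_iff] using hb
      simp [this, Data.snd, Data.toNat_unary]
  | test φ =>
    simp only [OpRel, Op.encode, opLetters, opHolds, Data.tag, Data.fst, Data.snd,
      Data.toNat_unary]
    refine and_congr Iff.rfl ?_
    simp only [Nat.reduceEqDiff, decide_false, cond_false, Nat.reduceLeDiff, decide_true, cond_true,
      Bool.and_eq_true, sameOn_iff, constraintHolds_global, OfNat.ofNat_ne_zero]
  | reset Y =>
    simp only [OpRel, Op.encode, opLetters, opHolds, Data.tag, Data.fst, Data.snd,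
      Data.toNat_unary]
    refine and_congr Iff.rfl ?_
    simp only [Nat.reduceEqDiff, decide_false, cond_false, Nat.reduceLeDiff, decide_true, cond_true,
      Bool.and_eq_true, OfNat.ofNat_ne_zero, decide_eq_true_eq, List.all_eq_true, List.mem_range,
      Data.toList_list]
    refine and_congr Iff.rfl ?_
    have key : ∀ x : P.Clock, (group P.globalClocks h (P.globalClocks + 1) (some x) =
        if x ∈ Y then group P.globalClocks h 0 none else group P.globalClocks h 0 (some x)) ↔
        coord h (P.globalClocks + 1) x = bif decide (((List.ofFn fun x : P.Clock =>
          Data.bool (decide (x ∈ Y))).getD x .nil).toNat = 0) then coord h 0 x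
          else coord h 0 P.globalClocks := by
      intro x
      have : ((List.ofFn fun x : P.Clock => Data.bool (decide (x ∈ Y))).getD x .nil) =
          Data.bool (decide (x ∈ Y)) := by
        rw [List.getD_eq_getElem _ _ (by simp), List.getElem_ofFn]
      rw [this]
      by_cases hx : x ∈ Y <;> simp [hx, Data.bool, Data.toNat, group, clockIdx]
    exact ⟨fun H j hj => (key ⟨j, hj⟩).1 (H _), fun H x => (key x).2 (H x x.2)⟩
  | push γ ψ =>
    simp [OpRel, Op.encode, opHolds, Data.tag, Data.fst, Data.toNat_unary]
  | pop γ ψ =>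
    simp [OpRel, Op.encode, opHolds, Data.tag, Data.fst, Data.toNat_unary]

theorem toNat_fst_encode_eq_five {op : P.Operation} (h : op.encode.fst.toNat = 5) :
    ∃ γ ψ, op = .push γ ψ := by
  cases op with
  | push γ ψ => exact ⟨γ, ψ, rfl⟩
  | input a => cases a <;> simp [Op.encode, Data.tag, Data.fst, Data.toNat_unary] at h
  | _ => simp [Op.encode, Data.tag, Data.fst, Data.toNat_unary] at h

theorem toNat_fst_encode_eq_six {op : P.Operation} (h : op.encode.fst.toNat = 6) :
    ∃ γ ψ, op = .pop γ ψ := by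
  cases op with
  | pop γ ψ => exact ⟨γ, ψ, rfl⟩
  | input a => cases a <;> simp [Op.encode, Data.tag, Data.fst, Data.toNat_unary] at h
  | _ => simp [Op.encode, Data.tag, Data.fst, Data.toNat_unary] at h

theorem stackHolds_iff (h : List ℕ) (op op' : P.Operation) :
    stackHolds P.globalClocks op.encode op'.encode h = true ↔ ∃ γ ψ χ, op = .push γ ψ ∧
      op' = .pop γ χ ∧ StackSat ψ (group P.globalClocks h 0) (P.stackGroup h) ∧
      StackSat χ (group P.globalClocks h (P.globalClocks + 1)) (P.stackGroup h) := by
  simp only [stackHolds, Bool.and_eq_true, decide_eq_true_eq]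
  constructor
  · rintro ⟨⟨h5, h6, hγ⟩, hψ, hχ⟩
    obtain ⟨γ, ψ, rfl⟩ := toNat_fst_encode_eq_five h5
    obtain ⟨γ', χ, rfl⟩ := toNat_fst_encode_eq_six h6
    simp only [Op.encode, Data.tag, Data.fst, Data.snd, Data.toNat_unary] at hγ hψ hχ
    obtain rfl : γ = γ' := Fin.ext hγ
    exact ⟨γ, ψ, χ, rfl, rfl, (constraintHolds_stack _ _ _).1 hψ, (constraintHolds_stack _ _ _).1 hχ⟩
  · rintro ⟨γ, ψ, χ, rfl, rfl, hψ, hχ⟩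
    simp only [Op.encode, Data.tag, Data.fst, Data.snd, Data.toNat_unary, true_and]
    exact ⟨(constraintHolds_stack _ _ _).2 hψ, (constraintHolds_stack _ _ _).2 hχ⟩

/-! ### Invariance under changes of time stamps that respect the order -/

section Invariance

variable {α β : Type} [LinearOrder α] [LinearOrder β] {s s' : P.Stamps α} {t t' : P.Stamps β}

theorem OpRel.congr (h : OrdEq (Sum.elim s s') (Sum.elim t t')) {π : P.Letter → ℕ}
    {op : P.Operation} (hop : OpRel s π s' op) : OpRel t π t' op := by
  have e : ∀ {c d}, s' c = s d → t' c = t d := fun {c d} hc =>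
    (h.eq_iff (.inr c) (.inl d)).1 hc
  cases op with
  | elapse => exact ⟨hop.1, fun x => e (hop.2 x)⟩
  | input a => exact ⟨hop.1, funext fun c => e (congrFun hop.2 c)⟩
  | test φ =>
    refine ⟨hop.1, funext fun c => e (congrFun hop.2.1 c), ?_⟩
    refine (Constraint.ordSat_congr ?_ φ).1 hop.2.2
    have := h.comp (fun c : Option P.Clock => Sum.inl c)
    intro c d
    have h' := this c d
    rcases c with _ | c <;> rcases d with _ | d <;> exact h'
  | reset Y =>
    refine ⟨hop.1, e hop.2.1, fun x => ?_⟩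
    have := hop.2.2 x
    split_ifs at this ⊢ with hx
    · exact e this
    · exact e this
  | push _ _ => exact hop
  | pop _ _ => exact hop

theorem StackSat.congr {ζ : P.StackClock → α} {ξ : P.StackClock → β}
    (h : OrdEq (Sum.elim s ζ) (Sum.elim t ξ)) {ψ : Constraint (P.Clock ⊕ P.StackClock)}
    (hψ : StackSat ψ s ζ) : StackSat ψ t ξ := by
  refine (Constraint.ordSat_congr ?_ ψ).1 hψ
  have := h.comp fun c : Option (P.Clock ⊕ P.StackClock) =>
    (c.elim (.inl none) (Sum.map some id) : Option P.Clock ⊕ P.StackClock)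
  intro c d
  have h' := this c d
  rcases c with _ | c | c <;> rcases d with _ | d | d <;> exact h'

end Invariance

end TPDA

/-! ### Enumeration of order types and numbering of nonterminals -/

namespace TimedPDA

/-- All lists of a given length with entries below `K`. -/
def tuples (K : ℕ) : ℕ → List (List ℕ)
  | 0 => [[]]
  | m + 1 => (tuples K m).flatMap fun h => (List.range K).map fun k => k :: h

theorem mem_tuples {K m : ℕ} {h : List ℕ} :
    h ∈ tuples K m ↔ h.length = m ∧ ∀ k ∈ h, k < K := by
  induction m generalizing h with
  | zero => simp +contextual [tuples]
  | succ m ih =>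
    simp only [tuples, List.mem_flatMap, List.mem_map, List.mem_range, ih]
    constructor
    · rintro ⟨g, ⟨rfl, hg⟩, k, hk, rfl⟩
      simpa [hk] using hg
    · rintro ⟨hl, hk⟩
      cases h with
      | nil => simp at hl
      | cons k g =>
        rw [List.forall_mem_cons] at hk
        exact ⟨g, ⟨by simpa using hl, hk.2⟩, k, hk.1, rfl⟩

theorem mul_add_inj {n a b i j : ℕ} (hi : i < n) (hj : j < n) (h : a * n + i = b * n + j) :
    a = b ∧ i = j := by
  have hn : 0 < n := by omega
  have h1 := congrArg (· / n) h
  simp only [mul_comm _ n, Nat.mul_add_div hn, Nat.div_eq_of_lt hi, Nat.div_eq_of_lt hj,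
    add_zero] at h1
  subst h1
  exact ⟨rfl, by omega⟩

theorem code_inj {L n ℓ r i ℓ' r' i' : ℕ} (hr : r < L) (hr' : r' < L) (hi : i < n) (hi' : i' < n)
    (h : code L n ℓ r i = code L n ℓ' r' i') : ℓ = ℓ' ∧ r = r' ∧ i = i' := by
  obtain ⟨h1, rfl⟩ := mul_add_inj hi hi' h
  obtain ⟨rfl, rfl⟩ := mul_add_inj hr hr' h1
  exact ⟨rfl, rfl, rfl⟩

end TimedPDA

namespace TPDA

open TimedPDA

variable (P : TPDA)

/-- The length of the tuples that represent order types. -/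
def tupleLength : ℕ := 3 * (P.globalClocks + 1) + P.stackClocks

/-- The tuples that represent order types. -/
def types : List (List ℕ) := tuples P.tupleLength P.tupleLength

/-- The entries of a tuple: three groups for the global clocks, and one for the stack clocks. -/
abbrev Entry : Type :=
  (Option P.Clock ⊕ Option P.Clock) ⊕ (Option P.Clock ⊕ P.StackClock)

/-- The tuple number `i`. -/
def typ (i : ℕ) : List ℕ := P.types.getD i []

def entry (h : List ℕ) : P.Entry → ℕ :=
  Sum.elim (Sum.elim (group P.globalClocks h 0) (group P.globalClocks h (P.globalClocks + 1)))
    (Sum.elim (group P.globalClocks h (2 * (P.globalClocks + 1))) (P.stackGroup h))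

/-- The first two groups. -/
def ends (i : ℕ) : Option P.Clock ⊕ Option P.Clock → ℕ :=
  Sum.elim (group P.globalClocks (P.typ i) 0) (group P.globalClocks (P.typ i) (P.globalClocks + 1))

/-- The position of an entry. -/
def entryPos : P.Entry → ℕ :=
  Sum.elim (pairIdx P.globalClocks) (Sum.elim (fun c => 2 * (P.globalClocks + 1) +
    clockIdx P.globalClocks c) fun z => 3 * (P.globalClocks + 1) + z)

variable {P}

theorem entry_eq_getD (h : List ℕ) (e : P.Entry) : P.entry h e = h.getD (P.entryPos e) 0 := by
  rcases e with (c | c) | c | z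
  · simp [entry, entryPos, pairIdx, group, coord]
  all_goals rfl

theorem entryPos_lt (e : P.Entry) : P.entryPos e < P.tupleLength := by
  rcases e with c | c | z
  · have := pairIdx_lt c
    simp only [entryPos, Sum.elim_inl, tupleLength]; omega
  · have := clockIdx_lt c
    simp only [entryPos, Sum.elim_inl, Sum.elim_inr, tupleLength]; omega
  · simp only [entryPos, Sum.elim_inr, tupleLength]; omega

theorem entryPos_injective : Function.Injective P.entryPos := by
  rintro (c | c | z) (d | d | z') h <;>
    simp only [entryPos, Sum.elim_inl, Sum.elim_inr] at h
  · rw [pairIdx_injective h]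
  · have := pairIdx_lt c; omega
  · have := pairIdx_lt c; omega
  · have := pairIdx_lt d; omega
  · rw [clockIdx_injective (Nat.add_left_cancel h)]
  · have := clockIdx_lt c; omega
  · have := pairIdx_lt d; omega
  · have := clockIdx_lt d; omega
  · rw [Fin.ext (Nat.add_left_cancel h)]

/-- There are as many entries as the bound on their values, so the ranks given by `exists_grid` fit
into one of the enumerated tuples. -/
theorem exists_typ {α : Type} [LinearOrder α] (u : P.Entry → α) :
    ∃ i < P.types.length, OrdEq (P.entry (P.typ i)) u := by
  classical
  obtain ⟨g, hg, hgu⟩ := exists_grid u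
  have hcard : Fintype.card P.Entry = P.tupleLength := by
    simp only [Fintype.card_sum, Fintype.card_option, Fintype.card_fin, tupleLength]
    ring
  rw [hcard] at hg
  -- Every rank is written at the position of its entry.
  let h : List ℕ := List.ofFn fun k : Fin P.tupleLength =>
    if hk : ∃ e, P.entryPos e = k then g hk.choose else 0
  have hmem : h ∈ P.types := mem_tuples.2 ⟨by simp [h], fun k hk => by
    obtain ⟨j, rfl⟩ := (List.mem_ofFn' _ _).1 hk
    dsimp only
    split_ifs
    · exact hg _
    · simp only [tupleLength]; omega⟩
  obtain ⟨i, hi, hih⟩ := List.mem_iff_getElem.1 hmem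
  refine ⟨i, hi, ?_⟩
  have he : ∀ e, P.entry (P.typ i) e = g e := by
    intro e
    rw [entry_eq_getD, typ, List.getD_eq_getElem _ _ hi, hih, List.getD_eq_getElem _ _
      (by simpa [h] using entryPos_lt e)]
    have hex : ∃ d, P.entryPos d = P.entryPos e := ⟨e, rfl⟩
    simp only [h, List.getElem_ofFn, dif_pos hex]
    rw [entryPos_injective hex.choose_spec]
  intro c d
  rw [he, he]
  exact hgu c d

variable (P)

/-- The productions of the grammar. -/
def grammar : List Production :=
  productions P.locations P.globalClocks P.types (P.rules.map P.encodeRule)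

/-- The nonterminal for runs between two locations, of a given order type. -/
def nonterminal (ℓ r : P.Loc) (i : ℕ) : ℕ := code P.locations P.types.length ℓ r i

/-- The productions, in terms of the automaton. -/
inductive IsProduction : Production → Prop where
  | id (ℓ : P.Loc) {i : ℕ} (hi : i < P.types.length)
      (h : group P.globalClocks (P.typ i) 0 = group P.globalClocks (P.typ i) (P.globalClocks + 1)) :
      IsProduction (P.nonterminal ℓ ℓ i, [], [])
  | rename (ℓ r : P.Loc) {i j : ℕ} (hi : i < P.types.length) (hj : j < P.types.length)
      (h : OrdEq (P.ends i) (P.ends j)) :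
      IsProduction (P.nonterminal ℓ r i, [P.nonterminal ℓ r j], [])
  | comp (ℓ k r : P.Loc) {i j j' : ℕ} (hi : i < P.types.length) (hj : j < P.types.length)
      (hj' : j' < P.types.length)
      (h : OrdEq (Sum.elim (group P.globalClocks (P.typ i) 0)
        (group P.globalClocks (P.typ i) (2 * (P.globalClocks + 1)))) (P.ends j))
      (h' : OrdEq (Sum.elim (group P.globalClocks (P.typ i) (2 * (P.globalClocks + 1)))
        (group P.globalClocks (P.typ i) (P.globalClocks + 1))) (P.ends j')) :
      IsProduction (P.nonterminal ℓ r i, [P.nonterminal ℓ k j, P.nonterminal k r j'], [])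
  | op {ℓ r : P.Loc} {o : P.Operation} (ho : (ℓ, o, r) ∈ P.rules) {i : ℕ}
      (hi : i < P.types.length) (h : opHolds P.globalClocks o.encode (P.typ i) = true) :
      IsProduction (P.nonterminal ℓ r i, [], opLetters o.encode)
  | stack {ℓ k l r : P.Loc} {o o' : P.Operation} (ho : (ℓ, o, k) ∈ P.rules)
      (ho' : (l, o', r) ∈ P.rules) {i : ℕ} (hi : i < P.types.length)
      (h : stackHolds P.globalClocks o.encode o'.encode (P.typ i) = true) :
      IsProduction (P.nonterminal ℓ r i, [P.nonterminal k l i], [])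

theorem mem_grammar_iff {p : Production} : p ∈ P.grammar ↔ P.IsProduction p := by
  have hrange : ∀ {q : ℕ → Prop}, (∃ ℓ < P.locations, q ℓ) ↔ ∃ ℓ : P.Loc, q ℓ := fun {q} =>
    ⟨fun ⟨ℓ, h, hq⟩ => ⟨⟨ℓ, h⟩, hq⟩, fun ⟨ℓ, hq⟩ => ⟨ℓ, ℓ.2, hq⟩⟩
  have hcond : ∀ (b : Bool) (q : Production), p ∈ (bif b then [q] else []) ↔ b = true ∧ p = q :=
    fun b q => by cases b <;> simp
  simp only [grammar, productions, List.mem_append, idProductions, renameProductions,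
    compProductions, opProductions, stackProductions, List.mem_flatMap, List.mem_range, hcond,
    hrange, List.mem_map, Prod.exists]
  constructor
  · rintro (⟨ℓ, i, hi, h, rfl⟩ | ⟨ℓ, r, i, hi, j, hj, h, rfl⟩ |
      ⟨ℓ, k, r, i, hi, j, hj, j', hj', h, rfl⟩ | ⟨_, ⟨ℓ, o, r, ho, rfl⟩, i, hi, h, rfl⟩ |
      ⟨_, ⟨ℓ, o, k, ho, rfl⟩, _, ⟨l, o', r, ho', rfl⟩, i, hi, h, rfl⟩)
    · exact .id ℓ hi (sameOn_iff.1 h)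
    · exact .rename ℓ r hi hj (sameOrder_iff.1 h)
    · rw [Bool.and_eq_true] at h
      exact .comp ℓ k r hi hj hj' (sameOrder_iff.1 h.1) (sameOrder_iff.1 h.2)
    · have := IsProduction.op ho hi h
      simpa only [nonterminal, encodeRule, Data.fst, Data.snd, Data.toNat_unary] using this
    · have := IsProduction.stack ho ho' hi h
      simpa only [nonterminal, encodeRule, Data.fst, Data.snd, Data.toNat_unary] using this
  · intro h
    cases h with
    | id ℓ hi h => exact Or.inl ⟨ℓ, _, hi, sameOn_iff.2 h, rfl⟩
    | rename ℓ r hi hj h => exact Or.inr (Or.inl ⟨ℓ, r, _, hi, _, hj, sameOrder_iff.2 h, rfl⟩)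
    | comp ℓ k r hi hj hj' h h' =>
      exact Or.inr (Or.inr (Or.inl ⟨ℓ, k, r, _, hi, _, hj, _, hj',
        Bool.and_eq_true _ _ ▸ ⟨sameOrder_iff.2 h, sameOrder_iff.2 h'⟩, rfl⟩))
    | @op ℓ r o ho i hi h =>
      refine Or.inr (Or.inr (Or.inr (Or.inl ⟨_, ⟨ℓ, o, r, ho, rfl⟩, i, hi, h, ?_⟩)))
      simp only [nonterminal, encodeRule, Data.fst, Data.snd, Data.toNat_unary]
    | @stack ℓ k l r o o' ho ho' i hi h =>
      refine Or.inr (Or.inr (Or.inr (Or.inr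
        ⟨_, ⟨ℓ, o, k, ho, rfl⟩, _, ⟨l, o', r, ho', rfl⟩, i, hi, h, ?_⟩)))
      simp only [nonterminal, encodeRule, Data.fst, Data.snd, Data.toNat_unary]

theorem boundedBy_grammar :
    BoundedBy P.grammar (P.locations * P.locations * P.types.length) := by
  intro p hp
  rw [mem_grammar_iff] at hp
  have h : ∀ (ℓ r : P.Loc) {i : ℕ}, i < P.types.length →
      P.nonterminal ℓ r i < P.locations * P.locations * P.types.length :=
    fun ℓ r i hi => code_lt ℓ.2 r.2 hi
  cases hp with
  | id ℓ hi => exact ⟨h _ _ hi, by simp⟩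
  | rename ℓ r hi hj => exact ⟨h _ _ hi, by simpa using h _ _ hj⟩
  | comp ℓ k r hi hj hj' => exact ⟨h _ _ hi, by simpa using ⟨h _ _ hj, h _ _ hj'⟩⟩
  | op ho hi => exact ⟨h _ _ hi, by simp⟩
  | stack ho ho' hi => exact ⟨h _ _ hi, by simpa using h _ _ hi⟩

/-! ### Completeness of the grammar -/

/-- The Parikh images of the words derived from a nonterminal. -/
def Lang (A : ℕ) : Set (P.Letter → ℕ) :=
  {π | ∃ y, Grammar.Gen (lhsOf P.grammar) (rhsOf P.grammar) {A} y ∧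
    π = fun a : P.Letter => ∑ j, y j * letterCount P.grammar j a}

variable {P}

/-- One more use of the production adds its own letters to the Parikh image of the right hand side.
-/
theorem lang_of_production {A : ℕ} {Bs as : List ℕ} (h : (A, Bs, as) ∈ P.grammar)
    {y : Fin P.grammar.length → ℕ}
    (hy : Grammar.Gen (lhsOf P.grammar) (rhsOf P.grammar) (Bs : Multiset ℕ) y) :
    (fun a : P.Letter => (∑ j, y j * letterCount P.grammar j a) + as.count (a : ℕ)) ∈ P.Lang A := by
  obtain ⟨j, hj, hjp⟩ := List.mem_iff_getElem.1 h
  have hp : prod P.grammar j = (A, Bs, as) := by rw [prod, List.getD_eq_getElem _ _ hj, hjp]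
  have h1 : lhsOf P.grammar ⟨j, hj⟩ = A := by simp [lhsOf, hp]
  have h2 : rhsOf P.grammar ⟨j, hj⟩ = (Bs : Multiset ℕ) := by simp [rhsOf, hp]
  have h3 : ∀ a, letterCount P.grammar ⟨j, hj⟩ a = as.count a := by simp [letterCount, hp]
  rw [← h2] at hy
  have := hy.of_production
  rw [h1] at this
  refine ⟨_, this, funext fun a => ?_⟩
  simp only [Pi.add_apply, add_mul, Finset.sum_add_distrib]
  congr 1
  rw [Finset.sum_eq_single ⟨j, hj⟩]
  · simp [h3]
  · intro k _ hk; simp [Pi.single_eq_of_ne hk]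
  · simp

theorem lang_nil {A : ℕ} {as : List ℕ} (h : (A, [], as) ∈ P.grammar) :
    (fun a : P.Letter => as.count (a : ℕ)) ∈ P.Lang A := by
  have := lang_of_production h (y := 0) .zero
  simpa using this

theorem lang_single {A B : ℕ} (h : (A, [B], []) ∈ P.grammar) {π : P.Letter → ℕ}
    (hB : π ∈ P.Lang B) : π ∈ P.Lang A := by
  obtain ⟨y, hy, rfl⟩ := hB
  have := lang_of_production h hy
  simpa using this

theorem lang_pair {A B C : ℕ} (h : (A, [B, C], []) ∈ P.grammar) {π π' : P.Letter → ℕ}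
    (hB : π ∈ P.Lang B) (hC : π' ∈ P.Lang C) : π + π' ∈ P.Lang A := by
  obtain ⟨y, hy, rfl⟩ := hB
  obtain ⟨y', hy', rfl⟩ := hC
  have := lang_of_production h (hy.add hy')
  convert this using 1
  funext a
  simp [add_mul, Finset.sum_add_distrib]

/-- The actual intermediate or stack stamps of the run, together with its endpoints, have some
enumerated order type; the given type is renamed to it before the production for the rule is
applied. Density plays no role in this direction. -/
theorem Sem.mem_lang {α : Type} [LinearOrder α] {ℓ r : P.Loc} {s s' : P.Stamps α}
    {π : P.Letter → ℕ} (h : P.Sem α ℓ s π r s') {i : ℕ} (hi : i < P.types.length)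
    (hs : OrdEq (P.ends i) (Sum.elim s s')) : π ∈ P.Lang (P.nonterminal ℓ r i) := by
  induction h generalizing i with
  | refl ℓ s =>
    exact lang_nil (P.mem_grammar_iff.2 (.id ℓ hi (funext fun c =>
      (hs.eq_iff (.inl c) (.inr c)).2 rfl)))
  | @comp ℓ k r s s' s'' π π' _ _ ih ih' =>
    have hends : ∀ t t' : P.Stamps α, ∃ j < P.types.length, OrdEq (P.ends j) (Sum.elim t t') := by
      intro t t'
      obtain ⟨j, hj, hju⟩ := exists_typ (P := P)
        -- The intermediate and stack entries are irrelevant here and filled with stamps at hand,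
        -- since any order type must be total on all entries.
        (Sum.elim (Sum.elim t t') (Sum.elim t fun _ => t none))
      exact ⟨j, hj, hju.comp Sum.inl⟩
    obtain ⟨i', hi', hu⟩ := exists_typ (P := P)
      (Sum.elim (Sum.elim s s'') (Sum.elim s' fun _ => s none))
    obtain ⟨j, hj, hju⟩ := hends s s'
    obtain ⟨j', hj', hju'⟩ := hends s' s''
    refine lang_single (P.mem_grammar_iff.2 (.rename ℓ r hi hi' (hs.trans (hu.comp Sum.inl).symm)))
      (lang_pair (P.mem_grammar_iff.2 (.comp ℓ k r hi' hj hj' ?_ ?_)) (ih hj hju) (ih' hj' hju'))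
    · refine OrdEq.trans ?_ hju.symm
      have := hu.comp (Sum.elim (fun c : Option P.Clock => (Sum.inl (Sum.inl c) : P.Entry))
        fun c : Option P.Clock => Sum.inr (Sum.inl c))
      intro c d
      have h' := this c d
      rcases c with c | c <;> rcases d with d | d <;> exact h'
    · refine OrdEq.trans ?_ hju'.symm
      have := hu.comp (Sum.elim (fun c : Option P.Clock => (Sum.inr (Sum.inl c) : P.Entry))
        fun c : Option P.Clock => Sum.inl (Sum.inr c))
      intro c d
      have h' := this c d
      rcases c with c | c <;> rcases d with d | d <;> exact h'
  | @op ℓ r s s' π op h hop =>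
    obtain ⟨rfl, ho⟩ := (opRel_iff_opHolds (P.typ i) π op).1 (hop.congr hs.symm)
    exact lang_nil (P.mem_grammar_iff.2 (.op h hi ho))
  | @stack ℓ k l r s s' π γ ψ χ ζ hpush hψ _ hpop hχ ih =>
    obtain ⟨i', hi', hu⟩ := exists_typ (P := P)
      (Sum.elim (Sum.elim s s') (Sum.elim s ζ))
    have hends : OrdEq (P.ends i') (Sum.elim s s') := hu.comp Sum.inl
    refine lang_single (P.mem_grammar_iff.2 (.rename ℓ r hi hi' (hs.trans hends.symm)))
      (lang_single (P.mem_grammar_iff.2 (.stack hpush hpop hi'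
        ((stackHolds_iff _ _ _).2 ⟨γ, ψ, χ, rfl, rfl, hψ.congr ?_, hχ.congr ?_⟩))) (ih hi' hends))
    · have := hu.symm.comp (Sum.elim (fun c : Option P.Clock => (Sum.inl (Sum.inl c) : P.Entry))
        fun z : P.StackClock => Sum.inr (Sum.inr z))
      intro c d
      have h' := this c d
      rcases c with c | c <;> rcases d with d | d <;> exact h'
    · have := hu.symm.comp (Sum.elim (fun c : Option P.Clock => (Sum.inl (Sum.inr c) : P.Entry))
        fun z : P.StackClock => Sum.inr (Sum.inr z))
      intro c d
      have h' := this c d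
      rcases c with c | c <;> rcases d with d | d <;> exact h'

/-! ### Soundness of the grammar -/

section Sound

variable {α : Type} [LinearOrder α]

variable (P α) in
/-- What a nonterminal is meant to derive. -/
def Meaning (A : ℕ) : Set (P.Letter → ℕ) :=
  {π | ∀ (ℓ r : P.Loc) (i : ℕ), i < P.types.length → A = P.nonterminal ℓ r i →
    ∀ s s' : P.Stamps α, OrdEq (Sum.elim s s') (P.ends i) → P.Sem α ℓ s π r s'}

/-- A nonterminal is a number, and the injectivity of `code` recovers its locations and its type. -/
theorem mem_meaning_iff {ℓ r : P.Loc} {i : ℕ} (hi : i < P.types.length) {π : P.Letter → ℕ} :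
    π ∈ P.Meaning α (P.nonterminal ℓ r i) ↔
      ∀ s s' : P.Stamps α, OrdEq (Sum.elim s s') (P.ends i) → P.Sem α ℓ s π r s' := by
  constructor
  · exact fun h => h ℓ r i hi rfl
  · intro h ℓ' r' i' hi' he
    obtain ⟨h1, h2, rfl⟩ := code_inj r.2 r'.2 hi hi' he
    obtain rfl := Fin.ext h1
    obtain rfl := Fin.ext h2
    exact h

-- The only place where density is needed: a production speaks of witnesses inside a tuple of
-- numbers, and these have to be realised by stamps over arbitrary given endpoints of the same order
-- type.
open scoped Pointwise in
theorem meaning_of_production [DenselyOrdered α] [NoMinOrder α] [NoMaxOrder α] [Nonempty α]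
    {p : Production} (hp : p ∈ P.grammar) {π : P.Letter → ℕ}
    (hπ : π ∈ ((p.2.1 : Multiset ℕ).map (P.Meaning α)).sum) :
    (fun a : P.Letter => p.2.2.count (a : ℕ)) + π ∈ P.Meaning α p.1 := by
  -- `exists_extension` keeps the endpoints fixed and adds intermediate stamps `t` and stack stamps
  -- `ζ` in the positions that the tuple prescribes.
  have hext : ∀ {i : ℕ} {s s' : P.Stamps α}, OrdEq (Sum.elim s s') (P.ends i) →
      ∃ (t : P.Stamps α) (ζ : P.StackClock → α),
        OrdEq (Sum.elim (Sum.elim s s') (Sum.elim t ζ)) (P.entry (P.typ i)) := by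
    intro i s s' h
    obtain ⟨u, hu, hus⟩ := exists_extension (P.entry (P.typ i)) Sum.inl (Sum.elim s s') h
    refine ⟨fun c => u (.inr (.inl c)), fun z => u (.inr (.inr z)), ?_⟩
    convert hu using 1
    funext e
    rcases e with c | c | z
    · exact (hus c).symm
    · rfl
    · rfl
  rw [mem_grammar_iff] at hp
  cases hp with
  | id ℓ hi h =>
    have hπ : π = 0 := by simpa using hπ
    subst hπ
    refine (mem_meaning_iff hi).2 fun s s' hs => ?_
    have : s' = s := funext fun c => (hs.eq_iff (.inr c) (.inl c)).2 (congrFun h c).symm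
    rw [this]
    exact .refl ℓ s
  | @rename ℓ r i j hi hj h =>
    have hπ : π ∈ P.Meaning α (P.nonterminal ℓ r j) := by simpa using hπ
    refine (mem_meaning_iff hi).2 fun s s' hs => ?_
    have := (mem_meaning_iff hj).1 hπ s s' (hs.trans h)
    convert this using 1
    funext a
    simp
  | @comp ℓ k r i j j' hi hj hj' h h' =>
    have hπ : π ∈ P.Meaning α (P.nonterminal ℓ k j) + P.Meaning α (P.nonterminal k r j') := by simpa using hπ
    obtain ⟨π₁, h1, π₂, h2, rfl⟩ := Set.mem_add.1 hπ
    refine (mem_meaning_iff hi).2 fun s s' hs => ?_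
    obtain ⟨t, ζ, ht⟩ := hext hs
    have e1 := (mem_meaning_iff hj).1 h1 s t (by
      refine OrdEq.trans ?_ h
      have := ht.comp (Sum.elim (fun c : Option P.Clock => (Sum.inl (Sum.inl c) : P.Entry))
        fun c : Option P.Clock => Sum.inr (Sum.inl c))
      intro c d
      have h' := this c d
      rcases c with c | c <;> rcases d with d | d <;> exact h')
    have e2 := (mem_meaning_iff hj').1 h2 t s' (by
      refine OrdEq.trans ?_ h'
      have := ht.comp (Sum.elim (fun c : Option P.Clock => (Sum.inr (Sum.inl c) : P.Entry))
        fun c : Option P.Clock => Sum.inl (Sum.inr c))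
      intro c d
      have h' := this c d
      rcases c with c | c <;> rcases d with d | d <;> exact h')
    convert e1.comp e2 using 1
    funext a
    simp
  | op ho hi h =>
    have hπ : π = 0 := by simpa using hπ
    subst hπ
    refine (mem_meaning_iff hi).2 fun s s' hs => ?_
    rw [add_zero]
    exact .op ho (((opRel_iff_opHolds _ _ _).2 ⟨rfl, h⟩).congr hs.symm)
  | @stack ℓ k l r o o' ho ho' i hi h =>
    have hπ : π ∈ P.Meaning α (P.nonterminal k l i) := by simpa using hπ
    refine (mem_meaning_iff hi).2 fun s s' hs => ?_
    obtain ⟨t, ζ, ht⟩ := hext hs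
    obtain ⟨γ, ψ, χ, rfl, rfl, hψ, hχ⟩ := (stackHolds_iff _ _ _).1 h
    have e1 := (mem_meaning_iff hi).1 hπ s s' hs
    have := Sem.stack ζ ho (hψ.congr ?_) e1 ho' (hχ.congr ?_)
    · convert this using 1
      funext a
      simp
    · have := ht.symm.comp (Sum.elim (fun c : Option P.Clock => (Sum.inl (Sum.inl c) : P.Entry))
        fun z : P.StackClock => Sum.inr (Sum.inr z))
      intro c d
      have h' := this c d
      rcases c with c | c <;> rcases d with d | d <;> exact h'
    · have := ht.symm.comp (Sum.elim (fun c : Option P.Clock => (Sum.inl (Sum.inr c) : P.Entry))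
        fun z : P.StackClock => Sum.inr (Sum.inr z))
      intro c d
      have h' := this c d
      rcases c with c | c <;> rcases d with d | d <;> exact h'

-- The meanings are closed under all productions, hence contain the Parikh images of all
-- derivations.
open scoped Pointwise in
theorem sem_of_mem_lang [DenselyOrdered α] [NoMinOrder α] [NoMaxOrder α] [Nonempty α]
    {ℓ r : P.Loc} {i : ℕ} (hi : i < P.types.length) {π : P.Letter → ℕ}
    (hπ : π ∈ P.Lang (P.nonterminal ℓ r i)) {s s' : P.Stamps α}
    (hs : OrdEq (Sum.elim s s') (P.ends i)) : P.Sem α ℓ s π r s' := by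
  obtain ⟨y, hy, rfl⟩ := hπ
  have := hy.sum_mem (wt := fun j => fun a : P.Letter => letterCount P.grammar j a)
    (I := P.Meaning α) fun j w hw => meaning_of_production (prod_mem j) hw
  rw [Multiset.map_singleton, Multiset.sum_singleton] at this
  convert (mem_meaning_iff hi).1 this s s' hs using 1
  funext a
  simp [Finset.sum_apply]

end Sound

end TPDA

/-! ### Equivalence of the formula and fractional reachability -/

namespace TPDA

open TimedPDA

variable (P : TPDA)

/-- The formula for the fractional reachability relation. -/
def formula (ℓ r : P.Loc) : Formula :=
  reachFormula P.letters P.locations P.globalClocks P.types P.grammar ℓ r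

theorem formula_existential (ℓ r : P.Loc) : (P.formula ℓ r).Existential := reachFormula_existential

variable {P}

/-- Time stamps can be moved into an open interval. -/
theorem exists_shift (s s' : P.Stamps (Set.Ico (0 : ℚ) 1)) :
    ∃ (ε : ℚ) (t t' : P.Stamps (Set.Ioo (0 : ℚ) 1)),
      (∀ c, (t c : ℚ) = s c + ε) ∧ ∀ c, (t' c : ℚ) = s' c + ε := by
  have : Nonempty (Set.Ico (0 : ℚ) 1) := ⟨⟨0, by simp⟩⟩
  obtain ⟨M, hM⟩ := Finite.exists_le (Sum.elim s s')
  have hM' := M.2.2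
  have h1 : ∀ c, (s c : ℚ) ≤ M := fun c => hM (.inl c)
  have h2 : ∀ c, (s' c : ℚ) ≤ M := fun c => hM (.inr c)
  -- Half the gap between the largest stamp and `1`. A common shift changes neither the order nor
  -- differences.
  refine ⟨(1 - M) / 2, fun c => ⟨s c + (1 - M) / 2, ?_, ?_⟩,
    fun c => ⟨s' c + (1 - M) / 2, ?_, ?_⟩, fun _ => rfl, fun _ => rfl⟩
  · have := (s c).2.1; linarith
  · have := h1 c; linarith
  · have := (s' c).2.1; linarith
  · have := h2 c; linarith

/-- The guessed stamps are those of the run, shifted into the open interval; the shifted stamps have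
the order type of the original ones, which suffices for `Sem.mem_lang`. -/
theorem sat_formula_of_sem (hP : P.Fractional) {ℓ r : P.Loc} {μ ν : P.Clock → ℚ≥0}
    {π : P.Letter → ℕ} (h : P.Reach ℓ r μ π ν) {v : ℕ → ℤ} {w : ℕ → ℚ}
    (hv : ∀ i : P.Letter, v i = π i) (hw : ∀ x : P.Clock, w x = Int.fract (μ x : ℚ))
    (hw' : ∀ x : P.Clock, w (P.globalClocks + x) = Int.fract (ν x : ℚ)) :
    (P.formula ℓ r).Sat v w := by
  obtain ⟨l, hl, rfl⟩ := h
  obtain ⟨T, hT⟩ := hl.semStack hP rfl 0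
  obtain ⟨ε, t, t', ht, ht'⟩ := exists_shift (stamps 0 μ) (stamps T ν)
  obtain ⟨i, hi, hu⟩ := exists_typ (P := P) (Sum.elim (Sum.elim t t') (Sum.elim t fun _ => t none))
  have hends : OrdEq (P.ends i) (Sum.elim t t') := hu.comp Sum.inl
  have hshift : OrdEq (Sum.elim t t') (Sum.elim (stamps 0 μ) (stamps T ν)) := by
    rintro (c | c) (d | d) <;>
      simp only [Sum.elim_inl, Sum.elim_inr, ← Subtype.coe_le_coe, ht, ht', add_le_add_iff_right]
  obtain ⟨y, hy, hπ⟩ := Sem.mem_lang hT hi (hends.trans hshift)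
  refine (sat_reachFormula P.boundedBy_grammar ℓ.2 r.2).2
    ⟨t, t', i, fun x => ⟨?_, ?_⟩, hi, hends.symm, y, hy, fun a ha => ?_⟩
  · rw [hw, stampOf_iff (Int.fract_nonneg _) (Int.fract_lt_one _) (t _).2.1 (t _).2.2
      (t _).2.1 (t _).2.2, ht, ht, add_sub_add_right_eq_sub, ← fract_stamps]
  · rw [hw', stampOf_iff (Int.fract_nonneg _) (Int.fract_lt_one _) (t' _).2.1 (t' _).2.2
      (t' _).2.1 (t' _).2.2, ht', ht', add_sub_add_right_eq_sub, ← fract_stamps]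
  · have := hv ⟨a, ha⟩
    rw [hπ] at this
    simp only [this, Nat.cast_sum, Nat.cast_mul]
    exact Finset.sum_congr rfl fun j _ => mul_comm _ _

theorem fractReach_of_sat (hP : P.Fractional) {ℓ r : P.Loc} {a b : P.Clock → Set.Ico (0 : ℚ) 1}
    {π : P.Letter → ℕ} {v : ℕ → ℤ} {w : ℕ → ℚ}
    (hv : ∀ i : P.Letter, v i = π i) (hw : ∀ x : P.Clock, w x = a x)
    (hw' : ∀ x : P.Clock, w (P.globalClocks + x) = b x) (h : (P.formula ℓ r).Sat v w) :
    P.FractReach ℓ r a π b := by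
  obtain ⟨s, s', i, hst, hi, hs, y, hy, hva⟩ :=
    (sat_reachFormula P.boundedBy_grammar ℓ.2 r.2).1 h
  have : Nonempty (Set.Ioo (0 : ℚ) 1) := ⟨⟨1 / 2, by norm_num, by norm_num⟩⟩
  have hπ : π ∈ P.Lang (P.nonterminal ℓ r i) := by
    refine ⟨y, hy, funext fun c => ?_⟩
    have := hva c c.2
    rw [hv] at this
    have h' : (π c : ℤ) = ((∑ j, letterCount P.grammar j c * y j : ℕ) : ℤ) := by
      rw [this]; push_cast; rfl
    rw [Int.natCast_inj.1 h']
    exact Finset.sum_congr rfl fun j _ => mul_comm _ _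
  have hsem := sem_of_mem_lang hi hπ hs
  have h1 : ∀ x, (a x : ℚ) = Int.fract ((s none : ℚ) - s (some x)) := fun x => by
    have := (hst x).1
    rwa [hw, stampOf_iff (a x).2.1 (a x).2.2 (s _).2.1 (s _).2.2 (s _).2.1 (s _).2.2] at this
  have h2 : ∀ x, (b x : ℚ) = Int.fract ((s' none : ℚ) - s' (some x)) := fun x => by
    have := (hst x).2
    rwa [hw', stampOf_iff (b x).2.1 (b x).2.2 (s' _).2.1 (s' _).2.2 (s' _).2.1 (s' _).2.2] at this
  have ha : ∀ x, Int.fract (a x : ℚ) = a x := fun x => Int.fract_eq_self.2 (a x).2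
  obtain ⟨l, ν, δ, hrun, hpar, hν, -⟩ := hsem.exists_run hP (e := Subtype.val) (fun _ _ h => h)
    -- The run starts from the fractional parts themselves as clock values.
    (fun q => ⟨q.2.1.le, q.2.2⟩) (fun x => ⟨a x, (a x).2.1⟩) []
    fun x => (ha x).trans (h1 x)
  exact ⟨_, ν, ⟨l, hrun, hpar⟩, ha, fun x => (hν x).trans (h2 x).symm⟩

theorem formula_expresses (hP : P.Fractional) : P.FractExpressedBy P.formula := by
  refine fun ℓ r => ⟨fun i => reachFormula_freeInt P.boundedBy_grammar,
    fun i => reachFormula_freeRat, fun a π b v w hv hw hw' => ⟨?_, fractReach_of_sat hP hv hw hw'⟩⟩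
  rintro ⟨μ, ν, h, ha, hb⟩
  exact sat_formula_of_sem hP h hv (fun x => (hw x).trans (ha x).symm)
    fun x => (hw' x).trans (hb x).symm

variable (P)

theorem list_ofFn_range {n : ℕ} {β : Type} (f : ℕ → β) :
    List.ofFn (fun i : Fin n => f i) = (List.range n).map f := by
  refine List.ext_getElem (by simp) fun i h1 h2 => by simp

theorem encodeFamily_formula : P.encodeFamily P.formula =
    Enc.enc (reachFamily P.letters P.locations P.globalClocks P.types P.grammar) := by
  change Data.list _ = Data.list _
  rw [reachFamily, List.map_map, ← list_ofFn_range]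
  congr 2
  funext ℓ
  change Data.list _ = Data.list _
  rw [List.map_map, ← list_ofFn_range]
  rfl

end TPDA

/-! ### Size of the list of order types, and shape of the bounds -/

namespace TimedPDA

open Enc (enc)

/-- One more entry. -/
def extendTuples (K : ℕ) (H : List (List ℕ)) : List (List ℕ) :=
  H.flatMap fun h => (List.range K).map fun k => k :: h

theorem foldl_extendTuples (K m : ℕ) :
    (List.replicate m ()).foldl (fun H _ => extendTuples K H) [[]] = tuples K m := by
  induction m with
  | zero => rfl
  | succ m ih => rw [List.replicate_succ', List.foldl_concat, ih]; rfl

theorem PF.extendTuples :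
    PF fun p : (ℕ × List (List ℕ)) × Unit => extendTuples p.1.1 p.1.2 := by
  unfold TimedPDA.extendTuples
  fun_prop

theorem length_tuples (K m : ℕ) : (tuples K m).length = K ^ m := by
  induction m with
  | zero => rfl
  | succ m ih =>
    simp [tuples, List.length_flatMap, ih, pow_succ]

/-- There are `K ^ m ≤ 2 ^ (K * K)` tuples, each of size quadratic in `K`. All lengths `m ≤ K` are
covered because the shorter tuples are the intermediate results of the enumeration. -/
theorem sz_tuples_le {K m : ℕ} (hm : m ≤ K) : sz (tuples K m) ≤ 2 ^ (7 * (K + 1) ^ 2) := by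
  have h1 : ∀ h ∈ tuples K m, sz h ≤ K * (2 * K + 2) + 1 := by
    intro h hh
    obtain ⟨rfl, hk⟩ := mem_tuples.1 hh
    have := sz_list_le (l := h) (B := 2 * K + 1) fun k hkh => by
      rw [sz_nat]; have := hk k hkh; omega
    refine this.trans ?_
    have := Nat.mul_le_mul_right (2 * K + 1 + 1) hm
    change _ ≤ K * (2 * K + 1 + 1) + 1
    omega
  have h2 := sz_list_le h1
  rw [length_tuples] at h2
  have h3 : K ^ m ≤ 2 ^ (K * K) := by
    calc K ^ m ≤ (2 ^ K) ^ m := Nat.pow_le_pow_left Nat.lt_two_pow_self.le _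
      _ = 2 ^ (K * m) := by rw [pow_mul]
      _ ≤ 2 ^ (K * K) := Nat.pow_le_pow_right (by norm_num) (Nat.mul_le_mul_left _ hm)
  have h4 : K * (2 * K + 2) + 3 ≤ 2 ^ (2 * K + 3) := by
    have : K + 1 ≤ 2 ^ K := Nat.lt_two_pow_self
    have e : 2 ^ (2 * K + 3) = 2 ^ K * 2 ^ K * 8 := by rw [pow_add, two_mul, pow_add]; norm_num
    rw [e]
    nlinarith
  have h5 : 1 ≤ 2 ^ (K * K) := Nat.one_le_two_pow
  have h6 := Nat.mul_le_mul_right (K * (2 * K + 2) + 1 + 1) h3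
  calc sz (tuples K m) ≤ 2 ^ (K * K) * (K * (2 * K + 2) + 1 + 1) + 2 ^ (K * K) := by omega
    _ = 2 ^ (K * K) * (K * (2 * K + 2) + 3) := by ring
    _ ≤ 2 ^ (K * K) * 2 ^ (2 * K + 3) := Nat.mul_le_mul_left _ h4
    _ = 2 ^ (K * K + (2 * K + 3)) := (pow_add _ _ _).symm
    _ ≤ 2 ^ (7 * (K + 1) ^ 2) := Nat.pow_le_pow_right (by norm_num) (by nlinarith)

/-- A linear factor in an exponent is absorbed by powers. -/
theorem exists_absorb (C d : ℕ) : ∃ c₀, ∀ c ≥ c₀, ∀ n W : ℕ, 2 ≤ W →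
    2 ^ (C * (n + 1) ^ d) * W ^ C ≤ 2 ^ (n + 1) ^ c * W ^ c := by
  refine ⟨2 * C + d, fun c hc n W hW => ?_⟩
  cases n with
  | zero =>
    -- Without clocks, raising `n + 1 = 1` to a higher power gains nothing, so the constant factor
    -- is charged to `W ≥ 2`.
    calc 2 ^ (C * (0 + 1) ^ d) * W ^ C ≤ W ^ C * W ^ C := by
          simpa using Nat.mul_le_mul_right _ (Nat.pow_le_pow_left hW C)
      _ = W ^ (2 * C) := by rw [← pow_add, two_mul]
      _ ≤ W ^ c := Nat.pow_le_pow_right (by omega) (by omega)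
      _ ≤ _ := Nat.le_mul_of_pos_left _ (by positivity)
  | succ n =>
    refine Nat.mul_le_mul (Nat.pow_le_pow_right (by norm_num) ?_)
      (Nat.pow_le_pow_right (by omega) (by omega))
    calc C * (n + 1 + 1) ^ d ≤ 2 ^ C * (n + 1 + 1) ^ d :=
          Nat.mul_le_mul_right _ Nat.lt_two_pow_self.le
      _ ≤ (n + 1 + 1) ^ C * (n + 1 + 1) ^ d :=
          Nat.mul_le_mul_right _ (Nat.pow_le_pow_left (by omega) _)
      _ = (n + 1 + 1) ^ (C + d) := by rw [pow_add]
      _ ≤ (n + 1 + 1) ^ c := Nat.pow_le_pow_right (by omega) (by omega)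

end TimedPDA

/-! ### The algorithm and its running time -/

namespace TPDA

open TimedPDA
open Enc (enc)

instance : Enc TPDA := ⟨encode⟩

/-- The components of an automaton. -/
def components (P : TPDA) : ℕ × ℕ × ℕ × ℕ × ℕ × List Data :=
  (P.letters, P.stackSymbols, P.locations, P.globalClocks, P.stackClocks, P.rules.map P.encodeRule)

/-- The representation of an automaton is already that of a nested tuple, so reading off a component
is a projection. -/
theorem enc_components (P : TPDA) : enc P.components = enc P := by
  change Data.node _ (Data.node _ (Data.node _ (Data.node _ (Data.node _
    (Data.list ((P.rules.map P.encodeRule).map id)))))) = _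
  rw [List.map_id]
  rfl

theorem PF_components : PF components := PF.id'.recode enc_components

@[fun_prop]
theorem PF_letters : PF letters := PF.fst.comp PF_components

@[fun_prop]
theorem PF_locations : PF locations := PF.fst.comp (PF.snd.comp (PF.snd.comp PF_components))

@[fun_prop]
theorem PF_globalClocks : PF globalClocks :=
  PF.fst.comp (PF.snd.comp (PF.snd.comp (PF.snd.comp PF_components)))

@[fun_prop]
theorem PF_stackClocks : PF stackClocks :=
  PF.fst.comp (PF.snd.comp (PF.snd.comp (PF.snd.comp (PF.snd.comp PF_components))))

theorem PF_rules : PF fun P : TPDA => P.rules.map P.encodeRule :=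
  PF.snd.comp (PF.snd.comp (PF.snd.comp (PF.snd.comp (PF.snd.comp PF_components))))

/-- Polynomial in the automaton and the list of tuples jointly: the exponential cost is confined to
producing the list. -/
theorem PF_family : PF fun p : TPDA × List (List ℕ) =>
    reachFamily p.1.letters p.1.locations p.1.globalClocks p.2
      (productions p.1.locations p.1.globalClocks p.2 (p.1.rules.map p.1.encodeRule)) := by
  have h : PF fun p : TPDA × List (List ℕ) => p.1.rules.map p.1.encodeRule := PF_rules.comp PF.fst
  exact PF.reachFamily (by fun_prop) (by fun_prop) (by fun_prop) PF.snd
    (PF.productions (by fun_prop) (by fun_prop) PF.snd h)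

@[fun_prop]
theorem PF_tupleLength : PF tupleLength := by
  unfold tupleLength
  fun_prop

theorem tupleLength_le (P : TPDA) : P.tupleLength ≤ 3 * (P.clocks + 1) := by
  simp only [tupleLength, clocks]
  omega

theorem two_le_size (P : TPDA) : 2 ≤ P.encode.size := by
  have := Data.one_le_size (Data.unary P.letters)
  simp only [encode, Data.size]
  omega

/-- The running time, in terms of the size of the input. -/
theorem exists_runs : ∃ (p : Prog) (C : ℕ), ∀ P : TPDA, ∃ t,
    Runs p P.encode (P.encodeFamily P.formula) t ∧
      t ≤ 2 ^ (C * (P.clocks + 1) ^ 2) * P.encode.size ^ C := by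
  have hinit : PF fun P : TPDA => ((P.tupleLength, ([[]] : List (List ℕ))),
      List.replicate P.tupleLength ()) :=
    PF.prodMk (by fun_prop) (PF.replicate PF_tupleLength)
  obtain ⟨p₁, c₁, h₁⟩ := hinit
  obtain ⟨p₂, c₂, h₂⟩ := PF.foldl_runs (f := fun K H (_ : Unit) => extendTuples K H)
    PF.extendTuples
  obtain ⟨p₃, c₃, h₃⟩ := PF_family
  obtain ⟨c₄, h₄⟩ := PF_tupleLength.size
  -- With `Q = N * B`, each of the three phases takes time at most `Q ^ (F - 3)`: the arguments of
  -- the second and third are of size at most `Q ^ (c₄ + 4)` and `Q ^ 2`. The spare factor `Q ^ 3`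
  -- pays for adding up. The constant `112 = 7 * 4 ^ 2` comes from `K + 1 ≤ 4 * (P.clocks + 1)`.
  set F := c₁ + (c₄ + 4) * c₂ + 2 * c₃ + 4 with hF
  refine ⟨.comp p₃ (.pair .skip (.comp p₂ p₁)), 112 * F, fun P => ?_⟩
  set K := P.tupleLength with hK
  set N := P.encode.size with hN
  obtain ⟨t₁, r₁, b₁⟩ := h₁ P
  obtain ⟨t₂, r₂, b₂⟩ := h₂ K [[]] (List.replicate K ()) (2 ^ (7 * (K + 1) ^ 2))
    fun l' hl' => by
      obtain ⟨m, hm, rfl⟩ : ∃ m ≤ K, l' = List.replicate m () :=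
        ⟨l'.length, by simpa using hl'.length_le, List.eq_replicate_iff.2 ⟨rfl, fun _ _ => rfl⟩⟩
      rw [foldl_extendTuples]
      exact sz_tuples_le hm
  rw [foldl_extendTuples] at r₂
  obtain ⟨t₃, r₃, b₃⟩ := h₃ (P, P.types)
  have hB := sz_tuples_le (le_refl K)
  set B := 2 ^ (7 * (K + 1) ^ 2) with hBdef
  refine ⟨_, .comp (.pair (.skip _) (.comp r₁ r₂)) (P.encodeFamily_formula ▸ r₃), ?_⟩
  have hN2 : 2 ≤ N := P.two_le_size
  have hB8 : 8 ≤ B := by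
    have : 2 ^ 3 ≤ B := Nat.pow_le_pow_right (by norm_num) (by nlinarith)
    simpa using this
  have hNQ : N + 1 ≤ N * B := by nlinarith
  have hBQ : B + B ≤ N * B := by nlinarith
  have hsz : sz P = N := rfl
  have hrep : sz (List.replicate K ()) = sz K := congrArg Data.size (enc_nat K)
  have h₄ : sz K ≤ (sz P + 1) ^ c₄ := h₄ P
  rw [hsz] at b₁ h₄
  rw [hrep] at b₂
  rw [sz_prod, hsz] at b₃
  change _ ≤ (N + sz (tuples K K) + 1 + 1) ^ c₃ at b₃
  set Q := N * B with hQ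
  have hQ8 : 8 ≤ Q := by omega
  have e₁ : t₁ ≤ Q ^ (F - 3) := (b₁.trans (Nat.pow_le_pow_left hNQ _)).trans
    (Nat.pow_le_pow_right (by omega) (by rw [hF]; omega))
  have e₂ : t₂ ≤ Q ^ (F - 3) := by
    have h : sz K + sz K + B + 4 ≤ Q ^ (c₄ + 4) := by
      have h5 := h₄.trans (Nat.pow_le_pow_left hNQ c₄)
      have h6 : 8 ^ 4 ≤ Q ^ 4 := Nat.pow_le_pow_left hQ8 4
      have h7 : Q ≤ Q ^ 4 := Nat.le_self_pow (by norm_num) _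
      have h8 : 1 ≤ Q ^ c₄ := Nat.one_le_pow _ _ (by omega)
      have h9 := Nat.mul_le_mul_left (Q ^ c₄) h6
      have h10 := Nat.mul_le_mul h8 h7
      rw [pow_add]
      omega
    refine (b₂.trans (Nat.pow_le_pow_left h _)).trans ?_
    rw [← pow_mul]
    exact Nat.pow_le_pow_right (by omega) (by rw [hF]; omega)
  have e₃ : t₃ ≤ Q ^ (F - 3) := by
    have h : N + sz (tuples K K) + 1 + 1 ≤ Q ^ 2 := by nlinarith
    refine (b₃.trans (Nat.pow_le_pow_left h _)).trans ?_
    rw [← pow_mul]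
    exact Nat.pow_le_pow_right (by omega) (by rw [hF]; omega)
  have e₄ : N ≤ Q ^ (F - 3) := (show N ≤ Q by omega).trans (Nat.le_self_pow (by rw [hF]; omega) _)
  have e₅ : Q ^ F = Q ^ (F - 3) * Q ^ 3 := by
    rw [← pow_add, Nat.sub_add_cancel (by rw [hF]; omega)]
  have e₆ : 8 ^ 3 ≤ Q ^ 3 := Nat.pow_le_pow_left hQ8 3
  have e₇ := Nat.mul_le_mul_left (Q ^ (F - 3)) e₆
  change N + (t₁ + t₂ + N) + N + t₃ + N ≤ _
  calc N + (t₁ + t₂ + N) + N + t₃ + N ≤ Q ^ F := by omega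
    _ = 2 ^ (7 * (K + 1) ^ 2 * F) * N ^ F := by rw [hQ, mul_pow, mul_comm, hBdef, ← pow_mul]
    _ ≤ 2 ^ (112 * F * (P.clocks + 1) ^ 2) * N ^ (112 * F) := by
      refine Nat.mul_le_mul (Nat.pow_le_pow_right (by norm_num) ?_)
        (Nat.pow_le_pow_right (by omega) (by omega))
      have h1 : K + 1 ≤ 4 * (P.clocks + 1) := by have := P.tupleLength_le; omega
      have h2 := Nat.pow_le_pow_left h1 2
      calc 7 * (K + 1) ^ 2 * F ≤ 7 * (4 * (P.clocks + 1)) ^ 2 * F :=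
            Nat.mul_le_mul_right _ (Nat.mul_le_mul_left _ h2)
        _ = 112 * F * (P.clocks + 1) ^ 2 := by ring

end TPDA

namespace TimedPDA

/-! ### The number and the size of conjunctive fractional rules -/

section Conj

variable {V : Type}

/-- Fractional literals. -/
abbrev FractLit (V : Type) : Type := Bool × (V ⊕ V × V)

def FractLit.toLit (a : FractLit V) : Bool × Atom V :=
  (a.1, a.2.elim .fractZero fun p => .fractLe p.1 p.2)

theorem FractLit.exists_eq {a : Bool × Atom V} (h : a.2.Fractional) :
    ∃ b : FractLit V, b.toLit = a := by
  obtain ⟨b, a⟩ := a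
  cases a with
  | fractZero x => exact ⟨(b, .inl x), rfl⟩
  | fractLe x y => exact ⟨(b, .inr (x, y)), rfl⟩
  | _ => exact h.elim

theorem exists_lits {l : List (Bool × Atom V)} (h : (Constraint.conj l).Fractional) :
    ∃ m : List (FractLit V), m.map FractLit.toLit = l := by
  induction l with
  | nil => exact ⟨[], rfl⟩
  | cons a l ih =>
    obtain ⟨b, a⟩ := a
    obtain ⟨m, rfl⟩ := ih h.2
    have ha : a.Fractional := by cases b <;> exact h.1
    obtain ⟨c, hc⟩ := FractLit.exists_eq (a := (b, a)) ha
    exact ⟨c :: m, by rw [List.map_cons, hc]⟩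

theorem size_unary (n : ℕ) : (Data.unary n).size = 2 * n + 1 := sz_nat n

theorem size_tag (k : ℕ) (d : Data) : (Data.tag k d).size = d.size + 2 * k + 2 := by
  simp only [Data.tag, Data.size, size_unary]; omega

theorem size_literal_le (e : V → Data) {M : ℕ} (he : ∀ v, (e v).size ≤ M) (a : FractLit V) :
    ((Constraint.literal a.toLit.1 a.toLit.2).encode e).size ≤ 2 * M + 23 := by
  rcases a with ⟨b, x | ⟨x, y⟩⟩
  · have := he x
    cases b <;> simp [FractLit.toLit, Constraint.literal, Constraint.encode, Atom.encode,
      size_tag] <;> omega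
  · have := he x
    have := he y
    cases b <;> simp [FractLit.toLit, Constraint.literal, Constraint.encode, Atom.encode,
      size_tag, Data.size] <;> omega

theorem size_conj_le (e : V → Data) {M : ℕ} (he : ∀ v, (e v).size ≤ M) (l : List (FractLit V)) :
    ((Constraint.conj (l.map FractLit.toLit)).encode e).size ≤ l.length * (2 * M + 32) + 3 := by
  induction l with
  | nil => simp [Constraint.conj, Constraint.encode, size_tag, Data.size]
  | cons a l ih =>
    have := size_literal_le e he a
    simp only [List.map_cons, Constraint.conj, Constraint.encode, size_tag, Data.size,
      List.length_cons, add_mul, one_mul]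
    omega

variable [Fintype V]

/-- Codes for conjunctions of fractional literals. -/
abbrev ConjCode (V : Type) [Fintype V] : Type :=
  Fin (Fintype.card (FractLit V)) → Option (FractLit V)

def ConjCode.toList (f : ConjCode V) : List (FractLit V) := (List.ofFn f).reduceOption

def ConjCode.toConstraint (f : ConjCode V) : Constraint V :=
  .conj (f.toList.map FractLit.toLit)

theorem ConjCode.length_toList_le (f : ConjCode V) :
    f.toList.length ≤ Fintype.card (FractLit V) :=
  (List.reduceOption_length_le _).trans (by simp)

/-- Distinctness bounds the number of conjuncts by the number of literals; shorter lists are padded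
with `none`, so that one finite function type codes all conjunctions. -/
theorem ConjCode.exists_eq {φ : Constraint V} (hφ : φ.Fractional) (hc : φ.Conjunctive) :
    ∃ f : ConjCode V, f.toConstraint = φ := by
  obtain ⟨l, hl, rfl⟩ := hc
  obtain ⟨m, rfl⟩ := exists_lits hφ
  have hm : m.length ≤ Fintype.card (FractLit V) := (hl.of_map _).length_le_card
  let m' : List (Option (FractLit V)) :=
    m.map some ++ List.replicate (Fintype.card (FractLit V) - m.length) none
  have hm' : m'.length = Fintype.card (FractLit V) := by
    rw [List.length_append, List.length_map, List.length_replicate, Nat.add_sub_cancel' hm]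
  refine ⟨fun i => m'[i], ?_⟩
  have : List.ofFn (fun i : Fin (Fintype.card (FractLit V)) => m'[i]) = m' :=
    List.ext_getElem (by simp [hm']) fun i h1 h2 => by simp
  have h2 : m'.reduceOption = m := by
    simp only [m', List.reduceOption, List.filterMap_append, List.filterMap_map,
      List.filterMap_replicate]
    simp
  rw [ConjCode.toConstraint, ConjCode.toList, this, h2]

theorem card_fractLit : Fintype.card (FractLit V) =
    2 * (Fintype.card V + Fintype.card V * Fintype.card V) := by
  simp

theorem card_fractLit_lt {n : ℕ} (h : Fintype.card V ≤ n) :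
    Fintype.card (FractLit V) + 1 ≤ 2 * (n + 1) ^ 2 := by
  rw [card_fractLit]
  nlinarith [Nat.mul_le_mul h h]

theorem card_conjCode_le {n : ℕ} (h : Fintype.card V ≤ n) :
    Fintype.card (ConjCode V) ≤ 2 ^ (4 * (n + 1) ^ 4) := by
  have h1 := card_fractLit_lt h
  have h2 : Fintype.card (ConjCode V) =
      (Fintype.card (FractLit V) + 1) ^ Fintype.card (FractLit V) := by
    rw [Fintype.card_fun, Fintype.card_option, Fintype.card_fin]
  rw [h2]
  calc (Fintype.card (FractLit V) + 1) ^ Fintype.card (FractLit V)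
      ≤ (2 * (n + 1) ^ 2) ^ (2 * (n + 1) ^ 2) :=
        (Nat.pow_le_pow_left h1 _).trans (Nat.pow_le_pow_right (by positivity) (by omega))
    _ ≤ (2 ^ (2 * (n + 1) ^ 2)) ^ (2 * (n + 1) ^ 2) :=
        Nat.pow_le_pow_left Nat.lt_two_pow_self.le _
    _ = 2 ^ (4 * (n + 1) ^ 4) := by rw [← pow_mul]; congr 1; ring

theorem size_conjCode_le {n : ℕ} (h : Fintype.card V ≤ n) (e : V → Data)
    (he : ∀ v, (e v).size ≤ 2 * n + 5) (f : ConjCode V) :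
    (f.toConstraint.encode e).size ≤ 87 * (n + 1) ^ 3 := by
  have h1 := size_conj_le e he f.toList
  have h2 := f.length_toList_le
  have h3 := card_fractLit_lt h
  have h4 : f.toList.length ≤ 2 * (n + 1) ^ 2 := by omega
  have h5 := Nat.mul_le_mul_right (2 * (2 * n + 5) + 32) h4
  have h6 : 1 ≤ (n + 1) ^ 3 := Nat.one_le_pow _ _ (by omega)
  have h7 : 2 * (n + 1) ^ 2 * (2 * (2 * n + 5) + 32) ≤ 84 * (n + 1) ^ 3 := by
    have : 2 * (2 * n + 5) + 32 ≤ 42 * (n + 1) := by omega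
    calc 2 * (n + 1) ^ 2 * (2 * (2 * n + 5) + 32) ≤ 2 * (n + 1) ^ 2 * (42 * (n + 1)) :=
          Nat.mul_le_mul_left _ this
      _ = 84 * (n + 1) ^ 3 := by ring
  rw [ConjCode.toConstraint]
  omega

end Conj

/-- Codes for operations with conjunctions of fractional literals. -/
abbrev OpCode (s g m n : ℕ) : Type :=
  Unit ⊕ Option (Fin s) ⊕ ConjCode (Fin m) ⊕ Finset (Fin m) ⊕
    Bool × Fin g × ConjCode (Fin m ⊕ Fin n)

namespace OpCode

variable {s g m n : ℕ}

def toOp : OpCode s g m n → Op s g m n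
  | .inl _ => .elapse
  | .inr (.inl a) => .input a
  | .inr (.inr (.inl φ)) => .test φ.toConstraint
  | .inr (.inr (.inr (.inl Y))) => .reset Y
  | .inr (.inr (.inr (.inr (b, γ, ψ)))) =>
    if b then .push γ ψ.toConstraint else .pop γ ψ.toConstraint

theorem exists_eq {o : Op s g m n} (h : o.Fractional) (hc : o.Conjunctive) :
    ∃ c : OpCode s g m n, c.toOp = o := by
  cases o with
  | elapse => exact ⟨.inl (), rfl⟩
  | input a => exact ⟨.inr (.inl a), rfl⟩
  | test φ =>
    obtain ⟨f, rfl⟩ := ConjCode.exists_eq h hc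
    exact ⟨.inr (.inr (.inl f)), rfl⟩
  | reset Y => exact ⟨.inr (.inr (.inr (.inl Y))), rfl⟩
  | push γ ψ =>
    obtain ⟨f, rfl⟩ := ConjCode.exists_eq h hc
    exact ⟨.inr (.inr (.inr (.inr (true, γ, f)))), rfl⟩
  | pop γ ψ =>
    obtain ⟨f, rfl⟩ := ConjCode.exists_eq h hc
    exact ⟨.inr (.inr (.inr (.inr (false, γ, f)))), rfl⟩

theorem card_le : Fintype.card (OpCode s g m n) ≤
    2 ^ (4 * (m + n + 1) ^ 4) * (s + 2 * g + 4) := by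
  have h1 : Fintype.card (ConjCode (Fin m)) ≤ 2 ^ (4 * (m + n + 1) ^ 4) :=
    card_conjCode_le (by simp)
  have h2 : Fintype.card (ConjCode (Fin m ⊕ Fin n)) ≤ 2 ^ (4 * (m + n + 1) ^ 4) :=
    card_conjCode_le (by simp)
  have h3 : 2 ^ m ≤ 2 ^ (4 * (m + n + 1) ^ 4) := Nat.pow_le_pow_right (by norm_num) (by
    have : m + n + 1 ≤ (m + n + 1) ^ 4 := Nat.le_self_pow (by norm_num) _
    omega)
  simp only [Fintype.card_sum, Fintype.card_prod, Fintype.card_option, Fintype.card_fin,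
    Fintype.card_bool, Fintype.card_unit, Fintype.card_finset]
  have h4 := Nat.mul_le_mul_left (2 * g) h2
  have h5 : 1 ≤ 2 ^ (4 * (m + n + 1) ^ 4) := Nat.one_le_two_pow
  generalize 2 ^ (4 * (m + n + 1) ^ 4) = E at *
  generalize Fintype.card (ConjCode (Fin m)) = a at *
  generalize Fintype.card (ConjCode (Fin m ⊕ Fin n)) = b at *
  nlinarith

theorem size_le (c : OpCode s g m n) :
    (c.toOp.encode).size ≤ 2 * s + 2 * g + 103 * (m + n + 1) ^ 3 := by
  have h1 : 1 ≤ (m + n + 1) ^ 3 := Nat.one_le_pow _ _ (by omega)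
  have h2 : ∀ f : ConjCode (Fin m ⊕ Fin n),
      (f.toConstraint.encode Op.encodeClock).size ≤ 87 * (m + n + 1) ^ 3 := by
    refine size_conjCode_le (by simp) _ ?_
    rintro (x | z) <;> simp only [Op.encodeClock, size_tag, size_unary] <;> omega
  rcases c with u | a | φ | Y | ⟨b, γ, ψ⟩
  · simp [toOp, Op.encode, size_tag, Data.size]; omega
  · cases a with
    | none => simp [toOp, Op.encode, size_tag, Data.size]; omega
    | some a => simp [toOp, Op.encode, size_tag, size_unary]; omega
  · have := size_conjCode_le (n := m + n) (by simp) Op.encodeGlobal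
      (fun x => by simp only [Op.encodeGlobal, size_unary]; omega) φ
    simp only [toOp, Op.encode, size_tag]
    omega
  · simp only [toOp, Op.encode, size_tag]
    have : (Data.list (List.ofFn fun x : Fin m => Data.bool (decide (x ∈ Y)))).size ≤
        1 + m * 4 := by
      have := sz_list_le (l := List.ofFn fun x : Fin m => decide (x ∈ Y)) (B := 3)
        fun a _ => sz_bool_le a
      rw [List.length_ofFn] at this
      change (Data.list ((List.ofFn fun x : Fin m => decide (x ∈ Y)).map Data.bool)).size ≤ _ at this
      rwa [List.map_ofFn] at this
    have h3 : m + n + 1 ≤ (m + n + 1) ^ 3 := Nat.le_self_pow (by norm_num) _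
    omega
  · have := h2 ψ
    cases b <;> simp [toOp, Op.encode, size_tag, size_unary, Data.size] <;> omega

end OpCode

end TimedPDA

namespace TPDA

open TimedPDA

variable {P : TPDA}

/-- Codes for rules. -/
abbrev RuleCode (P : TPDA) : Type :=
  P.Loc × OpCode P.letters P.stackSymbols P.globalClocks P.stackClocks × P.Loc

def RuleCode.toRule (c : P.RuleCode) :
    P.Loc × Op P.letters P.stackSymbols P.globalClocks P.stackClocks × P.Loc :=
  (c.1, c.2.1.toOp, c.2.2)

theorem exists_ruleCode (hP : P.Fractional) (hc : P.Conjunctive) {ρ} (h : ρ ∈ P.rules) :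
    ∃ c : P.RuleCode, c.toRule = ρ := by
  obtain ⟨c, hc⟩ := OpCode.exists_eq (hP ρ h) (hc.2 ρ h)
  exact ⟨(ρ.1, c, ρ.2.2), by rw [RuleCode.toRule, hc]⟩

/-- The rules are listed without repetition, and each has a code. -/
theorem length_rules_le (hP : P.Fractional) (hc : P.Conjunctive) :
    P.rules.length ≤ Fintype.card P.RuleCode := by
  classical
  rw [← List.toFinset_card_of_nodup hc.1]
  refine (Finset.card_le_card (t := Finset.univ.image RuleCode.toRule) fun ρ h => ?_).trans
    Finset.card_image_le
  obtain ⟨c, rfl⟩ := exists_ruleCode hP hc (List.mem_toFinset.1 h)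
  exact Finset.mem_image_of_mem _ (Finset.mem_univ c)

theorem size_rule_le (c : P.RuleCode) : (P.encodeRule c.toRule).size ≤
    4 * (P.locations + P.stackSymbols + P.letters) + 107 * (P.clocks + 1) ^ 3 := by
  have h := c.2.1.size_le
  have h1 : 1 ≤ (P.clocks + 1) ^ 3 := Nat.one_le_pow _ _ (by omega)
  simp only [encodeRule, RuleCode.toRule, Data.size, size_unary, clocks] at *
  omega

/-- Number of rule codes times the largest size of a rule. The former is exponential in the clocks
only through the choice of a set of reset clocks or a conjunction, and the latter is polynomial in
all parameters. -/
theorem size_le (hP : P.Fractional) (hc : P.Conjunctive) :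
    P.encode.size ≤
      2 ^ (16 * (P.clocks + 1) ^ 4) * (P.locations + P.stackSymbols + P.letters + 2) ^ 16 := by
  have h1 : (Data.list (P.rules.map P.encodeRule)).size ≤ 1 + P.rules.length *
      (4 * (P.locations + P.stackSymbols + P.letters) + 107 * (P.clocks + 1) ^ 3 + 1) := by
    have := sz_list_le (l := P.rules.map P.encodeRule)
      (B := 4 * (P.locations + P.stackSymbols + P.letters) + 107 * (P.clocks + 1) ^ 3) fun d hd => by
      obtain ⟨ρ, hρ, rfl⟩ := List.mem_map.1 hd
      obtain ⟨c, rfl⟩ := exists_ruleCode hP hc hρ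
      exact size_rule_le c
    change (Data.list ((P.rules.map P.encodeRule).map id)).size ≤ _ at this
    rwa [List.map_id, List.length_map] at this
  have h2 := length_rules_le hP hc
  have h3 : Fintype.card P.RuleCode ≤ 2 ^ (4 * (P.clocks + 1) ^ 4) *
      (2 * (P.locations + P.stackSymbols + P.letters + 2) ^ 3) := by
    rw [Fintype.card_prod, Fintype.card_prod, Fintype.card_fin]
    have h := OpCode.card_le (s := P.letters) (g := P.stackSymbols) (m := P.globalClocks)
      (n := P.stackClocks)
    set W := P.locations + P.stackSymbols + P.letters + 2 with hW
    calc P.locations * (_ * P.locations) ≤ W * (2 ^ (4 * (P.clocks + 1) ^ 4) * (2 * W) * W) :=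
          Nat.mul_le_mul (by omega) (Nat.mul_le_mul (h.trans (Nat.mul_le_mul_left _ (by omega)))
            (by omega))
      _ = _ := by ring
  have h4 : P.encode.size = 2 * (P.locations + P.stackSymbols + P.letters + P.clocks) + 10 +
      (Data.list (P.rules.map P.encodeRule)).size := by
    simp only [encode, Data.size, size_unary, clocks]
    omega
  set W := P.locations + P.stackSymbols + P.letters + 2 with hW
  set n := P.clocks + 1 with hn
  set E := 2 ^ (4 * n ^ 4) with hE
  have h5 := Nat.mul_le_mul_right
    (4 * (P.locations + P.stackSymbols + P.letters) + 107 * n ^ 3 + 1) (h2.trans h3)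
  have hE1 : 1 ≤ E := Nat.one_le_two_pow
  have hn1 : 1 ≤ n ^ 3 := Nat.one_le_pow _ _ (by omega)
  have hn2 : n ≤ n ^ 3 := Nat.le_self_pow (by norm_num) _
  have hW2 : 8 ≤ W ^ 3 := by
    have : 2 ^ 3 ≤ W ^ 3 := Nat.pow_le_pow_left (by omega) 3
    simpa using this
  have h6 : 4 * (P.locations + P.stackSymbols + P.letters) + 107 * n ^ 3 + 1 ≤
      112 * (n ^ 3 * W) := by nlinarith
  have h7 : 2 * (P.locations + P.stackSymbols + P.letters + P.clocks) + 11 ≤ 11 * (n ^ 3 * W) := by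
    nlinarith
  have h8 : n ^ 3 ≤ 2 ^ (3 * n ^ 4) := by
    calc n ^ 3 ≤ (2 ^ n) ^ 3 := Nat.pow_le_pow_left Nat.lt_two_pow_self.le _
      _ = 2 ^ (3 * n) := by rw [← pow_mul, mul_comm]
      _ ≤ _ := Nat.pow_le_pow_right (by norm_num) (Nat.mul_le_mul_left _
        (Nat.le_self_pow (by norm_num) _))
  have h9 : 235 ≤ 2 ^ (8 * n ^ 4) := by
    have : 2 ^ (8 * 1) ≤ 2 ^ (8 * n ^ 4) := Nat.pow_le_pow_right (by norm_num)
      (Nat.mul_le_mul_left _ (Nat.one_le_pow _ _ (by omega)))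
    norm_num at this
    omega
  have hX : 1 ≤ n ^ 3 * W := Nat.mul_pos (by omega) (by omega)
  calc P.encode.size ≤ 11 * (n ^ 3 * W) + E * (2 * W ^ 3) * (112 * (n ^ 3 * W)) := by
        have := Nat.mul_le_mul_left (E * (2 * W ^ 3)) h6
        omega
    _ ≤ 235 * E * n ^ 3 * W ^ 4 := by
        have : 1 ≤ E * W ^ 3 := Nat.mul_pos hE1 (by omega)
        have := Nat.mul_le_mul_right (11 * (n ^ 3 * W)) this
        have e1 : E * W ^ 3 * (11 * (n ^ 3 * W)) = 11 * E * n ^ 3 * W ^ 4 := by ring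
        have e2 : E * (2 * W ^ 3) * (112 * (n ^ 3 * W)) = 224 * E * n ^ 3 * W ^ 4 := by ring
        rw [e1] at this
        rw [e2]
        nlinarith
    _ ≤ 2 ^ (8 * n ^ 4) * 2 ^ (4 * n ^ 4) * 2 ^ (3 * n ^ 4) * W ^ 16 :=
        Nat.mul_le_mul (Nat.mul_le_mul (Nat.mul_le_mul_right _ h9) h8)
          (Nat.pow_le_pow_right (by omega) (by norm_num))
    _ ≤ 2 ^ (16 * n ^ 4) * W ^ 16 := by
        refine Nat.mul_le_mul_right _ ?_
        rw [← pow_add, ← pow_add]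
        exact Nat.pow_le_pow_right (by norm_num) (by omega)

end TPDA

/-! ### Combination of correctness with the two time bounds -/

theorem mainTheorem4 :
    ∃ (p : TimedPDA.Prog) (c : ℕ), ∀ P : TPDA, P.Fractional →
      ∃ (ψ : P.Loc → P.Loc → TimedPDA.Formula) (t : ℕ),
        (∀ ℓ r, (ψ ℓ r).Existential) ∧
        P.FractExpressedBy ψ ∧
        TimedPDA.Runs p P.encode (P.encodeFamily ψ) t ∧
        t ≤ 2 ^ (P.clocks + 1) ^ c * P.encode.size ^ c ∧
        (P.Conjunctive →
          t ≤ 2 ^ (P.clocks + 1) ^ c *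
            (P.locations + P.stackSymbols + P.letters + 2) ^ c) := by
  obtain ⟨p, C, h⟩ := TPDA.exists_runs
  obtain ⟨c₁, h₁⟩ := TimedPDA.exists_absorb C 2
  -- The bound of `TPDA.size_le` with its exponents `16`, raised to the power `C`, and the factor `2
  -- ^ (C * n ^ 2)` of the running time combine to `17 * C`.
  obtain ⟨c₂, h₂⟩ := TimedPDA.exists_absorb (17 * C) 4
  refine ⟨p, max c₁ c₂, fun P hP => ?_⟩
  obtain ⟨t, hr, ht⟩ := h P
  refine ⟨P.formula, t, P.formula_existential, TPDA.formula_expresses hP, hr,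
    ht.trans (h₁ _ (le_max_left _ _) _ _ P.two_le_size), fun hc => ?_⟩
  refine ht.trans (le_trans ?_ (h₂ _ (le_max_right _ _) _ _ (by omega)))
  set n := P.clocks + 1 with hn
  set W := P.locations + P.stackSymbols + P.letters + 2 with hW
  calc 2 ^ (C * n ^ 2) * P.encode.size ^ C
      ≤ 2 ^ (C * n ^ 4) * (2 ^ (16 * n ^ 4) * W ^ 16) ^ C :=
        Nat.mul_le_mul (Nat.pow_le_pow_right (by norm_num) (Nat.mul_le_mul_left _
          (Nat.pow_le_pow_right (by omega) (by norm_num))))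
          (Nat.pow_le_pow_left (TPDA.size_le hP hc) _)
    _ = 2 ^ (17 * C * n ^ 4) * W ^ (16 * C) := by
        rw [mul_pow, ← pow_mul, ← pow_mul, ← mul_assoc, ← pow_add]
        congr 2
        ring
    _ ≤ 2 ^ (17 * C * n ^ 4) * W ^ (17 * C) :=
        Nat.mul_le_mul_left _ (Nat.pow_le_pow_right (by omega) (by omega))
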